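/- Let $n>1$. Equip $\mathbb R^{2n}=\mathbb R^n\oplus\mathbb R^n$ (coordinates $(x,y)$) with the standard symplectic form, and let $\mathrm{ASp}(2n,\mathbb R)=\mathrm{Sp}(2n,\mathbb R)\ltimes\mathbb R^{2n}$ be the affine symplectic group. Let $\mathcal{AL}(n,\mathbb R)$ be the manifold of affine Lagrangian subspaces of $\mathbb R^{2n}$ (translates of Lagrangian linear subspaces). For $T\in\mathrm{Symm}(n,\mathbb R)$, $\tau\in\mathbb R^n$ put $L_{T,\tau}=\{(Ty+\tau,y):y\in\mathbb R^n\}$; these subspaces form an open dense subset of $\mathcal{AL}(n,\mathbb R)$. For a Schwartz function $f\in\mathcal S(\mathbb R^{2n})$ (complex-valued) define the flat Lagrangian Radon transform $$\mathcal R_{flat}f(T,\tau)=\int_{\mathbb R^n}f(Ty+\tau,y)\,dy .$$ The Schwartz space $\mathcal S(\mathcal{AL}(n,\mathbb R))$ consists of all $C^\infty$ functions $F$ on $\mathcal{AL}(n,\mathbb R)$ such that for all elements $X_1,\dots,X_k$ ($k\ge 0$) of the Lie algebra of $\mathrm{ASp}(2n,\mathbb R)$, acting by the corresponding vector fields $L_{X_j}$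 on $\mathcal{AL}(n,\mathbb R)$, and for every integer $M\ge 0$, $$\sup_{P\in\mathcal{AL}(n,\mathbb R)}\ \mathrm{dist}(0,P)^{M}\,|L_{X_1}\cdots L_{X_k}F(P)|<\infty .$$ A function $h$ on $\mathrm{Symm}(n,\mathbb R)\times\mathbb R^n$ is said to be contained in this Schwartz space if there is $F\in\mathcal S(\mathcal{AL}(n,\mathbb R))$ with $$h(T,\tau)=\det(1+T^2)^{-1/2}\,F(L_{T,\tau})\qquad\text{for all }(T,\tau).$$ (In other words, $h$ is regarded as a function $H(L,\omega)$ of an affine Lagrangian subspace $L$ with a translation-invariant positive volume form $\omega$ on it, homogeneous of degree one in $\omega$, with $h(T,\tau)=H(L_{T,\tau},dy)$; and $F(L)=H(L,\mu_L)$, where $\mu_L=\det(1+T^2)^{1/2}dy$ is the Euclidean volume form of $L=L_{T,\tau}$.) The determinantal system $\mathfrak D_{flat}$ for a smooth function $h$ of $T=(t_{kl})$ and $\tau=(\tau_k)$ says that $h$ is annihilated by all $3\times3$ minors of the symmetric $(n+1)\times(n+1)$ matrix of constant coefficient differential operators $$\begin{pmatrix} 2\frac{\partial}{\partial t_{11}}&\frac{\partial}{\partial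 t_{12}}&\dots&\frac{\partial}{\partial t_{1n}}&\frac{\partial}{\partial\tau_1}\\ \frac{\partial}{\partial t_{12}}&2\frac{\partial}{\partial t_{22}}&\dots&\frac{\partial}{\partial t_{2n}}&\frac{\partial}{\partial\tau_2}\\ \vdots&\vdots&\ddots&\vdots&\vdots\\ \frac{\partial}{\partial t_{1n}}&\frac{\partial}{\partial t_{2n}}&\dots&2\frac{\partial}{\partial t_{nn}}&\frac{\partial}{\partial\tau_n}\\ \frac{\partial}{\partial\tau_1}&\frac{\partial}{\partial\tau_2}&\dots&\frac{\partial}{\partial\tau_n}&0 \end{pmatrix},$$ where the independent variables are $t_{kl}=t_{lk}$, $k\le l$, and $\tau_k$. **Theorem.** A function $h:\mathrm{Symm}(n,\mathbb R)\times\mathbb R^n\to\mathbb C$ is of the form $h=\mathcal R_{flat}f$ for some $f\in\mathcal S(\mathbb R^{2n})$ if and only if $h$ is contained in $\mathcal S(\mathcal{AL}(n,\mathbb R))$ in the above sense and $h$ satisfies the determinantal system $\mathfrak D_{flat}$. -/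

import Mathlib

open scoped ContDiff SchwartzMap Matrix

noncomputable section

namespace LagrangianRadon

/-! ### Phase space and affine Lagrangian subspaces -/

/-- The space `ℝ²ⁿ = ℝⁿ ⊕ ℝⁿ` with coordinates `(x, y)`: the coordinates `x` are indexed by
`Sum.inl`, the coordinates `y` by `Sum.inr`. -/
abbrev PhaseSpace (n : ℕ) : Type := EuclideanSpace ℝ (Fin n ⊕ Fin n)

/-- The point `(x, y)` of `ℝⁿ ⊕ ℝⁿ`. -/
def point {n : ℕ} (x y : Fin n → ℝ) : PhaseSpace n := WithLp.toLp 2 (Sum.elim x y)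

/-- The standard symplectic form, with matrix `(0 1; -1 0)`. -/
def symplForm {n : ℕ} (v w : PhaseSpace n) : ℝ :=
  WithLp.ofLp v ⬝ᵥ
    (Matrix.fromBlocks 0 1 (-1) 0 : Matrix (Fin n ⊕ Fin n) (Fin n ⊕ Fin n) ℝ) *ᵥ WithLp.ofLp w

/-- A linear subspace is Lagrangian if it is isotropic of dimension `n`. -/
def IsLagrangian {n : ℕ} (V : Submodule ℝ (PhaseSpace n)) : Prop :=
  (∀ v ∈ V, ∀ w ∈ V, symplForm v w = 0) ∧ Module.finrank ℝ V = n

/-- The affine Lagrangian Grassmannian: all translates of Lagrangian linear subspaces. -/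
def AL (n : ℕ) : Type :=
  {L : AffineSubspace ℝ (PhaseSpace n) // (L : Set (PhaseSpace n)).Nonempty ∧
    IsLagrangian L.direction}

/-- The Euclidean distance between the origin of `ℝ²ⁿ` and an affine Lagrangian subspace. -/
def AL.distZero {n : ℕ} (P : AL n) : ℝ := Metric.infDist 0 (P.1 : Set (PhaseSpace n))

/-! ### The affine symplectic group and its Lie algebra -/

/-- Matrices of size `2n + 1`. -/
abbrev AffMatrix (n : ℕ) : Type :=
  Matrix ((Fin n ⊕ Fin n) ⊕ Unit) ((Fin n ⊕ Fin n) ⊕ Unit) ℝ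

/-- The affine symplectic group `ASp(2n, ℝ)`: matrices `(A r; 0 1)` with `A` symplectic. -/
def ASp (n : ℕ) : Set (AffMatrix n) :=
  {g | g.toBlocks₁₁ ∈ Matrix.symplecticGroup (Fin n) ℝ ∧ g.toBlocks₂₁ = 0 ∧ g.toBlocks₂₂ = 1}

/-- The Lie algebra of `ASp(2n, ℝ)`: matrices `(X ξ; 0 0)` with `X` in `sp(2n, ℝ)`. -/
def aspLie (n : ℕ) : Set (AffMatrix n) :=
  {Y | Y.toBlocks₁₁ ∈ LieAlgebra.Symplectic.sp (Fin n) ℝ ∧ Y.toBlocks₂₁ = 0 ∧ Y.toBlocks₂₂ = 0}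

/-- The affine transformation `v ↦ A v + r` of `ℝ²ⁿ` given by the matrix `(A r; 0 1)`. -/
def affineAction {n : ℕ} (g : AffMatrix n) : PhaseSpace n →ᵃ[ℝ] PhaseSpace n :=
  (Matrix.toLpLin 2 2 g.toBlocks₁₁).toAffineMap +
    AffineMap.const ℝ (PhaseSpace n) (WithLp.toLp 2 fun i => g.toBlocks₁₂ i ())

theorem affineAction_linear {n : ℕ} (g : AffMatrix n) :
    (affineAction g).linear = Matrix.toLpLin 2 2 g.toBlocks₁₁ := by
  ext v; simp [affineAction]

theorem symplForm_toLpLin {n : ℕ} {A : Matrix (Fin n ⊕ Fin n) (Fin n ⊕ Fin n) ℝ}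
    (hA : A ∈ Matrix.symplecticGroup (Fin n) ℝ) (v w : PhaseSpace n) :
    symplForm (Matrix.toLpLin 2 2 A v) (Matrix.toLpLin 2 2 A w) = symplForm v w := by
  have hJ : (Matrix.fromBlocks 0 1 (-1) 0 : Matrix (Fin n ⊕ Fin n) (Fin n ⊕ Fin n) ℝ)
      = -Matrix.J (Fin n) ℝ := by
    simp [Matrix.J, Matrix.fromBlocks_neg]
  have h := SymplecticGroup.mem_iff'.1 hA
  simp only [symplForm, Matrix.ofLp_toLpLin, Matrix.toLin'_apply, hJ]
  rw [← Matrix.vecMul_transpose, ← Matrix.dotProduct_mulVec, Matrix.mulVec_mulVec,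
    Matrix.mulVec_mulVec, Matrix.mul_neg, Matrix.neg_mul, h]

theorem isLagrangian_map {n : ℕ} {A : Matrix (Fin n ⊕ Fin n) (Fin n ⊕ Fin n) ℝ}
    (hA : A ∈ Matrix.symplecticGroup (Fin n) ℝ) {V : Submodule ℝ (PhaseSpace n)}
    (hV : IsLagrangian V) : IsLagrangian (V.map (Matrix.toLpLin 2 2 A)) := by
  refine ⟨?_, ?_⟩
  · rintro _ ⟨v, hv, rfl⟩ _ ⟨w, hw, rfl⟩
    rw [symplForm_toLpLin hA]
    exact hV.1 v hv w hw
  · have hinj : Function.Injective (Matrix.toLpLin 2 2 A : PhaseSpace n →ₗ[ℝ] PhaseSpace n) := by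
      intro v w h
      have h' := congrArg WithLp.ofLp h
      simp only [Matrix.ofLp_toLpLin, Matrix.toLin'_apply] at h'
      have := Matrix.mulVec_injective_of_isUnit
        ((Matrix.isUnit_iff_isUnit_det A).2 (SymplecticGroup.symplectic_det hA)) h'
      exact (WithLp.ofLp_injective 2) this
    exact (Submodule.equivMapOfInjective _ hinj V).finrank_eq.symm.trans hV.2

/-- The action of `ASp(2n, ℝ)` on affine Lagrangian subspaces. -/
def AL.act {n : ℕ} (g : ASp n) (P : AL n) : AL n :=
  ⟨P.1.map (affineAction g.1), by
    obtain ⟨hne, hL⟩ := P.2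
    refine ⟨by simpa using hne, ?_⟩
    rw [AffineSubspace.map_direction, affineAction_linear]
    exact isLagrangian_map g.2.1 hL⟩

theorem exp_mem_symplecticGroup {n : ℕ} {X : Matrix (Fin n ⊕ Fin n) (Fin n ⊕ Fin n) ℝ}
    (hX : X ∈ LieAlgebra.Symplectic.sp (Fin n) ℝ) :
    NormedSpace.exp X ∈ Matrix.symplecticGroup (Fin n) ℝ := by
  have h : Xᵀ * Matrix.J (Fin n) ℝ = Matrix.J (Fin n) ℝ * (-X) := by
    have h' := (mem_skewAdjointMatricesLieSubalgebra _ _).1 hX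
    rw [mem_skewAdjointMatricesSubmodule] at h'
    exact h'
  have hJ := Matrix.isUnit_det_J (Fin n) ℝ
  have hXt : Xᵀ = -(Matrix.J (Fin n) ℝ * X * (Matrix.J (Fin n) ℝ)⁻¹) := by
    rw [← Matrix.mul_nonsing_inv_cancel_right _ Xᵀ hJ, h]
    simp
  rw [SymplecticGroup.mem_iff', ← Matrix.exp_transpose, hXt, Matrix.exp_neg,
    Matrix.exp_conj _ _ ((Matrix.isUnit_iff_isUnit_det _).2 hJ), Matrix.mul_inv_rev,
    Matrix.mul_inv_rev, Matrix.nonsing_inv_nonsing_inv _ hJ, Matrix.mul_assoc, Matrix.mul_assoc,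
    Matrix.mul_assoc, Matrix.nonsing_inv_mul_cancel_left _ _ hJ,
    Matrix.nonsing_inv_mul _
      ((Matrix.isUnit_iff_isUnit_det _).1 (Matrix.isUnit_exp X)), Matrix.mul_one]

open scoped Matrix.Norms.Operator in
theorem hasSum_exp {m : Type*} [Fintype m] [DecidableEq m] (A : Matrix m m ℝ) :
    HasSum (fun k : ℕ => ((k.factorial : ℝ)⁻¹) • A ^ k) (NormedSpace.exp A) :=
  NormedSpace.exp_series_hasSum_exp' A

theorem exp_apply {m : Type*} [Fintype m] [DecidableEq m] (A : Matrix m m ℝ) (i j : m) :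
    HasSum (fun k : ℕ => ((k.factorial : ℝ)⁻¹) * (A ^ k) i j) (NormedSpace.exp A i j) :=
  Pi.hasSum.1 (Pi.hasSum.1 (hasSum_exp A) i) j

theorem exp_mem_ASp {n : ℕ} {Y : AffMatrix n} (hY : Y ∈ aspLie n) (t : ℝ) :
    NormedSpace.exp (t • Y) ∈ ASp n := by
  obtain ⟨h1, h2, h3⟩ := hY
  set X := Y.toBlocks₁₁ with hX
  have hpow : ∀ k : ℕ, ∃ B, (t • Y) ^ k =
      Matrix.fromBlocks ((t • X) ^ k) B 0 (if k = 0 then 1 else 0) := by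
    intro k
    induction k with
    | zero => exact ⟨0, by simp⟩
    | succ k ih =>
      obtain ⟨B, hB⟩ := ih
      have hYb : t • Y = Matrix.fromBlocks (t • X) (t • Y.toBlocks₁₂) 0 0 := by
        conv_lhs => rw [← Matrix.fromBlocks_toBlocks Y, h2, h3]
        simp [Matrix.fromBlocks_smul, hX]
      refine ⟨(t • X) ^ k * (t • Y.toBlocks₁₂), ?_⟩
      rw [pow_succ, hB]
      conv_lhs => rw [hYb]
      rw [Matrix.fromBlocks_multiply]
      simp [pow_succ]
  refine ⟨?_, ?_, ?_⟩
  · have : (NormedSpace.exp (t • Y)).toBlocks₁₁ = NormedSpace.exp (t • X) := by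
      ext i j
      refine (exp_apply (t • Y) (Sum.inl i) (Sum.inl j)).unique ?_
      convert exp_apply (t • X) i j using 3 with k
      obtain ⟨B, hB⟩ := hpow k
      rw [hB, Matrix.fromBlocks_apply₁₁]
    rw [this]
    exact exp_mem_symplecticGroup (Submodule.smul_mem _ t h1)
  · ext i j
    refine (exp_apply (t • Y) (Sum.inr i) (Sum.inl j)).unique ?_
    convert hasSum_zero using 2 with k
    · obtain ⟨B, hB⟩ := hpow k
      rw [hB, Matrix.fromBlocks_apply₂₁]
      simp
    · rfl
  · ext i j
    refine (exp_apply (t • Y) (Sum.inr i) (Sum.inr j)).unique ?_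
    convert hasSum_ite_eq (0 : ℕ) (1 : ℝ) using 2 with k
    · obtain ⟨B, hB⟩ := hpow k
      rw [hB, Matrix.fromBlocks_apply₂₂]
      by_cases hk : k = 0 <;> simp [hk]
    · rfl

/-- The element `exp (t Y)` of the one-parameter subgroup of `ASp(2n, ℝ)` generated by `Y`. -/
def aspExp {n : ℕ} (Y : aspLie n) (t : ℝ) : ASp n :=
  ⟨NormedSpace.exp (t • Y.1), exp_mem_ASp Y.2 t⟩

/-- The derivative `L_Y F` of a function on the affine Lagrangian Grassmannian along the vector
field that an element `Y` of the Lie algebra of `ASp(2n, ℝ)` induces. -/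
def lieDeriv {n : ℕ} (Y : aspLie n) (F : AL n → ℂ) : AL n → ℂ :=
  fun P => deriv (fun t : ℝ => F (P.act (aspExp Y t))) 0

/-! ### Flat coordinates `(T, τ)` -/

/-- Symmetric real `n × n` matrices `T`, given by their coordinates `t_{kl} = t_{lk}`. -/
abbrev Symm (n : ℕ) : Type := Sym2 (Fin n) → ℝ

/-- The symmetric matrix with entries `t_{kl}`. -/
def Symm.toMatrix {n : ℕ} (T : Symm n) : Matrix (Fin n) (Fin n) ℝ :=
  Matrix.of fun k l => T s(k, l)

theorem Symm.isSymm_toMatrix {n : ℕ} (T : Symm n) : T.toMatrix.IsSymm := by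
  ext k l; simp [Symm.toMatrix, Sym2.eq_swap]

/-- The coordinates `t_{kl}` parametrize exactly the symmetric matrices. -/
def Symm.equivSymmetric (n : ℕ) :
    Symm n ≃ {A : Matrix (Fin n) (Fin n) ℝ // A.IsSymm} where
  toFun T := ⟨T.toMatrix, T.isSymm_toMatrix⟩
  invFun A := Sym2.lift ⟨fun k l => A.1 k l, fun k l => A.2.apply l k⟩
  left_inv T := by ext z; induction z with | _ k l => rfl
  right_inv A := by ext k l; rfl

/-- The linear map `y ↦ (T y, y)`. -/
def graphMap {n : ℕ} (T : Symm n) : (Fin n → ℝ) →ₗ[ℝ] PhaseSpace n where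
  toFun y := point (T.toMatrix *ᵥ y) y
  map_add' y z := by
    ext i; cases i <;> simp [point, Matrix.mulVec_add]
  map_smul' c y := by
    ext i; cases i <;> simp [point, Matrix.mulVec_smul]

theorem isLagrangian_range_graphMap {n : ℕ} (T : Symm n) :
    IsLagrangian (LinearMap.range (graphMap T)) := by
  refine ⟨?_, ?_⟩
  · rintro _ ⟨y, rfl⟩ _ ⟨z, rfl⟩
    have h : (T.toMatrix *ᵥ y) ⬝ᵥ z = y ⬝ᵥ (T.toMatrix *ᵥ z) := by
      rw [Matrix.dotProduct_mulVec, ← Matrix.mulVec_transpose, T.isSymm_toMatrix.eq]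
    simp [symplForm, graphMap, point, Matrix.fromBlocks_mulVec, Matrix.neg_mulVec, h]
  · have hinj : Function.Injective (graphMap T) := by
      intro y z h
      ext i
      exact congrArg (fun v : PhaseSpace n => v (Sum.inr i)) h
    rw [LinearMap.finrank_range_of_inj hinj]
    simp

/-- The affine Lagrangian subspace `x = T y + τ`. -/
def graphPlane {n : ℕ} (p : Symm n × (Fin n → ℝ)) : AL n :=
  ⟨AffineSubspace.mk' (point p.2 0) (LinearMap.range (graphMap p.1)),
    ⟨point p.2 0, AffineSubspace.self_mem_mk' _ _⟩, by
    rw [AffineSubspace.direction_mk']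
    exact isLagrangian_range_graphMap p.1⟩

/-! ### The Schwartz space of the affine Lagrangian Grassmannian -/

/-- `F` is of class `C^∞`: it is so in all the charts `(T, τ) ↦ g {x = T y + τ}`, where `g` is in
`ASp(2n, ℝ)`. The images of the pair `ℝⁿ ⊕ 0`, `0 ⊕ ℝⁿ` under `Sp(2n, ℝ)` are all the pairs of
transversal Lagrangian subspaces, so these charts are the usual atlas. -/
def IsSmooth {n : ℕ} (F : AL n → ℂ) : Prop :=
  ∀ g : ASp n, ContDiff ℝ ∞ fun p : Symm n × (Fin n → ℝ) => F ((graphPlane p).act g)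

/-- The Schwartz space `S(AL(n, ℝ))`: smooth functions `F` such that every iterated derivative
`L_{Y₁} ⋯ L_{Yₖ} F`, `k ≥ 0`, is `O(dist(0, P)^{-M})` for every `M`. -/
def IsSchwartz {n : ℕ} (F : AL n → ℂ) : Prop :=
  IsSmooth F ∧ ∀ (Ys : List (aspLie n)) (M : ℕ), ∃ C : ℝ, ∀ P : AL n,
    P.distZero ^ M * ‖Ys.foldr lieDeriv F P‖ ≤ C

/-- Membership of a function `h(T, τ)` of the flat coordinates in the Schwartz space.
The flat coordinates describe only the open dense set of planes `L = {x = T y + τ}`, and there `h`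
stands for the function `H(L, ω)` of a plane with a translation invariant positive volume form,
homogeneous of degree one in `ω`, with `h(T, τ) = H(L, dy)`. The Euclidean volume form of `L` is
`μ_L = det(1 + T²)^{1/2} dy`, so that `h(T, τ) = det(1 + T²)^{-1/2} F(L)` with `F(L) = H(L, μ_L)`.
The condition is that `F` extends to a function in the Schwartz space on all of `AL(n, ℝ)`. -/
def MemSchwartzFlat {n : ℕ} (h : Symm n × (Fin n → ℝ) → ℂ) : Prop :=
  ∃ F : AL n → ℂ, IsSchwartz F ∧ ∀ (T : Symm n) (τ : Fin n → ℝ),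
    h (T, τ) = ((√(1 + T.toMatrix ^ 2).det)⁻¹ : ℝ) • F (graphPlane (T, τ))

/-! ### The Radon transform and the determinantal system -/

/-- The Lagrangian Radon transform `∫ f(T y + τ, y) dy` in flat coordinates. -/
def radonFlat {n : ℕ} (f : 𝓢(PhaseSpace n, ℂ)) (p : Symm n × (Fin n → ℝ)) : ℂ :=
  ∫ y : Fin n → ℝ, f (point (p.1.toMatrix *ᵥ y + p.2) y)

/-- The directions of the entries of the matrix of partial derivatives: the entry `(k, l)` is
`∂/∂t_{kl}` for `k ≠ l` and `2 ∂/∂t_{kk}` for `k = l`, the last row and the last column consist of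
the `∂/∂τ_k`, and the last diagonal entry is zero. -/
def entryDir {n : ℕ} : Fin n ⊕ Unit → Fin n ⊕ Unit → Symm n × (Fin n → ℝ)
  | Sum.inl k, Sum.inl l => ((if k = l then (2 : ℝ) else 1) • Pi.single s(k, l) 1, 0)
  | Sum.inl k, Sum.inr _ => (0, Pi.single k 1)
  | Sum.inr _, Sum.inl l => (0, Pi.single l 1)
  | Sum.inr _, Sum.inr _ => 0

/-- The entry of the matrix of partial derivatives as an operator: the derivative in the direction
`entryDir i j`. -/
def entryOp {n : ℕ} (i j : Fin n ⊕ Unit) (h : Symm n × (Fin n → ℝ) → ℂ) :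
    Symm n × (Fin n → ℝ) → ℂ :=
  fun p => fderiv ℝ h p (entryDir i j)

/-- The `3 × 3` minor with rows `r` and columns `c`, as a differential operator: the Leibniz
expansion of the determinant, with products of entries read as compositions. -/
def minorOp {n : ℕ} (r c : Fin 3 → Fin n ⊕ Unit) (h : Symm n × (Fin n → ℝ) → ℂ) :
    Symm n × (Fin n → ℝ) → ℂ :=
  fun p => ∑ σ : Equiv.Perm (Fin 3), ((Equiv.Perm.sign σ : ℤ) : ℂ) *
    entryOp (r 0) (c (σ 0)) (entryOp (r 1) (c (σ 1)) (entryOp (r 2) (c (σ 2)) h)) p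

/-- The determinantal system: `h` is annihilated by all `3 × 3` minors. -/
def SatisfiesDeterminantal {n : ℕ} (h : Symm n × (Fin n → ℝ) → ℂ) : Prop :=
  ∀ r c : Fin 3 → Fin n ⊕ Unit, Function.Injective r → Function.Injective c →
    ∀ p, minorOp r c h p = 0

end LagrangianRadon

end

/-! Necessity. A shift of the plane in the direction (S, σ) shifts its point over y by (Sy + σ, 0).
So the entries of the matrix in the determinantal system act on `f` as X_i Y_j + X_j Y_i with X =
(∂/∂x_i, 0) and Y = (y_j, 1). All these operators commute, and a matrix of this form has rank at
most two, so its 3 × 3 minors vanish (`sum_sign_entryEnd`). For the Schwartz condition take F =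
`radonAL f`, the integral over the plane for the Euclidean volume. The Gaussian exp(-π|v|²) has
integral 1 over every Lagrangian direction, so in any linear parametrization F is a quotient of two
integrals whose denominator is a Gaussian integral (`radonAL_mul`). This gives smoothness in all
charts. The quotient rule keeps Lie derivatives inside a class of functions with uniform decay
(`RadonClass`).

Sufficiency rests on the slice theorem `fourierTau_radonFlat`: the Fourier transform in τ of a Radon
transform is the restriction of the Fourier transform of `f` to {(ξ, -Tξ)}. Given `h`, one looks for
a Schwartz function G on phase space with ĥ(T, ξ) = G(ξ, -Tξ). After the Fourier transform, the
minors containing the last row and column say that ĥ is constant in the directions S with Sξ = 0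
(`fderiv_fourierTau_eq_zero`). So for ξ ≠ 0 the value ĥ(T, ξ) depends on (ξ, Tξ) only, and G is
defined where ξ ≠ 0. The second chart y = Tx + τ of the Grassmannian supplies G on the subspaces
{(-Tη, η)}, and the two definitions fit together (`hasSlices_phaseFunction`). Since a bounded T
suffices to join ξ to any η with |η| ≤ |ξ|, estimates that are locally uniform in T give smoothness
off the origin and rapid decay.

The origin is the delicate point. For n > 1 any two symmetric matrices are joined by a chain in
which neighbours agree on a nonzero vector, so ĥ(T, 0) is independent of T and G extends
continuously (`HasSlices.exists_value`). The property of having slices passes to first derivatives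
of G. The T-derivative of ĥ along 2E_kk is -2ξ_k ∂G/∂η_k, and division by ξ_k amounts to taking a
primitive in τ_k, which decays because the integrals over full lines vanish (`exists_fderiv_left`,
`rapidDecay_lineInt`). Hence the derivatives of G also have limits at the origin, so G is
differentiable there, and iteration makes G a Schwartz function. Its inverse Fourier transform is
the required `f`. -/

namespace LagrangianRadon

open MeasureTheory Filter Topology

variable {n : ℕ}

/-! ### Classes of functions closed under directional derivatives -/

section Closed

variable {E F : Type*} [NormedAddCommGroup E] [NormedSpace ℝ E] [NormedAddCommGroup F]
  [NormedSpace ℝ F]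

/-- Induction on the order of differentiability. Working with a whole class stable under directional
derivatives avoids explicit formulas for higher derivatives; only a first derivative is ever
computed. -/
theorem contDiff_of_closed [FiniteDimensional ℝ E] (S : (E → F) → Prop)
    (h : ∀ g, S g → Differentiable ℝ g ∧ ∀ w, S fun p => fderiv ℝ g p w) {g : E → F} (hg : S g) :
    ContDiff ℝ ∞ g := by
  rw [contDiff_infty]
  intro n
  induction n generalizing g with
  | zero => exact contDiff_zero.2 (h g hg).1.continuous
  | succ n ih =>
    have : ((n + 1 : ℕ) : WithTop ℕ∞) = (n : WithTop ℕ∞) + 1 := by push_cast; rfl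
    rw [this, contDiff_succ_iff_fderiv]
    refine ⟨(h g hg).1, fun hn => by simp at hn, contDiff_clm_apply_iff.2 fun w => ih ((h g hg).2 w)⟩

/-- Decay of order zero for all members of the class is enough: the derivative of order n + 1 of `g`
is assembled from derivatives of order n of its partial derivatives along a basis, and these are
again in the class. -/
theorem exists_schwartz_of_closed [FiniteDimensional ℝ E] (S : (E → F) → Prop)
    (h : ∀ g, S g → Differentiable ℝ g ∧ (∀ k : ℕ, ∃ C : ℝ, ∀ x, ‖x‖ ^ k * ‖g x‖ ≤ C) ∧
      ∀ w, S fun p => fderiv ℝ g p w) {g : E → F} (hg : S g) :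
    ∃ f : 𝓢(E, F), ⇑f = g := by
  have hs : ∀ g, S g → ContDiff ℝ ∞ g := fun g hg =>
    contDiff_of_closed S (fun g hg => ⟨(h g hg).1, (h g hg).2.2⟩) hg
  refine ⟨⟨g, hs g hg, fun k n => ?_⟩, rfl⟩
  induction n generalizing g with
  | zero =>
    obtain ⟨C, hC⟩ := (h g hg).2.1 k
    exact ⟨C, fun x => by simpa using hC x⟩
  | succ n ih =>
    let b := Module.finBasis ℝ E
    let L : Fin (Module.finrank ℝ E) → F →L[ℝ] E →L[ℝ] F := fun i =>
      (ContinuousLinearMap.smulRightL ℝ E F) (LinearMap.toContinuousLinearMap (b.coord i))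
    have hL : ∀ i y w, L i y w = b.repr w i • y := fun i y w => rfl
    have hfd : fderiv ℝ g = fun x => ∑ i, L i (fderiv ℝ g x (b i)) := by
      funext x
      ext w
      rw [sum_apply]
      simp_rw [hL, ← map_smul]
      rw [← map_sum, b.sum_repr]
    choose C hC using fun i => ih ((h g hg).2.2 (b i))
    refine ⟨∑ i, ‖L i‖ * C i, fun x => ?_⟩
    have hgi : ∀ i, ContDiff ℝ n fun x => fderiv ℝ g x (b i) := fun i =>
      (hs _ ((h g hg).2.2 (b i))).of_le (by exact_mod_cast le_top)
    have hsum : iteratedFDeriv ℝ n (fun x => ∑ i, L i (fderiv ℝ g x (b i))) x =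
        ∑ i, iteratedFDeriv ℝ n (fun x => L i (fderiv ℝ g x (b i))) x :=
      iteratedFDeriv_fun_sum_apply (fun i _ => ((L i).contDiff.comp (hgi i)).contDiffAt)
    rw [← norm_iteratedFDeriv_fderiv, hfd, hsum]
    calc ‖x‖ ^ k * ‖∑ i, iteratedFDeriv ℝ n (fun x => L i (fderiv ℝ g x (b i))) x‖
        ≤ ‖x‖ ^ k * ∑ i, ‖L i‖ * ‖iteratedFDeriv ℝ n (fun x => fderiv ℝ g x (b i)) x‖ := by
          gcongr
          refine (norm_sum_le _ _).trans (Finset.sum_le_sum fun i _ => ?_)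
          exact (L i).norm_iteratedFDeriv_comp_left (hgi i).contDiffAt le_rfl
      _ = ∑ i, ‖L i‖ * (‖x‖ ^ k * ‖iteratedFDeriv ℝ n (fun x => fderiv ℝ g x (b i)) x‖) := by
          rw [Finset.mul_sum]; exact Finset.sum_congr rfl fun i _ => by ring
      _ ≤ _ := Finset.sum_le_sum fun i _ => by gcongr; exact hC i x

theorem schwartz_one_add_decay (f : 𝓢(E, F)) (k : ℕ) :
    ∃ C : ℝ, 0 ≤ C ∧ ∀ x, (1 + ‖x‖) ^ k * ‖f x‖ ≤ C := by
  have := SchwartzMap.one_add_le_sup_seminorm_apply (𝕜 := ℝ) (m := (k, 0)) le_rfl le_rfl f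
  simp only [norm_iteratedFDeriv_zero] at this
  exact ⟨_, by positivity, this⟩

end Closed

/-! ### Integrals depending on a parameter -/

section Parametric

theorem norm_le_of_decay {V F : Type*} [NormedAddCommGroup V] [NormedAddCommGroup F] {r : ℕ} {C : ℝ}
    {a : F} {y : V} (h : (1 + ‖y‖) ^ r * ‖a‖ ≤ C) : ‖a‖ ≤ C * ((1 + ‖y‖) ^ r)⁻¹ := by
  rw [← div_eq_mul_inv, le_div_iff₀ (by positivity), mul_comm]
  exact h


theorem integrable_one_add_norm_pow {V : Type*} [NormedAddCommGroup V] [NormedSpace ℝ V]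
    [FiniteDimensional ℝ V] [MeasurableSpace V] [BorelSpace V] {μ : Measure V} [μ.IsAddHaarMeasure]
    {r : ℕ} (hr : Module.finrank ℝ V < r) : Integrable (fun y : V => ((1 + ‖y‖) ^ r)⁻¹) μ := by
  have := integrable_one_add_norm (μ := μ) (E := V) (r := r) (by exact_mod_cast hr)
  refine this.congr (Eventually.of_forall fun y => ?_)
  simp only
  rw [Real.rpow_neg (by positivity), Real.rpow_natCast]

variable {V : Type*} [NormedAddCommGroup V] [MeasurableSpace V] {μ : Measure V}
  {F : Type*} [NormedAddCommGroup F]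

theorem integrable_of_decay [BorelSpace V] [SecondCountableTopology V] {r : ℕ}
    (hr : Integrable (fun y : V => ((1 + ‖y‖) ^ r)⁻¹) μ) {φ : V → F} {C : ℝ}
    (hφ : Continuous φ) (hb : ∀ y, (1 + ‖y‖) ^ r * ‖φ y‖ ≤ C) : Integrable φ μ :=
  (hr.const_mul C).mono' hφ.aestronglyMeasurable (Eventually.of_forall fun y => norm_le_of_decay (hb y))

variable [NormedSpace ℝ F]

theorem norm_integral_le_of_decay {r : ℕ}
    (hr : Integrable (fun y : V => ((1 + ‖y‖) ^ r)⁻¹) μ) {φ : V → F} {C : ℝ}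
    (hb : ∀ y, (1 + ‖y‖) ^ r * ‖φ y‖ ≤ C) :
    ‖∫ y, φ y ∂μ‖ ≤ C * ∫ y : V, ((1 + ‖y‖) ^ r)⁻¹ ∂μ := by
  rw [← integral_const_mul]
  exact norm_integral_le_of_norm_le (hr.const_mul C)
    (Eventually.of_forall fun y => norm_le_of_decay (hb y))

/-- Dominated convergence with a multiple of (1 + |y|)^(-r) as the majorant. -/
theorem hasFDerivAt_integral_of_decay [BorelSpace V] [SecondCountableTopology V] {H : Type*}
    [NormedAddCommGroup H] [NormedSpace ℝ H] {φ : H → V → F} {φ' : H → V → H →L[ℝ] F} {p₀ : H}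
    {C C₀ ε : ℝ} (hε : 0 < ε) {r : ℕ} (hr : Integrable (fun y : V => ((1 + ‖y‖) ^ r)⁻¹) μ)
    (hc : ∀ p, Continuous (φ p)) (hc' : Continuous (φ' p₀))
    (hd : ∀ p ∈ Metric.ball p₀ ε, ∀ y, HasFDerivAt (fun p => φ p y) (φ' p y) p)
    (hb₀ : ∀ y, (1 + ‖y‖) ^ r * ‖φ p₀ y‖ ≤ C₀)
    (hb : ∀ p ∈ Metric.ball p₀ ε, ∀ y, (1 + ‖y‖) ^ r * ‖φ' p y‖ ≤ C) :
    HasFDerivAt (fun p => ∫ y, φ p y ∂μ) (∫ y, φ' p₀ y ∂μ) p₀ :=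
  hasFDerivAt_integral_of_dominated_of_fderiv_le (Metric.ball_mem_nhds p₀ hε)
    (Eventually.of_forall fun p => (hc p).aestronglyMeasurable)
    (integrable_of_decay hr (hc p₀) hb₀) hc'.aestronglyMeasurable
    (Eventually.of_forall fun y p hp => norm_le_of_decay (hb p hp y))
    (hr.const_mul C)
    (Eventually.of_forall fun y p hp => hd p hp y)

end Parametric

/-! ### The Gaussian -/

section Gaussian

variable {E : Type*} [NormedAddCommGroup E] [InnerProductSpace ℝ E]

theorem hasFDerivAt_gaussian (x : E) :
    HasFDerivAt (fun x : E => ((Real.exp (-Real.pi * ‖x‖ ^ 2) : ℝ) : ℂ))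
      ((Complex.ofRealCLM.comp
        ((Real.exp (-Real.pi * ‖x‖ ^ 2)) • ((-Real.pi) • (2 : ℝ) • innerSL ℝ x)))) x := by
  have h := ((hasStrictFDerivAt_norm_sq x).hasFDerivAt.const_mul (-Real.pi)).exp
  have h2 : HasFDerivAt (fun x : E => Real.exp (-Real.pi * ‖x‖ ^ 2))
      (Real.exp (-Real.pi * ‖x‖ ^ 2) • ((-Real.pi) • (2 : ℝ) • innerSL ℝ x)) x := by
    convert h using 3
    ext w; simp [two_smul]
  exact Complex.ofRealCLM.hasFDerivAt.comp x h2

theorem one_add_pow_mul_exp_le (k : ℕ) :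
    ∃ C : ℝ, ∀ t : ℝ, 0 ≤ t → (1 + t) ^ k * Real.exp (-Real.pi * t ^ 2) ≤ C := by
  -- The constant comes from (1 + t)^k ≤ k! exp(1 + t) together with 1 + t - πt² ≤ 2.
  refine ⟨k.factorial * Real.exp 2, fun t ht => ?_⟩
  have h1 : (1 + t) ^ k ≤ k.factorial * Real.exp (1 + t) := by
    have := Real.pow_div_factorial_le_exp (1 + t) (by positivity) k
    rwa [div_le_iff₀ (by positivity), mul_comm] at this
  calc (1 + t) ^ k * Real.exp (-Real.pi * t ^ 2)
      ≤ k.factorial * Real.exp (1 + t) * Real.exp (-Real.pi * t ^ 2) := by gcongr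
    _ = k.factorial * Real.exp (1 + t - Real.pi * t ^ 2) := by
        rw [mul_assoc, ← Real.exp_add]; ring_nf
    _ ≤ _ := by
        gcongr
        nlinarith [Real.pi_gt_three, sq_nonneg (t - 1), mul_nonneg ht ht]

theorem hasTemperateGrowth_fderiv_apply {E F : Type*} [NormedAddCommGroup E] [NormedSpace ℝ E]
    [NormedAddCommGroup F] [NormedSpace ℝ F] {p : E → F} (hp : p.HasTemperateGrowth) (w : E) :
    (fun x => fderiv ℝ p x w).HasTemperateGrowth := by
  have h1 : (fderiv ℝ p).HasTemperateGrowth := by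
    refine ⟨hp.1.fderiv_right (by simp), fun n => ?_⟩
    simp_rw [norm_iteratedFDeriv_fderiv]
    exact hp.2 (n + 1)
  exact (ContinuousLinearMap.apply ℝ F w).hasTemperateGrowth.comp h1

theorem exists_gaussian (E : Type*) [NormedAddCommGroup E] [InnerProductSpace ℝ E]
    [FiniteDimensional ℝ E] :
    ∃ f : 𝓢(E, ℂ), ∀ x, f x = ((Real.exp (-Real.pi * ‖x‖ ^ 2) : ℝ) : ℂ) := by
  -- The stable class consists of the products of the Gaussian with functions of temperate growth.
  have := exists_schwartz_of_closed (E := E) (F := ℂ)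
    (fun g => ∃ p : E → ℂ, p.HasTemperateGrowth ∧
      g = fun x => p x * ((Real.exp (-Real.pi * ‖x‖ ^ 2) : ℝ) : ℂ)) ?_
    (g := fun x => 1 * ((Real.exp (-Real.pi * ‖x‖ ^ 2) : ℝ) : ℂ))
    ⟨fun _ => 1, .const _, rfl⟩
  · obtain ⟨f, hf⟩ := this
    exact ⟨f, fun x => by simpa using congrFun hf x⟩
  · rintro _ ⟨p, hp, rfl⟩
    have hpd : Differentiable ℝ p := hp.1.differentiable (by simp)
    have hd : ∀ x, HasFDerivAt (fun x => p x * ((Real.exp (-Real.pi * ‖x‖ ^ 2) : ℝ) : ℂ)) _ x :=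
      fun x => (hpd x).hasFDerivAt.mul (hasFDerivAt_gaussian x)
    refine ⟨fun x => (hd x).differentiableAt, fun k => ?_, fun w => ?_⟩
    · obtain ⟨m, C, hC⟩ := hp.2 0
      obtain ⟨D, hD⟩ := one_add_pow_mul_exp_le (k + m)
      refine ⟨|C| * D, fun x => ?_⟩
      have h1 : ‖p x‖ ≤ |C| * (1 + ‖x‖) ^ m := by
        have := hC x
        rw [norm_iteratedFDeriv_zero] at this
        exact this.trans (by gcongr; exact le_abs_self C)
      rw [norm_mul, Complex.norm_real, Real.norm_eq_abs, Real.abs_exp]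
      calc ‖x‖ ^ k * (‖p x‖ * Real.exp (-Real.pi * ‖x‖ ^ 2))
          ≤ (1 + ‖x‖) ^ k * (|C| * (1 + ‖x‖) ^ m * Real.exp (-Real.pi * ‖x‖ ^ 2)) := by
            gcongr; linarith
        _ = |C| * ((1 + ‖x‖) ^ (k + m) * Real.exp (-Real.pi * ‖x‖ ^ 2)) := by ring
        _ ≤ _ := by gcongr; exact hD _ (norm_nonneg x)
    · refine ⟨fun x => fderiv ℝ p x w + p x * ((-Real.pi * (2 * inner ℝ x w) : ℝ) : ℂ), ?_, ?_⟩
      · refine .add ?_ (hp.mul ?_)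
        · exact hasTemperateGrowth_fderiv_apply hp w
        · have h2 : (fun x : E => ((-Real.pi * (2 * inner ℝ x w) : ℝ) : ℂ)) =
              (Complex.ofRealCLM.comp ((-Real.pi) • (2 : ℝ) • innerSL ℝ w) : E →L[ℝ] ℂ) := by
            funext x
            simp [real_inner_comm]
          rw [h2]
          exact ContinuousLinearMap.hasTemperateGrowth _
      · funext x
        rw [(hd x).fderiv]
        simp
        ring

end Gaussian

/-! ### Coordinates on phase space -/

/-- The continuous linear equivalence `(x, y) ↦ point x y`. -/
noncomputable def pointE (n : ℕ) : ((Fin n → ℝ) × (Fin n → ℝ)) ≃L[ℝ] PhaseSpace n :=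
  LinearEquiv.toContinuousLinearEquiv
    { toFun := fun p => point p.1 p.2
      invFun := fun v => (fun i => v (Sum.inl i), fun i => v (Sum.inr i))
      map_add' := fun p q => by ext i; cases i <;> simp [point]
      map_smul' := fun c p => by ext i; cases i <;> simp [point]
      left_inv := fun p => rfl
      right_inv := fun v => by ext i; cases i <;> rfl }

@[simp]
theorem pointE_apply (p : (Fin n → ℝ) × (Fin n → ℝ)) : pointE n p = point p.1 p.2 := rfl

@[simp]
theorem point_inl (x y : Fin n → ℝ) (i : Fin n) : point x y (Sum.inl i) = x i := rfl

@[simp]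
theorem point_inr (x y : Fin n → ℝ) (i : Fin n) : point x y (Sum.inr i) = y i := rfl

theorem norm_le_norm_point_left (x y : Fin n → ℝ) : ‖x‖ ≤ ‖point x y‖ :=
  (pi_norm_le_iff_of_nonneg (norm_nonneg _)).2 fun i =>
    PiLp.norm_apply_le (point x y) (Sum.inl i)

theorem norm_le_norm_point_right (x y : Fin n → ℝ) : ‖y‖ ≤ ‖point x y‖ :=
  (pi_norm_le_iff_of_nonneg (norm_nonneg _)).2 fun i =>
    PiLp.norm_apply_le (point x y) (Sum.inr i)

theorem continuous_point : Continuous fun p : (Fin n → ℝ) × (Fin n → ℝ) => point p.1 p.2 :=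
  (pointE n).continuous

theorem norm_point_le : ∃ C : ℝ, 0 ≤ C ∧ ∀ x y : Fin n → ℝ, ‖point x y‖ ≤ C * (‖x‖ + ‖y‖) := by
  refine ⟨‖(pointE n).toContinuousLinearMap‖, norm_nonneg _, fun x y => ?_⟩
  refine ((pointE n).toContinuousLinearMap.le_opNorm (x, y)).trans ?_
  gcongr
  exact max_le (by simp) (by simp)

theorem Symm.toMatrix_add (S T : Symm n) : (S + T).toMatrix = S.toMatrix + T.toMatrix := rfl

theorem Symm.toMatrix_smul (c : ℝ) (T : Symm n) : (c • T).toMatrix = c • T.toMatrix := rfl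

theorem Symm.toMatrix_zero : (0 : Symm n).toMatrix = 0 := rfl

theorem Symm.toMatrix_neg (T : Symm n) : (-T).toMatrix = -T.toMatrix := rfl

theorem Symm.norm_mulVec_le (T : Symm n) (y : Fin n → ℝ) :
    ‖T.toMatrix *ᵥ y‖ ≤ n * ‖T‖ * ‖y‖ := by
  refine (pi_norm_le_iff_of_nonneg (by positivity)).2 fun i => ?_
  calc ‖(T.toMatrix *ᵥ y) i‖ ≤ ∑ j, ‖T.toMatrix i j * y j‖ :=
        norm_sum_le Finset.univ fun j => T.toMatrix i j * y j
    _ ≤ ∑ _j : Fin n, ‖T‖ * ‖y‖ := Finset.sum_le_sum fun j _ => by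
        rw [norm_mul]
        exact mul_le_mul (norm_le_pi_norm T s(i, j)) (norm_le_pi_norm y j) (norm_nonneg _)
          (norm_nonneg _)
    _ = n * ‖T‖ * ‖y‖ := by simp [mul_assoc]

/-- The direction in which the point of the plane with parameter `y` moves, as a function of the
direction in which the plane moves. -/
noncomputable def dirMap (y : Fin n → ℝ) : (Symm n × (Fin n → ℝ)) →L[ℝ] PhaseSpace n :=
  LinearMap.toContinuousLinearMap
    { toFun := fun w => point (w.1.toMatrix *ᵥ y + w.2) 0
      map_add' := fun v w => by
        ext i; cases i <;> simp [Symm.toMatrix_add, Matrix.add_mulVec]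
        ring
      map_smul' := fun c w => by
        ext i; cases i <;> simp [Symm.toMatrix_smul, Matrix.smul_mulVec, mul_add] }

theorem dirMap_apply (y : Fin n → ℝ) (w : Symm n × (Fin n → ℝ)) :
    dirMap y w = point (w.1.toMatrix *ᵥ y + w.2) 0 := rfl

theorem norm_dirMap_le : ∃ C : ℝ, 0 ≤ C ∧ ∀ y : Fin n → ℝ, ‖dirMap y‖ ≤ C * (1 + ‖y‖) := by
  obtain ⟨C, hC0, hC⟩ := norm_point_le (n := n)
  refine ⟨C * (n + 1), by positivity, fun y => ?_⟩
  refine ContinuousLinearMap.opNorm_le_bound _ (by positivity) fun w => ?_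
  rw [dirMap_apply]
  calc ‖point (w.1.toMatrix *ᵥ y + w.2) 0‖
      ≤ C * (‖w.1.toMatrix *ᵥ y + w.2‖ + ‖(0 : Fin n → ℝ)‖) := hC _ _
    _ ≤ C * (n * ‖w‖ * ‖y‖ + ‖w‖) := by
        rw [norm_zero, add_zero]
        gcongr
        refine (norm_add_le _ _).trans (add_le_add ((w.1.norm_mulVec_le y).trans ?_) (norm_snd_le w))
        gcongr
        exact norm_fst_le w
    _ ≤ C * (n + 1) * (1 + ‖y‖) * ‖w‖ := by
        have : n * ‖w‖ * ‖y‖ + ‖w‖ ≤ (n + 1) * (1 + ‖y‖) * ‖w‖ := by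
          have h1 : 0 ≤ (n : ℝ) * ‖w‖ := by positivity
          have h2 : 0 ≤ ‖y‖ * ‖w‖ := by positivity
          nlinarith
        calc _ ≤ C * ((n + 1) * (1 + ‖y‖) * ‖w‖) := by gcongr
          _ = _ := by ring

theorem chart_eq (p : Symm n × (Fin n → ℝ)) (y : Fin n → ℝ) :
    point (p.1.toMatrix *ᵥ y + p.2) y = dirMap y p + point 0 y := by
  ext i; cases i <;> simp [dirMap_apply]

theorem continuous_chart (p : Symm n × (Fin n → ℝ)) :
    Continuous fun y => point (p.1.toMatrix *ᵥ y + p.2) y := by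
  have h : Continuous fun y : Fin n → ℝ => p.1.toMatrix *ᵥ y + p.2 := by fun_prop
  exact continuous_point.comp (h.prodMk continuous_id)

/-! ### Derivatives of Schwartz functions along vector fields of temperate growth -/

/-- The derivative of `f` along the vector field `g`. -/
noncomputable def derivAlong {E : Type*} [NormedAddCommGroup E] [NormedSpace ℝ E] {g : E → E}
    (hg : g.HasTemperateGrowth) (f : 𝓢(E, ℂ)) : 𝓢(E, ℂ) :=
  SchwartzMap.bilinLeftCLM (ContinuousLinearMap.id ℝ (E →L[ℝ] ℂ)) hg (SchwartzMap.fderivCLM ℝ E ℂ f)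

theorem derivAlong_apply {E : Type*} [NormedAddCommGroup E] [NormedSpace ℝ E] {g : E → E}
    (hg : g.HasTemperateGrowth) (f : 𝓢(E, ℂ)) (x : E) : derivAlong hg f x = fderiv ℝ f x (g x) := rfl

theorem hasTemperateGrowth_shear (w : Symm n × (Fin n → ℝ)) :
    (fun v : PhaseSpace n => dirMap (fun i => v (Sum.inr i)) w).HasTemperateGrowth := by
  have h : (fun v : PhaseSpace n => dirMap (fun i => v (Sum.inr i)) w) =
      fun v => (LinearMap.toContinuousLinearMap
        { toFun := fun v : PhaseSpace n => point (w.1.toMatrix *ᵥ fun i => v (Sum.inr i)) 0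
          map_add' := fun v v' => by
            ext i
            cases i
            · simp [← Pi.add_def, Matrix.mulVec_add]
            · simp
          map_smul' := fun (c : ℝ) v => by
            ext i
            cases i
            · exact congrFun (Matrix.mulVec_smul w.1.toMatrix c fun i => v (Sum.inr i)) _
            · simp }) v + point w.2 0 := by
    funext v; ext i; cases i <;> simp [dirMap_apply]
  rw [h]
  exact (ContinuousLinearMap.hasTemperateGrowth _).add (.const _)

/-! ### Smoothness of the Radon transform -/

theorem hasFDerivAt_radonFlat (f : 𝓢(PhaseSpace n, ℂ)) (p : Symm n × (Fin n → ℝ)) :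
    HasFDerivAt (radonFlat f)
      (∫ y : Fin n → ℝ, (fderiv ℝ f (point (p.1.toMatrix *ᵥ y + p.2) y)).comp (dirMap y)) p ∧
    Integrable fun y : Fin n → ℝ =>
      (fderiv ℝ f (point (p.1.toMatrix *ᵥ y + p.2) y)).comp (dirMap y) := by
  obtain ⟨D, hD0, hD⟩ := norm_dirMap_le (n := n)
  have hr : Integrable fun y : Fin n → ℝ => ((1 + ‖y‖) ^ (n + 1))⁻¹ :=
    integrable_one_add_norm_pow (by simp)
  obtain ⟨C₀, hC₀, hb₀⟩ := schwartz_one_add_decay f (n + 1)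
  obtain ⟨C, hC, hb⟩ := schwartz_one_add_decay (SchwartzMap.fderivCLM ℝ _ _ f) (n + 1 + 1)
  have hB₀ : ∀ y : Fin n → ℝ, (1 + ‖y‖) ^ (n + 1) * ‖f (point (p.1.toMatrix *ᵥ y + p.2) y)‖ ≤ C₀ := by
    intro y
    refine le_trans ?_ (hb₀ (point (p.1.toMatrix *ᵥ y + p.2) y))
    gcongr
    exact norm_le_norm_point_right _ _
  have hB : ∀ p : Symm n × (Fin n → ℝ), ∀ y : Fin n → ℝ, (1 + ‖y‖) ^ (n + 1) *
      ‖(fderiv ℝ f (point (p.1.toMatrix *ᵥ y + p.2) y)).comp (dirMap y)‖ ≤ D * C := by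
    intro p y
    set v := point (p.1.toMatrix *ᵥ y + p.2) y
    calc (1 + ‖y‖) ^ (n + 1) * ‖(fderiv ℝ f v).comp (dirMap y)‖
        ≤ (1 + ‖y‖) ^ (n + 1) * (‖fderiv ℝ f v‖ * (D * (1 + ‖y‖))) := by
          gcongr
          exact (ContinuousLinearMap.opNorm_comp_le _ _).trans (by gcongr; exact hD y)
      _ = D * ((1 + ‖y‖) ^ (n + 1 + 1) * ‖fderiv ℝ f v‖) := by ring
      _ ≤ D * ((1 + ‖v‖) ^ (n + 1 + 1) * ‖fderiv ℝ f v‖) := by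
          gcongr
          exact norm_le_norm_point_right _ _
      _ ≤ D * C := by gcongr; exact hb v
  have hdc : Continuous fun y : Fin n → ℝ => dirMap (n := n) y := by
    refine continuous_clm_apply.2 fun w => ?_
    simp only [dirMap_apply]
    exact continuous_point.comp (Continuous.prodMk (by fun_prop) continuous_const)
  have hc' : Continuous fun y : Fin n → ℝ =>
      (fderiv ℝ f (point (p.1.toMatrix *ᵥ y + p.2) y)).comp (dirMap y) :=
    (((SchwartzMap.fderivCLM ℝ _ _ f).continuous).comp (continuous_chart p)).clm_comp hdc
  refine ⟨hasFDerivAt_integral_of_decay one_pos hr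
    (fun p => f.continuous.comp (continuous_chart p)) hc' (fun p _ y => ?_) hB₀ fun p _ => hB p, ?_⟩
  · have h2 : HasFDerivAt (fun p : Symm n × (Fin n → ℝ) => point (p.1.toMatrix *ᵥ y + p.2) y)
        (dirMap y) p := by
      simp_rw [chart_eq]
      exact (dirMap y).hasFDerivAt.add_const _
    exact (f.hasFDerivAt _).comp p h2
  · exact integrable_of_decay hr hc' (hB p)

/-- The direction `w` enters only through the vector field (x, y) ↦ (Sy + σ, 0) on phase space, so
differentiating a transform gives another transform. Both smoothness and the determinantal system
follow from this. -/
theorem fderiv_radonFlat (f : 𝓢(PhaseSpace n, ℂ)) (w : Symm n × (Fin n → ℝ)) :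
    (fun p => fderiv ℝ (radonFlat f) p w) =
      radonFlat (derivAlong (hasTemperateGrowth_shear w) f) := by
  funext p
  rw [(hasFDerivAt_radonFlat f p).1.fderiv,
    ContinuousLinearMap.integral_apply (hasFDerivAt_radonFlat f p).2]
  rfl

theorem contDiff_radonFlat (f : 𝓢(PhaseSpace n, ℂ)) : ContDiff ℝ ∞ (radonFlat f) := by
  refine contDiff_of_closed (fun h => ∃ f : 𝓢(PhaseSpace n, ℂ), h = radonFlat f) ?_ ⟨f, rfl⟩
  rintro _ ⟨f, rfl⟩
  exact ⟨fun p => (hasFDerivAt_radonFlat f p).1.differentiableAt,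
    fun w => ⟨_, fderiv_radonFlat f w⟩⟩

/-! ### The determinantal system for Radon transforms -/

/-- The matrix of operators `y_j ∂/∂x_i + y_i ∂/∂x_j`, bordered by the `∂/∂x_i`, is the symmetrized
product of the vectors of operators `(∂/∂x_i, 0)` and `(y_j, 1)`. This is the first of them. -/
noncomputable def dX : Fin n ⊕ Unit → Module.End ℝ 𝓢(PhaseSpace n, ℂ)
  | Sum.inl k => ((LineDeriv.lineDerivOpCLM ℝ 𝓢(PhaseSpace n, ℂ) (point (Pi.single k 1) 0)) :
      𝓢(PhaseSpace n, ℂ) →ₗ[ℝ] 𝓢(PhaseSpace n, ℂ))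
  | Sum.inr _ => 0

/-- The vector of operators `(y_j, 1)`. -/
noncomputable def mY : Fin n ⊕ Unit → Module.End ℝ 𝓢(PhaseSpace n, ℂ)
  | Sum.inl k => ((SchwartzMap.smulLeftCLM ℂ fun v : PhaseSpace n => v (Sum.inr k)) :
      𝓢(PhaseSpace n, ℂ) →ₗ[ℝ] 𝓢(PhaseSpace n, ℂ))
  | Sum.inr _ => 1

theorem hasTemperateGrowth_coord (k : Fin n ⊕ Fin n) :
    (fun v : PhaseSpace n => v k).HasTemperateGrowth :=
  (EuclideanSpace.proj (𝕜 := ℝ) k).hasTemperateGrowth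

theorem dX_inl_apply (k : Fin n) (f : 𝓢(PhaseSpace n, ℂ)) (v : PhaseSpace n) :
    dX (Sum.inl k) f v = fderiv ℝ f v (point (Pi.single k 1) 0) :=
  SchwartzMap.lineDerivOp_apply_eq_fderiv _ _ _

theorem mY_inl_apply (k : Fin n) (f : 𝓢(PhaseSpace n, ℂ)) (v : PhaseSpace n) :
    mY (Sum.inl k) f v = (v (Sum.inr k) : ℂ) * f v := by
  have := SchwartzMap.smulLeftCLM_apply_apply (hasTemperateGrowth_coord (Sum.inr k)) f v
  exact this.trans (Complex.real_smul)

theorem dX_commute (i j : Fin n ⊕ Unit) : dX i * dX j = dX j * dX i := by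
  rcases i with i | i <;> rcases j with j | j
  · ext f v
    simp only [Module.End.mul_apply, dX_inl_apply]
    have h : ∀ i : Fin n, ⇑(dX (Sum.inl i) f) = fun v => fderiv ℝ f v (point (Pi.single i 1) 0) :=
      fun i => funext fun v => dX_inl_apply i f v
    have hd : DifferentiableAt ℝ (fderiv ℝ f) v :=
      (SchwartzMap.fderivCLM ℝ _ _ f).differentiableAt
    rw [h, h, fderiv_clm_apply hd (by fun_prop), fderiv_clm_apply hd (by fun_prop)]
    simp only [fderiv_fun_const, Pi.zero_apply, ContinuousLinearMap.comp_zero, zero_add,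
      ContinuousLinearMap.flip_apply]
    exact ((f.smooth 2).contDiffAt.isSymmSndFDerivAt (by simp)) _ _
  all_goals simp [dX]

theorem mY_commute (i j : Fin n ⊕ Unit) : mY i * mY j = mY j * mY i := by
  rcases i with i | i <;> rcases j with j | j
  · ext f v
    simp only [Module.End.mul_apply, mY_inl_apply]
    ring
  all_goals simp [mY]

/-- The derivatives are in the x variables and the multiplications in the y variables, so the
product rule leaves no extra term. -/
theorem dX_mY_commute (i j : Fin n ⊕ Unit) : dX i * mY j = mY j * dX i := by
  rcases i with i | i <;> rcases j with j | j
  · ext f v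
    simp only [Module.End.mul_apply, mY_inl_apply, dX_inl_apply]
    have h : ⇑(mY (Sum.inl j) f) = fun v => (v (Sum.inr j)) • f v :=
      funext fun v => (mY_inl_apply j f v).trans Complex.real_smul.symm
    have h1 : HasFDerivAt (fun v : PhaseSpace n => v (Sum.inr j))
        (EuclideanSpace.proj (Sum.inr j) : PhaseSpace n →L[ℝ] ℝ) v :=
      (EuclideanSpace.proj (Sum.inr j) : PhaseSpace n →L[ℝ] ℝ).hasFDerivAt
    have h2 : HasFDerivAt (fun v : PhaseSpace n => v (Sum.inr j) • f v) _ v :=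
      h1.smul (f.hasFDerivAt v)
    rw [h, h2.fderiv]
    simp
  all_goals simp [mY, dX]

/-- The operators `y_j ∂/∂x_i + y_i ∂/∂x_j` and `∂/∂x_i`. -/
noncomputable def entryEnd (i j : Fin n ⊕ Unit) : Module.End ℝ 𝓢(PhaseSpace n, ℂ) :=
  dX i * mY j + dX j * mY i

/-- The factor 2 on the diagonal makes the direction equal to E_kl + E_lk in all cases, k = l
included. -/
theorem entryDir_toMatrix (k l i j : Fin n) :
    Symm.toMatrix (entryDir (n := n) (Sum.inl k) (Sum.inl l)).1 i j =
      (if i = k ∧ j = l then 1 else 0) + (if i = l ∧ j = k then 1 else 0) := by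
  simp only [entryDir, Symm.toMatrix, Matrix.of_apply, Pi.smul_apply, Pi.single_apply, Sym2.eq_iff,
    smul_eq_mul]
  by_cases hkl : k = l
  · subst hkl
    by_cases h : i = k ∧ j = k <;> norm_num [h]
  · by_cases h1 : i = k ∧ j = l
    · have : ¬(i = l ∧ j = k) := fun h => hkl (h1.1.symm.trans h.1)
      simp [h1, hkl]
    · simp [h1, hkl]

theorem entryDir_mulVec (k l : Fin n) (y : Fin n → ℝ) :
    Symm.toMatrix (entryDir (n := n) (Sum.inl k) (Sum.inl l)).1 *ᵥ y =
      y l • Pi.single k 1 + y k • Pi.single l 1 := by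
  ext i
  simp only [Matrix.mulVec, dotProduct, entryDir_toMatrix, add_mul, ite_mul, one_mul, zero_mul,
    Finset.sum_add_distrib, ite_and, Pi.add_apply, Pi.smul_apply, Pi.single_apply, smul_eq_mul,
    mul_ite, mul_one, mul_zero]
  congr 1 <;> split_ifs <;> simp

theorem entryDir_shear (i j : Fin n ⊕ Unit) (f : 𝓢(PhaseSpace n, ℂ)) :
    derivAlong (hasTemperateGrowth_shear (entryDir i j)) f = entryEnd i j f := by
  ext v
  have hsum : ∀ x : Fin n → ℝ, fderiv ℝ f v (point x 0) = ∑ k, x k * dX (Sum.inl k) f v := by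
    intro x
    have : point x 0 = ∑ k, x k • point (Pi.single k 1) (0 : Fin n → ℝ) := by
      ext i
      cases i <;> simp [Pi.single_apply]
    rw [this, map_sum]
    simp [dX_inl_apply]
  have hsingle : ∀ k : Fin n, ∀ a : Fin n → ℂ,
      ∑ m, (((Pi.single k 1 : Fin n → ℝ) m : ℝ) : ℂ) * a m = a k := by
    intro k a
    rw [Finset.sum_eq_single k (fun m _ hm => by simp [hm]) (by simp)]
    simp
  rw [derivAlong_apply, dirMap_apply, hsum]
  simp only [entryEnd, dX_mY_commute, LinearMap.add_apply, Module.End.mul_apply, add_apply]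
  rcases i with k | k <;> rcases j with l | l
  · rw [entryDir_mulVec, show (entryDir (n := n) (Sum.inl k) (Sum.inl l)).2 = 0 from rfl, add_zero]
    simp only [Pi.add_apply, Pi.smul_apply, smul_eq_mul, Complex.ofReal_add,
      Complex.ofReal_mul, add_mul, Finset.sum_add_distrib, mul_assoc, ← Finset.mul_sum, hsingle,
      mY_inl_apply]
  · simp only [entryDir, Symm.toMatrix_zero, Matrix.zero_mulVec, zero_add, hsingle]
    simp [mY, dX]
  · simp only [entryDir, Symm.toMatrix_zero, Matrix.zero_mulVec, zero_add, hsingle]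
    simp [mY, dX]
  · simp [entryDir, mY, dX, Symm.toMatrix_zero]

theorem entryOp_radonFlat (i j : Fin n ⊕ Unit) (f : 𝓢(PhaseSpace n, ℂ)) :
    entryOp i j (radonFlat f) = radonFlat (entryEnd i j f) := by
  rw [← entryDir_shear]
  exact fderiv_radonFlat f _

/-- The entries lie in the commutative algebra generated by the operators X_i and Y_j, where the sum
is an honest determinant. The matrix X_i Y_j + X_j Y_i is a sum of two matrices of rank one, so its
3 × 3 determinants vanish identically. -/
theorem sum_sign_entryEnd (r c : Fin 3 → Fin n ⊕ Unit) :
    ∑ σ : Equiv.Perm (Fin 3), ((Equiv.Perm.sign σ : ℤ)) •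
      (entryEnd (r 0) (c (σ 0)) * entryEnd (r 1) (c (σ 1)) * entryEnd (r 2) (c (σ 2))) = 0 := by
  let s : Set (Module.End ℝ 𝓢(PhaseSpace n, ℂ)) := Set.range dX ∪ Set.range mY
  have hs : ∀ a ∈ s, ∀ b ∈ s, a * b = b * a := by
    rintro _ (⟨i, rfl⟩ | ⟨i, rfl⟩) _ (⟨j, rfl⟩ | ⟨j, rfl⟩)
    exacts [dX_commute i j, dX_mY_commute i j, (dX_mY_commute j i).symm, mY_commute i j]
  have hcomm : IsMulCommutative (Algebra.adjoin ℝ s) := Algebra.isMulCommutative_adjoin ℝ hs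
  let : CommRing (Algebra.adjoin ℝ s) :=
    { (inferInstance : Ring (Algebra.adjoin ℝ s)) with mul_comm := hcomm.is_comm.comm }
  let X : Fin n ⊕ Unit → Algebra.adjoin ℝ s := fun i =>
    ⟨dX i, Algebra.subset_adjoin (Or.inl ⟨i, rfl⟩)⟩
  let Y : Fin n ⊕ Unit → Algebra.adjoin ℝ s := fun i =>
    ⟨mY i, Algebra.subset_adjoin (Or.inr ⟨i, rfl⟩)⟩
  let M : Matrix (Fin 3) (Fin 3) (Algebra.adjoin ℝ s) :=
    Matrix.of fun i j => X (r j) * Y (c i) + X (c i) * Y (r j)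
  have hM : M.det = 0 := by
    rw [Matrix.det_fin_three]
    simp only [M, Matrix.of_apply]
    ring
  rw [Matrix.det_apply] at hM
  have h := congrArg (Subalgebra.val (Algebra.adjoin ℝ s)) hM
  rw [map_sum, map_zero] at h
  rw [← h]
  refine Finset.sum_congr rfl fun σ _ => ?_
  rw [Fin.prod_univ_three, Units.smul_def, map_zsmul, map_mul, map_mul]
  rfl

theorem satisfiesDeterminantal_radonFlat (f : 𝓢(PhaseSpace n, ℂ)) :
    SatisfiesDeterminantal (radonFlat f) := by
  intro r c _ _ p
  simp only [minorOp, entryOp_radonFlat]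
  have hint : ∀ f : 𝓢(PhaseSpace n, ℂ), Integrable fun y : Fin n → ℝ =>
      f (point (p.1.toMatrix *ᵥ y + p.2) y) := by
    intro f
    obtain ⟨C₀, hC₀, hb₀⟩ := schwartz_one_add_decay f (n + 1)
    refine integrable_of_decay (r := n + 1) (integrable_one_add_norm_pow (by simp)) (f.continuous.comp (continuous_chart p))
      (C := C₀) fun y => ?_
    refine le_trans ?_ (hb₀ (point (p.1.toMatrix *ᵥ y + p.2) y))
    gcongr
    exact norm_le_norm_point_right _ _
  have h := congrArg (fun A : Module.End ℝ 𝓢(PhaseSpace n, ℂ) => radonFlat (A f) p)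
    (sum_sign_entryEnd r c)
  simp only [radonFlat] at h ⊢
  simp_rw [← integral_const_mul]
  rw [← integral_finsetSum _ fun σ _ => (hint _).const_mul _]
  rw [LinearMap.zero_apply] at h
  simp only [LinearMap.sum_apply, sum_apply] at h
  simpa using h

/-! ### Integrals over affine Lagrangian subspaces with respect to the Euclidean volume -/

/-- The integral of `f` over an affine Lagrangian subspace. -/
noncomputable def radonAL (f : 𝓢(PhaseSpace n, ℂ)) (P : AL n) : ℂ :=
  ∫ w : P.1.direction, f (P.2.1.choose + (w : PhaseSpace n))

/-- The integral of `f` over the direction of an affine Lagrangian subspace. -/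
noncomputable def dirAL (f : 𝓢(PhaseSpace n, ℂ)) (P : AL n) : ℂ :=
  ∫ w : P.1.direction, f (w : PhaseSpace n)

/-- The Gaussian `exp (-π |v|²)`. -/
noncomputable def gauss (n : ℕ) : 𝓢(PhaseSpace n, ℂ) := (exists_gaussian (PhaseSpace n)).choose

theorem gauss_apply (v : PhaseSpace n) :
    gauss n v = ((Real.exp (-Real.pi * ‖v‖ ^ 2) : ℝ) : ℂ) :=
  (exists_gaussian (PhaseSpace n)).choose_spec v

/-- The normalization by π makes the Gaussian a test function that detects the Euclidean volume of
every direction. -/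
theorem dirAL_gauss (P : AL n) : dirAL (gauss n) P = 1 := by
  simp only [dirAL, gauss_apply]
  rw [integral_complex_ofReal]
  have := GaussianFourier.integral_rexp_neg_mul_sq_norm (V := P.1.direction) Real.pi_pos
  rw [div_self Real.pi_ne_zero, Real.one_rpow] at this
  simpa using this

theorem radonAL_eq (f : 𝓢(PhaseSpace n, ℂ)) (P : AL n) {p : PhaseSpace n} (hp : p ∈ P.1) :
    radonAL f P = ∫ w : P.1.direction, f (p + (w : PhaseSpace n)) := by
  have h0 := P.2.1.choose_spec
  rw [radonAL]
  set q := P.2.1.choose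
  let w₀ : P.1.direction := ⟨q - p, AffineSubspace.vsub_mem_direction h0 hp⟩
  rw [← integral_add_right_eq_self (fun w : P.1.direction => f (p + (w : PhaseSpace n))) w₀]
  congr 1
  funext w
  congr 1
  simp [w₀]
  abel

/-- Uniqueness of Haar measure up to a scalar. The scalar need not be known, since `radonAL_mul`
eliminates it. -/
theorem exists_integral_direction {W : Type*} [NormedAddCommGroup W] [NormedSpace ℝ W]
    [FiniteDimensional ℝ W] [MeasurableSpace W] [BorelSpace W] (μ : Measure W) [μ.IsAddHaarMeasure]
    (L : W →ₗ[ℝ] PhaseSpace n) (hL : Function.Injective L) {V : Submodule ℝ (PhaseSpace n)}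
    (hV : LinearMap.range L = V) :
    ∃ c : ℝ, ∀ φ : PhaseSpace n → ℂ, ∫ w : V, φ w = c * ∫ w, φ (L w) ∂μ := by
  subst hV
  let e : W ≃L[ℝ] LinearMap.range L := (LinearEquiv.ofInjective L hL).toContinuousLinearEquiv
  have he : ∀ w, ((e w : LinearMap.range L) : PhaseSpace n) = L w := fun w => rfl
  have := e.isAddHaarMeasure_map μ
  refine ⟨((volume : Measure (LinearMap.range L)).addHaarScalarFactor (Measure.map e μ) : ℝ),
    fun φ => ?_⟩
  conv_lhs => rw [Measure.isAddLeftInvariant_eq_smul volume (Measure.map e μ)]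
  rw [integral_smul_nnreal_measure]
  have h := integral_map_equiv (μ := μ) e.toHomeomorph.toMeasurableEquiv
    fun w : LinearMap.range L => φ w
  have h2 : ∫ (w : ↥(LinearMap.range L)), φ ↑w ∂Measure.map (⇑e) μ = ∫ w, φ (L w) ∂μ := h
  rw [h2]
  rfl

/-- Testing on the Gaussian identifies the unknown Haar scalar as the inverse of the Gaussian
integral in the parametrization. This replaces any computation of Gram determinants. -/
theorem radonAL_mul {W : Type*} [NormedAddCommGroup W] [NormedSpace ℝ W]
    [FiniteDimensional ℝ W] [MeasurableSpace W] [BorelSpace W] (μ : Measure W) [μ.IsAddHaarMeasure]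
    (L : W →ₗ[ℝ] PhaseSpace n) (hL : Function.Injective L) (P : AL n)
    (hV : LinearMap.range L = P.1.direction) :
    (∫ w, gauss n (L w) ∂μ) ≠ 0 ∧
      (∀ f : 𝓢(PhaseSpace n, ℂ), ∀ p ∈ P.1,
        radonAL f P * ∫ w, gauss n (L w) ∂μ = ∫ w, f (p + L w) ∂μ) ∧
      ∀ f : 𝓢(PhaseSpace n, ℂ), dirAL f P * ∫ w, gauss n (L w) ∂μ = ∫ w, f (L w) ∂μ := by
  obtain ⟨c, hc⟩ := exists_integral_direction μ L hL hV
  have h1 : (1 : ℂ) = c * ∫ w, gauss n (L w) ∂μ := by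
    rw [← dirAL_gauss P]
    exact hc _
  refine ⟨fun h => by simp [h] at h1, fun f p hp => ?_, fun f => ?_⟩
  · rw [radonAL_eq f P hp, hc fun v => f (p + v), mul_right_comm, ← h1, one_mul]
  · rw [dirAL, hc f, mul_right_comm, ← h1, one_mul]

/-! ### Decay -/

theorem finrank_direction (P : AL n) : Module.finrank ℝ P.1.direction = n := P.2.2.2

/-- An isometry of the direction with ℝⁿ makes the constants in the decay estimates independent of
the plane. -/
theorem integral_direction_eq (P : AL n) :
    ∫ w : P.1.direction, ((1 + ‖w‖) ^ (n + 1))⁻¹ =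
      ∫ w : EuclideanSpace ℝ (Fin n), ((1 + ‖w‖) ^ (n + 1))⁻¹ := by
  let e : P.1.direction ≃ₗᵢ[ℝ] EuclideanSpace ℝ (Fin n) :=
    ((stdOrthonormalBasis ℝ P.1.direction).reindex (finCongr (finrank_direction P))).repr
  rw [← e.measurePreserving.integral_comp e.toHomeomorph.measurableEmbedding]
  simp

theorem AL.distZero_nonneg (P : AL n) : 0 ≤ P.distZero := Metric.infDist_nonneg

theorem radonAL_decay (f : 𝓢(PhaseSpace n, ℂ)) (M : ℕ) :
    ∃ C : ℝ, ∀ P : AL n, P.distZero ^ M * ‖radonAL f P‖ ≤ C := by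
  obtain ⟨C, hC0, hC⟩ := schwartz_one_add_decay f (M + (n + 1))
  refine ⟨C * ∫ w : EuclideanSpace ℝ (Fin n), ((1 + ‖w‖) ^ (n + 1))⁻¹, fun P => ?_⟩
  obtain ⟨q, hq⟩ := P.2.1
  -- The base point `z` is the foot of the perpendicular from the origin. By Pythagoras |z + w| ≥
  -- |w|, and |z + w| is also at least the distance of the plane, so one decay estimate for `f` pays
  -- for both factors.
  obtain ⟨y, hy, z, hz, hqyz⟩ := P.1.direction.exists_add_mem_mem_orthogonal q
  have hzP : z ∈ P.1 := by
    have : z = -y +ᵥ q := by rw [hqyz]; simp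
    rw [this]
    exact AffineSubspace.vadd_mem_of_mem_direction (neg_mem hy) hq
  rw [radonAL_eq f P hzP, ← integral_direction_eq P]
  have hn : ‖∫ w : P.1.direction, ((P.distZero ^ M : ℝ) : ℂ) * f (z + w)‖ ≤ _ :=
    norm_integral_le_of_decay (μ := volume) (r := n + 1) (C := C)
      (integrable_one_add_norm_pow (by rw [finrank_direction]; exact Nat.lt_succ_self n)) fun w => ?_
  · rw [integral_const_mul, norm_mul, Complex.norm_real, Real.norm_eq_abs,
      abs_of_nonneg (pow_nonneg P.distZero_nonneg M)] at hn
    exact hn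
  · have hw : (z + (w : PhaseSpace n)) ∈ P.1 := by
      rw [add_comm]
      exact AffineSubspace.vadd_mem_of_mem_direction w.2 hzP
    have h1 : P.distZero ≤ ‖z + (w : PhaseSpace n)‖ := by
      have := Metric.infDist_le_dist_of_mem (x := (0 : PhaseSpace n)) hw
      rwa [dist_zero_left] at this
    have h2 : ‖w‖ ≤ ‖z + (w : PhaseSpace n)‖ := by
      have h3 : ‖z + (w : PhaseSpace n)‖ * ‖z + (w : PhaseSpace n)‖ =
          ‖z‖ * ‖z‖ + ‖(w : PhaseSpace n)‖ * ‖(w : PhaseSpace n)‖ :=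
        norm_add_sq_eq_norm_sq_add_norm_sq_of_inner_eq_zero _ _
          (Submodule.inner_left_of_mem_orthogonal w.2 hz)
      refine (mul_self_le_mul_self_iff (norm_nonneg _) (norm_nonneg _)).2 ?_
      rw [h3]
      exact le_add_of_nonneg_left (mul_self_nonneg _)
    rw [norm_mul, Complex.norm_real, Real.norm_eq_abs, abs_of_nonneg (pow_nonneg P.distZero_nonneg M)]
    calc (1 + ‖w‖) ^ (n + 1) * (P.distZero ^ M * ‖f (z + w)‖)
        ≤ (1 + ‖z + (w : PhaseSpace n)‖) ^ (n + 1) *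
          ((1 + ‖z + (w : PhaseSpace n)‖) ^ M * ‖f (z + w)‖) := by
          have := P.distZero_nonneg
          gcongr
          linarith
      _ = (1 + ‖z + (w : PhaseSpace n)‖) ^ (M + (n + 1)) * ‖f (z + w)‖ := by ring
      _ ≤ C := hC _

theorem dirAL_bounded (f : 𝓢(PhaseSpace n, ℂ)) : ∃ C : ℝ, 0 ≤ C ∧ ∀ P : AL n, ‖dirAL f P‖ ≤ C := by
  obtain ⟨C, hC0, hC⟩ := schwartz_one_add_decay f (n + 1)
  refine ⟨C * ∫ w : EuclideanSpace ℝ (Fin n), ((1 + ‖w‖) ^ (n + 1))⁻¹,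
    mul_nonneg hC0 (integral_nonneg fun w => by positivity), fun P => ?_⟩
  rw [← integral_direction_eq P]
  exact norm_integral_le_of_decay (r := n + 1) (C := C)
    (integrable_one_add_norm_pow (by rw [finrank_direction]; exact Nat.lt_succ_self n)) fun w => hC w

/-! ### One-parameter groups of affine symplectic transformations -/

/-- The linear part of the affine transformation given by a matrix. -/
noncomputable def linPart (g : AffMatrix n) : PhaseSpace n →L[ℝ] PhaseSpace n :=
  LinearMap.toContinuousLinearMap (Matrix.toLpLin 2 2 g.toBlocks₁₁)

/-- The translation part of the affine transformation given by a matrix. -/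
noncomputable def transPart (g : AffMatrix n) : PhaseSpace n := WithLp.toLp 2 fun i => g.toBlocks₁₂ i ()

theorem affineAction_apply (g : AffMatrix n) (v : PhaseSpace n) :
    affineAction g v = linPart g v + transPart g := by
  simp [affineAction, linPart, transPart]

theorem linPart_coord (g : AffMatrix n) (v : PhaseSpace n) (i : Fin n ⊕ Fin n) :
    linPart g v i = ∑ j, g (Sum.inl i) (Sum.inl j) * v j := rfl

theorem transPart_coord (g : AffMatrix n) (i : Fin n ⊕ Fin n) :
    transPart g i = g (Sum.inl i) (Sum.inr ()) := rfl

theorem linPart_one : linPart (1 : AffMatrix n) = 1 := by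
  ext v i
  simp [linPart_coord, Matrix.one_apply]

theorem transPart_one : transPart (1 : AffMatrix n) = 0 := by
  ext i
  simp [transPart_coord]

theorem linPart_mul {g h : AffMatrix n} (h0 : h.toBlocks₂₁ = 0) (v : PhaseSpace n) :
    linPart (g * h) v = linPart g (linPart h v) := by
  have h1 : ∀ j, h (Sum.inr ()) (Sum.inl j) = 0 := fun j => congrFun (congrFun h0 ()) j
  ext i
  simp only [linPart_coord, Matrix.mul_apply, Fintype.sum_sum_type (α₁ := Fin n ⊕ Fin n), h1,
    Finset.univ_unique, Finset.sum_singleton, PUnit.default_eq_unit, mul_zero, add_zero,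
    Finset.sum_mul, Finset.mul_sum, mul_assoc]
  exact Finset.sum_comm

theorem transPart_mul {g h : AffMatrix n} (h0 : h.toBlocks₂₂ = 1) :
    transPart (g * h) = linPart g (transPart h) + transPart g := by
  have h1 : h (Sum.inr ()) (Sum.inr ()) = 1 := by
    exact congrFun (congrFun h0 ()) ()
  ext i
  simp [transPart_coord, linPart_coord, Matrix.mul_apply, Fintype.sum_sum_type, h1]

theorem linPart_injective (g : ASp n) : Function.Injective (linPart g.1) := by
  intro v w h
  have h' := congrArg WithLp.ofLp h
  have h'' : g.1.toBlocks₁₁ *ᵥ (WithLp.ofLp v) = g.1.toBlocks₁₁ *ᵥ (WithLp.ofLp w) := h'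
  exact WithLp.ofLp_injective 2 (Matrix.mulVec_injective_of_isUnit
    ((Matrix.isUnit_iff_isUnit_det _).2 (SymplecticGroup.symplectic_det g.2.1)) h'')

theorem direction_act (g : ASp n) (P : AL n) :
    (P.act g).1.direction = P.1.direction.map (linPart g.1 : PhaseSpace n →ₗ[ℝ] PhaseSpace n) := by
  simp only [AL.act, AffineSubspace.map_direction, affineAction_linear]
  rfl

theorem mem_act (g : ASp n) {P : AL n} {v : PhaseSpace n} (hv : v ∈ P.1) :
    linPart g.1 v + transPart g.1 ∈ (P.act g).1 := by
  rw [← affineAction_apply]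
  exact AffineSubspace.mem_map_of_mem _ hv

open scoped Matrix.Norms.Operator in
theorem hasDerivAt_exp_entry {m : Type*} [Fintype m] [DecidableEq m] (Y : Matrix m m ℝ) (t : ℝ)
    (i j : m) :
    HasDerivAt (fun t : ℝ => NormedSpace.exp (t • Y) i j) ((Y * NormedSpace.exp (t • Y)) i j) t := by
  have h := hasDerivAt_exp_smul_const' (𝕂 := ℝ) Y t
  exact hasDerivAt_pi.1 (hasDerivAt_pi.1 h i) j

theorem exp_neg_mul_exp {m : Type*} [Fintype m] [DecidableEq m] (Y : Matrix m m ℝ) (t : ℝ) :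
    NormedSpace.exp ((-t) • Y) * NormedSpace.exp (t • Y) = 1 := by
  rw [← Matrix.exp_add_of_commute _ _ ((Commute.refl Y).smul_left _ |>.smul_right _), ← add_smul]
  simp

theorem hasDerivAt_linPart_exp (Y : aspLie n) (v : PhaseSpace n) (t : ℝ) :
    HasDerivAt (fun t => linPart (aspExp Y t).1 v) (linPart Y.1 (linPart (aspExp Y t).1 v)) t := by
  have h : ∀ i, HasDerivAt (fun t => linPart (aspExp Y t).1 v i)
      (linPart Y.1 (linPart (aspExp Y t).1 v) i) t := by
    intro i
    rw [← linPart_mul (aspExp Y t).2.2.1]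
    simp only [linPart_coord]
    exact HasDerivAt.fun_sum fun j _ => (hasDerivAt_exp_entry Y.1 t _ _).mul_const _
  exact (PiLp.hasFDerivAt_toLp (𝕜 := ℝ) 2 _).comp_hasDerivAt t (hasDerivAt_pi.2 h)

theorem hasDerivAt_transPart_exp (Y : aspLie n) (t : ℝ) :
    HasDerivAt (fun t => transPart (aspExp Y t).1)
      (linPart Y.1 (transPart (aspExp Y t).1) + transPart Y.1) t := by
  have h : ∀ i, HasDerivAt (fun t => transPart (aspExp Y t).1 i)
      ((linPart Y.1 (transPart (aspExp Y t).1) + transPart Y.1) i) t := by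
    intro i
    rw [← transPart_mul (aspExp Y t).2.2.2]
    simp only [transPart_coord]
    exact hasDerivAt_exp_entry Y.1 t _ _
  exact (PiLp.hasFDerivAt_toLp (𝕜 := ℝ) 2 _).comp_hasDerivAt t (hasDerivAt_pi.2 h)

theorem aspExp_zero (Y : aspLie n) : (aspExp Y 0).1 = 1 := by
  simp [aspExp]

/-- The point `v` is recovered from its image by exp(-tY), whose linear and translation parts are
bounded for t in the compact interval [-1, 1]. The flow therefore does not spoil majorants in 1 +
|v|. -/
theorem exists_flow_bound (Y : aspLie n) :
    ∃ K : ℝ, 0 ≤ K ∧ ∀ t ∈ Metric.ball (0 : ℝ) 1, ∀ v,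
      1 + ‖v‖ ≤ K * (1 + ‖linPart (aspExp Y t).1 v + transPart (aspExp Y t).1‖) ∧
      1 + ‖v‖ ≤ K * (1 + ‖linPart (aspExp Y t).1 v‖) := by
  have hA : Continuous fun t => linPart (aspExp Y t).1 :=
    continuous_clm_apply.2 fun v =>
      continuous_iff_continuousAt.2 fun t => (hasDerivAt_linPart_exp Y v t).continuousAt
  have hr : Continuous fun t => transPart (aspExp Y t).1 :=
    continuous_iff_continuousAt.2 fun t => (hasDerivAt_transPart_exp Y t).continuousAt
  obtain ⟨K₁, hK₁⟩ := (isCompact_Icc (a := (-1 : ℝ)) (b := 1)).exists_bound_of_continuousOn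
    hA.continuousOn
  obtain ⟨K₂, hK₂⟩ := (isCompact_Icc (a := (-1 : ℝ)) (b := 1)).exists_bound_of_continuousOn
    hr.continuousOn
  have hK₁0 : 0 ≤ K₁ := (norm_nonneg _).trans (hK₁ 0 (by simp))
  have hK₂0 : 0 ≤ K₂ := (norm_nonneg _).trans (hK₂ 0 (by simp))
  refine ⟨1 + K₁ + K₂, by positivity, fun t ht v => ?_⟩
  rw [mem_ball_zero_iff, Real.norm_eq_abs, abs_lt] at ht
  have ht' : -t ∈ Set.Icc (-1 : ℝ) 1 := ⟨by linarith, by linarith⟩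
  have h1 : v = linPart (aspExp Y (-t)).1 (linPart (aspExp Y t).1 v) := by
    rw [← linPart_mul (aspExp Y t).2.2.1]
    simp only [aspExp, exp_neg_mul_exp]
    rw [linPart_one]
    rfl
  have h2 : linPart (aspExp Y (-t)).1 (transPart (aspExp Y t).1) + transPart (aspExp Y (-t)).1 = 0 := by
    rw [← transPart_mul (aspExp Y t).2.2.2]
    simp only [aspExp, exp_neg_mul_exp]
    exact transPart_one
  have h3 : v = linPart (aspExp Y (-t)).1 (linPart (aspExp Y t).1 v + transPart (aspExp Y t).1) +
      transPart (aspExp Y (-t)).1 := by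
    rw [map_add, add_assoc, h2, add_zero]
    exact h1
  have hb : ∀ u, ‖linPart (aspExp Y (-t)).1 u‖ ≤ K₁ * ‖u‖ := fun u =>
    (ContinuousLinearMap.le_opNorm _ _).trans (by gcongr; exact hK₁ _ ht')
  constructor
  · set u := linPart (aspExp Y t).1 v + transPart (aspExp Y t).1
    have : ‖v‖ ≤ K₁ * ‖u‖ + K₂ := by
      rw [h3]
      exact (norm_add_le _ _).trans (add_le_add (hb u) (hK₂ _ ht'))
    nlinarith [norm_nonneg u, mul_nonneg hK₂0 (norm_nonneg u)]
  · set u := linPart (aspExp Y t).1 v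
    have : ‖v‖ ≤ K₁ * ‖u‖ := by
      rw [h1]
      exact hb u
    nlinarith [norm_nonneg u, mul_nonneg hK₂0 (norm_nonneg u)]

/-! ### Lie derivatives of integrals over planes -/

theorem hasTemperateGrowth_affine (A : PhaseSpace n →L[ℝ] PhaseSpace n) (b : PhaseSpace n) :
    (fun v => A v + b).HasTemperateGrowth := A.hasTemperateGrowth.add (.const b)

/-- Differentiation under the integral sign. The t-derivative of f(u_t v) is the derivative of `f`
along the generating field, again a Schwartz function, evaluated at u_t v; the bound `hK` turns its
decay at u_t v into decay in `w` uniformly in t. -/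
theorem hasDerivAt_integral_flow (f : 𝓢(PhaseSpace n, ℂ)) (V : Submodule ℝ (PhaseSpace n))
    (p : PhaseSpace n) {u : ℝ → PhaseSpace n → PhaseSpace n} {A : PhaseSpace n →L[ℝ] PhaseSpace n}
    {b : PhaseSpace n} (hu : ∀ t v, HasDerivAt (fun t => u t v) (A (u t v) + b) t)
    (hu0 : ∀ v, u 0 v = v) (huc : ∀ t, Continuous (u t)) {K : ℝ} (hK0 : 0 ≤ K)
    (hK : ∀ t ∈ Metric.ball (0 : ℝ) 1, ∀ v, 1 + ‖v‖ ≤ K * (1 + ‖u t v‖)) :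
    HasDerivAt (fun t => ∫ w : V, f (u t (p + w)))
      (∫ w : V, derivAlong (hasTemperateGrowth_affine A b) f (p + w)) 0 := by
  set d := Module.finrank ℝ V
  set g := derivAlong (hasTemperateGrowth_affine A b) f
  obtain ⟨C₀, hC₀, hb₀⟩ := schwartz_one_add_decay f (d + 1)
  obtain ⟨C, hC, hb⟩ := schwartz_one_add_decay g (d + 1)
  have hbound : ∀ (φ : 𝓢(PhaseSpace n, ℂ)) (C : ℝ), 0 ≤ C →
      (∀ v, (1 + ‖v‖) ^ (d + 1) * ‖φ v‖ ≤ C) → ∀ t ∈ Metric.ball (0 : ℝ) 1, ∀ w : V,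
      (1 + ‖w‖) ^ (d + 1) * ‖φ (u t (p + w))‖ ≤ ((1 + ‖p‖) * K) ^ (d + 1) * C := by
    intro φ C hC hφ t ht w
    have h1 : 1 + ‖w‖ ≤ (1 + ‖p‖) * K * (1 + ‖u t (p + w)‖) := by
      have h2 : ‖w‖ ≤ ‖p + (w : PhaseSpace n)‖ + ‖p‖ := by
        have := norm_sub_le (p + (w : PhaseSpace n)) p
        simpa using this
      calc 1 + ‖w‖ ≤ (1 + ‖p‖) * (1 + ‖p + (w : PhaseSpace n)‖) := by
            nlinarith [norm_nonneg p, norm_nonneg (p + (w : PhaseSpace n)),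
              mul_nonneg (norm_nonneg p) (norm_nonneg (p + (w : PhaseSpace n)))]
        _ ≤ (1 + ‖p‖) * (K * (1 + ‖u t (p + w)‖)) := by gcongr; exact hK t ht _
        _ = _ := by ring
    calc (1 + ‖w‖) ^ (d + 1) * ‖φ (u t (p + w))‖
        ≤ ((1 + ‖p‖) * K * (1 + ‖u t (p + w)‖)) ^ (d + 1) * ‖φ (u t (p + w))‖ := by gcongr
      _ = ((1 + ‖p‖) * K) ^ (d + 1) * ((1 + ‖u t (p + w)‖) ^ (d + 1) * ‖φ (u t (p + w))‖) := by
        rw [mul_pow, mul_assoc]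
      _ ≤ _ := by gcongr; exact hφ _
  have hpc : Continuous fun w : V => p + (w : PhaseSpace n) := by fun_prop
  have h := hasDerivAt_integral_of_dominated_loc_of_deriv_le (μ := (volume : Measure V))
    (F := fun t w => f (u t (p + w))) (F' := fun t w => g (u t (p + w))) (x₀ := (0 : ℝ))
    (s := Metric.ball 0 1)
    (bound := fun w => ((1 + ‖p‖) * K) ^ (d + 1) * C * ((1 + ‖w‖) ^ (d + 1))⁻¹)
    (Metric.ball_mem_nhds 0 one_pos)
    (Eventually.of_forall fun t => (f.continuous.comp ((huc t).comp hpc)).aestronglyMeasurable)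
    (integrable_of_decay (integrable_one_add_norm_pow (Nat.lt_succ_self _)) (f.continuous.comp ((huc 0).comp hpc))
      (hbound f C₀ hC₀ hb₀ 0 (Metric.mem_ball_self one_pos)))
    (g.continuous.comp ((huc 0).comp hpc)).aestronglyMeasurable
    (Eventually.of_forall fun w t ht => norm_le_of_decay (hbound g C hC hb t ht w))
    ((integrable_one_add_norm_pow (Nat.lt_succ_self _)).const_mul _)
    (Eventually.of_forall fun w t _ => (f.hasFDerivAt _).comp_hasDerivAt t (hu t _))
  simpa only [hu0] using h.2

theorem hasDerivAt_integral_act (f : 𝓢(PhaseSpace n, ℂ)) (Y : aspLie n)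
    (V : Submodule ℝ (PhaseSpace n)) (p : PhaseSpace n) :
    HasDerivAt (fun t => ∫ w : V, f (linPart (aspExp Y t).1 (p + w) + transPart (aspExp Y t).1))
      (∫ w : V, derivAlong (hasTemperateGrowth_affine (linPart Y.1) (transPart Y.1)) f (p + w)) 0 := by
  obtain ⟨K, hK0, hK⟩ := exists_flow_bound Y
  refine hasDerivAt_integral_flow f V p (u := fun t v =>
    linPart (aspExp Y t).1 v + transPart (aspExp Y t).1) (fun t v => ?_) (fun v => ?_)
    (fun t => by fun_prop) hK0 fun t ht v => (hK t ht v).1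
  · have := (hasDerivAt_linPart_exp Y v t).add (hasDerivAt_transPart_exp Y t)
    rwa [← add_assoc, ← map_add] at this
  · simp only [aspExp_zero]
    rw [linPart_one, transPart_one, add_zero]
    rfl

theorem hasDerivAt_integral_linear (f : 𝓢(PhaseSpace n, ℂ)) (Y : aspLie n)
    (V : Submodule ℝ (PhaseSpace n)) :
    HasDerivAt (fun t => ∫ w : V, f (linPart (aspExp Y t).1 w))
      (∫ w : V, derivAlong (hasTemperateGrowth_affine (linPart Y.1) 0) f w) 0 := by
  obtain ⟨K, hK0, hK⟩ := exists_flow_bound Y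
  have := hasDerivAt_integral_flow f V 0 (u := fun t v => linPart (aspExp Y t).1 v) (b := 0)
    (A := linPart Y.1)
    (fun t v => ?_) (fun v => ?_) (fun t => by fun_prop) hK0 fun t ht v => (hK t ht v).2
  · simpa only [zero_add] using this
  · rw [add_zero]
    exact hasDerivAt_linPart_exp Y v t
  · simp only [aspExp_zero]
    rw [linPart_one]
    rfl

/-- The functions on the affine Lagrangian Grassmannian generated by Radon transforms and integrals
over the direction. -/
inductive RadonClass : (AL n → ℂ) → Prop
  | radon (f : 𝓢(PhaseSpace n, ℂ)) : RadonClass (radonAL f)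
  | dir (g : 𝓢(PhaseSpace n, ℂ)) {G : AL n → ℂ} : RadonClass G → RadonClass fun P => dirAL g P * G P
  | sub {G H : AL n → ℂ} : RadonClass G → RadonClass H → RadonClass fun P => G P - H P

theorem RadonClass.decay {G : AL n → ℂ} (hG : RadonClass G) (M : ℕ) :
    ∃ C : ℝ, ∀ P : AL n, P.distZero ^ M * ‖G P‖ ≤ C := by
  induction hG with
  | radon f => exact radonAL_decay f M
  | @dir g G _ ih =>
    obtain ⟨C, hC⟩ := ih
    obtain ⟨D, hD0, hD⟩ := dirAL_bounded g
    refine ⟨D * C, fun P => ?_⟩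
    rw [norm_mul]
    calc P.distZero ^ M * (‖dirAL g P‖ * ‖G P‖) = ‖dirAL g P‖ * (P.distZero ^ M * ‖G P‖) := by ring
      _ ≤ D * C := mul_le_mul (hD P) (hC P)
          (mul_nonneg (pow_nonneg P.distZero_nonneg M) (norm_nonneg _)) hD0
  | @sub G H _ _ ih ih' =>
    obtain ⟨C, hC⟩ := ih
    obtain ⟨D, hD⟩ := ih'
    refine ⟨C + D, fun P => ?_⟩
    calc P.distZero ^ M * ‖G P - H P‖ ≤ P.distZero ^ M * (‖G P‖ + ‖H P‖) := by
          have := P.distZero_nonneg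
          gcongr
          exact norm_sub_le _ _
      _ ≤ C + D := by rw [mul_add]; exact add_le_add (hC P) (hD P)

theorem AL.act_aspExp_zero (Y : aspLie n) (P : AL n) : P.act (aspExp Y 0) = P := by
  have : affineAction (aspExp Y 0).1 = AffineMap.id ℝ (PhaseSpace n) := by
    ext1 v
    rw [affineAction_apply, aspExp_zero, linPart_one, transPart_one, add_zero]
    rfl
  refine Subtype.ext ?_
  simp only [AL.act]
  rw [this, AffineSubspace.map_id]

/-- The moved plane is parametrized by the original direction. The domain of integration is then
fixed, and only the integrand depends on `g`. -/
theorem radonAL_act (g : ASp n) (P : AL n) {p : PhaseSpace n} (hp : p ∈ P.1) :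
    (∫ w : P.1.direction, gauss n (linPart g.1 w)) ≠ 0 ∧
    (∀ f, radonAL f (P.act g) = (∫ w : P.1.direction, f (linPart g.1 (p + w) + transPart g.1)) /
      ∫ w : P.1.direction, gauss n (linPart g.1 w)) ∧
    ∀ f, dirAL f (P.act g) = (∫ w : P.1.direction, f (linPart g.1 w)) /
      ∫ w : P.1.direction, gauss n (linPart g.1 w) := by
  obtain ⟨h0, h1, h2⟩ := radonAL_mul (volume : Measure P.1.direction)
    ((linPart g.1 : PhaseSpace n →ₗ[ℝ] PhaseSpace n) ∘ₗ P.1.direction.subtype)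
    ((linPart_injective g).comp Subtype.val_injective) (P.act g)
    (by rw [direction_act, LinearMap.range_comp, Submodule.range_subtype])
  refine ⟨h0, fun f => (eq_div_iff h0).2 ?_, fun f => (eq_div_iff h0).2 (h2 f)⟩
  refine (h1 f _ (mem_act g hp)).trans ?_
  refine integral_congr_ae (Eventually.of_forall fun w => congrArg f ?_)
  simp only [map_add, LinearMap.comp_apply, ContinuousLinearMap.coe_coe, Submodule.subtype_apply]
  abel

/-- Quotient rule at t = 0, where the Gaussian denominator equals 1. The subtracted term accounts
for the change of the Euclidean volume under the flow. -/
theorem hasDerivAt_radonAL_act (f : 𝓢(PhaseSpace n, ℂ)) (Y : aspLie n) (P : AL n) :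
    HasDerivAt (fun t => radonAL f (P.act (aspExp Y t)))
      (radonAL (derivAlong (hasTemperateGrowth_affine (linPart Y.1) (transPart Y.1)) f) P -
        dirAL (derivAlong (hasTemperateGrowth_affine (linPart Y.1) 0) (gauss n)) P * radonAL f P) 0 := by
  obtain ⟨p, hp⟩ := P.2.1
  have hp' : p ∈ P.1 := hp
  have hN := hasDerivAt_integral_act f Y P.1.direction p
  have hD := hasDerivAt_integral_linear (gauss n) Y P.1.direction
  have h := hN.fun_div hD (radonAL_act (aspExp Y 0) P hp').1
  have hg0 : ∫ w : P.1.direction, gauss n (linPart (aspExp Y 0).1 w) = 1 := by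
    rw [aspExp_zero, linPart_one]
    exact dirAL_gauss P
  have hf0 : ∫ w : P.1.direction, f (linPart (aspExp Y 0).1 (p + w) + transPart (aspExp Y 0).1) =
      radonAL f P := by
    rw [aspExp_zero, linPart_one, transPart_one, radonAL_eq f P hp']
    simp
  rw [hg0, hf0, ← radonAL_eq _ P hp'] at h
  simp only [(radonAL_act _ P hp').2.1]
  refine h.congr_deriv ?_
  rw [mul_one, one_pow, div_one, mul_comm (dirAL _ _)]
  rfl

theorem hasDerivAt_dirAL_act (f : 𝓢(PhaseSpace n, ℂ)) (Y : aspLie n) (P : AL n) :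
    HasDerivAt (fun t => dirAL f (P.act (aspExp Y t)))
      (dirAL (derivAlong (hasTemperateGrowth_affine (linPart Y.1) 0) f) P -
        dirAL (derivAlong (hasTemperateGrowth_affine (linPart Y.1) 0) (gauss n)) P * dirAL f P) 0 := by
  obtain ⟨p, hp⟩ := P.2.1
  have hp' : p ∈ P.1 := hp
  have hN := hasDerivAt_integral_linear f Y P.1.direction
  have hD := hasDerivAt_integral_linear (gauss n) Y P.1.direction
  have h := hN.fun_div hD (radonAL_act (aspExp Y 0) P hp').1
  have hg0 : ∀ f : 𝓢(PhaseSpace n, ℂ), ∫ w : P.1.direction, f (linPart (aspExp Y 0).1 w) =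
      dirAL f P := by
    intro f
    rw [aspExp_zero, linPart_one]
    rfl
  rw [hg0, hg0, dirAL_gauss] at h
  simp only [(radonAL_act _ P hp').2.2]
  refine h.congr_deriv ?_
  rw [mul_one, one_pow, div_one, mul_comm (dirAL _ _) (dirAL f P)]
  rfl

theorem RadonClass.hasDerivAt {G : AL n → ℂ} (hG : RadonClass G) (Y : aspLie n) :
    ∃ G', RadonClass G' ∧ ∀ P, HasDerivAt (fun t => G (P.act (aspExp Y t))) (G' P) 0 := by
  induction hG with
  | radon f => exact ⟨_, .sub (.radon _) (.dir _ (.radon _)), hasDerivAt_radonAL_act f Y⟩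
  | @dir g G hG ih =>
    obtain ⟨G', hG', h⟩ := ih
    -- The class is generated with differences only, so the sum a + b of the product rule is written
    -- as a - (0 - b), with the zero realized as a multiple of `G P - G P`.
    refine ⟨fun P => (dirAL (derivAlong (hasTemperateGrowth_affine (linPart Y.1) 0) g) P * G P -
      dirAL (derivAlong (hasTemperateGrowth_affine (linPart Y.1) 0) (gauss n)) P *
        (dirAL g P * G P)) - (dirAL g P * (G P - G P) - dirAL g P * G' P),
      .sub (.sub (.dir _ hG) (.dir _ (.dir _ hG))) (.sub (.dir _ (.sub hG hG)) (.dir _ hG')),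
      fun P => ?_⟩
    refine ((hasDerivAt_dirAL_act g Y P).fun_mul (h P)).congr_deriv ?_
    rw [AL.act_aspExp_zero]
    ring
  | @sub G H _ _ ih ih' =>
    obtain ⟨G', hG', h⟩ := ih
    obtain ⟨H', hH', h'⟩ := ih'
    exact ⟨_, .sub hG' hH', fun P => (h P).fun_sub (h' P)⟩

theorem RadonClass.lieDeriv {G : AL n → ℂ} (hG : RadonClass G) (Ys : List (aspLie n)) :
    RadonClass (Ys.foldr lieDeriv G) := by
  induction Ys with
  | nil => exact hG
  | cons Y Ys ih =>
    obtain ⟨G', hG', h⟩ := ih.hasDerivAt Y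
    have : List.foldr LagrangianRadon.lieDeriv G (Y :: Ys) = G' := funext fun P => (h P).deriv
    rwa [this]

/-! ### Radon transforms are contained in the Schwartz space -/

/-- The composition of a Schwartz function with an affine symplectic transformation. -/
noncomputable def compAffine (g : ASp n) (r : PhaseSpace n) (f : 𝓢(PhaseSpace n, ℂ)) :
    𝓢(PhaseSpace n, ℂ) :=
  SchwartzMap.compCLMOfContinuousLinearEquiv ℝ (LinearEquiv.ofInjectiveEndo
    (linPart g.1 : PhaseSpace n →ₗ[ℝ] PhaseSpace n) (linPart_injective g)).toContinuousLinearEquiv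
    (SchwartzMap.compSubConstCLM ℝ (-r) f)

theorem compAffine_apply (g : ASp n) (r : PhaseSpace n) (f : 𝓢(PhaseSpace n, ℂ))
    (v : PhaseSpace n) : compAffine g r f v = f (linPart g.1 v + r) := by
  simp [compAffine]

theorem direction_graphPlane (p : Symm n × (Fin n → ℝ)) :
    (graphPlane p).1.direction = LinearMap.range (graphMap p.1) :=
  AffineSubspace.direction_mk' _ _

theorem mem_graphPlane {p : Symm n × (Fin n → ℝ)} {v : PhaseSpace n} :
    v ∈ (graphPlane p).1 ↔ ∀ i, v (Sum.inl i) =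
      (p.1.toMatrix *ᵥ fun j => v (Sum.inr j)) i + p.2 i := by
  rw [graphPlane, AffineSubspace.mem_mk']
  constructor
  · rintro ⟨y, hy⟩ i
    have h1 : v = graphMap p.1 y + point p.2 0 := by rw [hy]; simp
    rw [h1]
    simp [graphMap]
  · intro h
    refine ⟨fun j => v (Sum.inr j), ?_⟩
    ext i
    cases i with
    | inl i => simp [graphMap, h i]
    | inr i => simp [graphMap]

theorem point_mem_graphPlane (p : Symm n × (Fin n → ℝ)) : point p.2 0 ∈ (graphPlane p).1 :=
  AffineSubspace.self_mem_mk' _ _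

theorem graphMap_injective (T : Symm n) : Function.Injective (graphMap T) := fun y z h => by
  ext i
  exact congrArg (fun v : PhaseSpace n => v (Sum.inr i)) h

/-- In every chart of the atlas the Euclidean integral is a quotient of two flat transforms, with a
nowhere vanishing Gaussian transform at τ = 0 below. Smoothness is thus inherited from
`contDiff_radonFlat`. -/
theorem radonAL_act_graphPlane (f : 𝓢(PhaseSpace n, ℂ)) (g : ASp n) (p : Symm n × (Fin n → ℝ)) :
    radonFlat (compAffine g 0 (gauss n)) (p.1, 0) ≠ 0 ∧
    radonAL f ((graphPlane p).act g) = radonFlat (compAffine g (transPart g.1) f) p /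
      radonFlat (compAffine g 0 (gauss n)) (p.1, 0) := by
  obtain ⟨h0, h1, -⟩ := radonAL_mul (volume : Measure (Fin n → ℝ))
    ((linPart g.1 : PhaseSpace n →ₗ[ℝ] PhaseSpace n) ∘ₗ graphMap p.1)
    ((linPart_injective g).comp (graphMap_injective p.1)) ((graphPlane p).act g)
    (by rw [direction_act, LinearMap.range_comp, direction_graphPlane])
  have hg : radonFlat (compAffine g 0 (gauss n)) (p.1, 0) = ∫ y : Fin n → ℝ,
      gauss n (((linPart g.1 : PhaseSpace n →ₗ[ℝ] PhaseSpace n) ∘ₗ graphMap p.1) y) := by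
    simp only [radonFlat, compAffine_apply, add_zero]
    rfl
  rw [hg]
  refine ⟨h0, (eq_div_iff h0).2 ((h1 f _ (mem_act g (point_mem_graphPlane p))).trans ?_)⟩
  refine integral_congr_ae (Eventually.of_forall fun y => ?_)
  simp only [compAffine_apply]
  congr 1
  have : point (p.1.toMatrix *ᵥ y + p.2) y = point p.2 0 + graphMap p.1 y := by
    ext i
    cases i <;> simp [graphMap, add_comm]
  rw [this, map_add, LinearMap.comp_apply, ContinuousLinearMap.coe_coe]
  abel

theorem isSmooth_radonAL (f : 𝓢(PhaseSpace n, ℂ)) : IsSmooth (radonAL f) := by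
  intro g
  simp only [(radonAL_act_graphPlane f g _).2, div_eq_mul_inv]
  have h : ContDiff ℝ ∞ fun p : Symm n × (Fin n → ℝ) =>
      radonFlat (compAffine g 0 (gauss n)) (p.1, 0) :=
    (contDiff_radonFlat _).comp (contDiff_fst.prodMk contDiff_const)
  exact (contDiff_radonFlat _).mul (h.inv fun p => (radonAL_act_graphPlane f g p).1)

theorem isSchwartz_radonAL (f : 𝓢(PhaseSpace n, ℂ)) : IsSchwartz (radonAL f) :=
  ⟨isSmooth_radonAL f, fun Ys M => ((RadonClass.radon f).lieDeriv Ys).decay M⟩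

theorem one_mem_ASp : (1 : AffMatrix n) ∈ ASp n := by
  rw [← Matrix.fromBlocks_one]
  refine ⟨?_, Matrix.toBlocks_fromBlocks₂₁ _ _ _ _, Matrix.toBlocks_fromBlocks₂₂ _ _ _ _⟩
  rw [Matrix.toBlocks_fromBlocks₁₁]
  exact one_mem (Matrix.symplecticGroup (Fin n) ℝ)

theorem AL.act_one (P : AL n) : P.act ⟨1, one_mem_ASp⟩ = P := by
  have : affineAction (1 : AffMatrix n) = AffineMap.id ℝ (PhaseSpace n) := by
    ext1 v
    rw [affineAction_apply, linPart_one, transPart_one, add_zero]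
    rfl
  refine Subtype.ext ?_
  simp only [AL.act]
  rw [this, AffineSubspace.map_id]

/-! ### The density det(1 + T²)^(-1/2) as a Gaussian integral -/

theorem integral_gauss_pi : ∫ y : Fin n → ℝ, Real.exp (-Real.pi * (y ⬝ᵥ y)) = 1 := by
  have := GaussianFourier.integral_rexp_neg_mul_sq_norm (V := EuclideanSpace ℝ (Fin n)) Real.pi_pos
  rw [div_self Real.pi_ne_zero, Real.one_rpow] at this
  rw [← this, ← (EuclideanSpace.volume_preserving_symm_measurableEquiv_toLp (Fin n)).integral_comp
    (MeasurableEquiv.measurableEmbedding _)]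
  refine integral_congr_ae (Eventually.of_forall fun y => ?_)
  have : ‖(y : EuclideanSpace ℝ (Fin n))‖ ^ 2 = ∑ i, y.ofLp i * y.ofLp i := by
    rw [EuclideanSpace.norm_sq_eq]
    simp [sq]
  change _ = Real.exp (-Real.pi * ‖y‖ ^ 2)
  rw [this]
  rfl

open scoped MatrixOrder Matrix.Norms.L2Operator in
-- The positive square root of 1 + T² works, because |Sy|² = y · (1 + T²)y is the squared length of
-- (Ty, y).
theorem exists_sqrt_one_add_sq (T : Symm n) :
    ∃ S : Matrix (Fin n) (Fin n) ℝ, S.det = √(1 + T.toMatrix ^ 2).det ∧ 0 < S.det ∧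
      ∀ y, (S *ᵥ y) ⬝ᵥ (S *ᵥ y) = (T.toMatrix *ᵥ y) ⬝ᵥ (T.toMatrix *ᵥ y) + y ⬝ᵥ y := by
  have hT : T.toMatrixᴴ = T.toMatrix := by
    rw [Matrix.conjTranspose_eq_transpose_of_trivial, T.isSymm_toMatrix.eq]
  have hpos : (1 + T.toMatrix ^ 2).PosDef := by
    refine Matrix.PosDef.one.add_posSemidef ?_
    have := Matrix.posSemidef_conjTranspose_mul_self T.toMatrix
    rwa [hT, ← sq] at this
  have hnn : 0 ≤ 1 + T.toMatrix ^ 2 := Matrix.nonneg_iff_posSemidef.2 hpos.posSemidef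
  have hSS := CFC.sqrt_mul_sqrt_self _ hnn
  have hS : (CFC.sqrt (1 + T.toMatrix ^ 2))ᵀ = CFC.sqrt (1 + T.toMatrix ^ 2) := by
    have := (Matrix.nonneg_iff_posSemidef.1 (CFC.sqrt_nonneg (1 + T.toMatrix ^ 2))).isHermitian.eq
    rwa [Matrix.conjTranspose_eq_transpose_of_trivial] at this
  have hdet : (CFC.sqrt (1 + T.toMatrix ^ 2)).det = √(1 + T.toMatrix ^ 2).det := by
    rw [hpos.posSemidef.det_sqrt]
    simp
  refine ⟨CFC.sqrt (1 + T.toMatrix ^ 2), hdet, ?_, fun y => ?_⟩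
  · rw [hdet]
    exact Real.sqrt_pos.2 hpos.det_pos
  · have hq : ∀ A : Matrix (Fin n) (Fin n) ℝ, Aᵀ = A → (A *ᵥ y) ⬝ᵥ (A *ᵥ y) = y ⬝ᵥ ((A * A) *ᵥ y) := by
      intro A hA
      rw [Matrix.dotProduct_mulVec, ← Matrix.mulVec_transpose, hA, Matrix.mulVec_mulVec,
        dotProduct_comm]
    rw [hq _ hS, hSS, hq _ T.isSymm_toMatrix.eq, Matrix.add_mulVec, Matrix.one_mulVec,
      dotProduct_add, sq, add_comm]

/-- The substitution by the square root of 1 + T² reduces the integral to the standard Gaussian.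
This is the denominator of `radonAL_act_graphPlane` for the identity, so it yields exactly the
factor between `h` and F in the Schwartz condition. -/
theorem radonFlat_gauss (T : Symm n) :
    radonFlat (gauss n) (T, 0) = (((√(1 + T.toMatrix ^ 2).det)⁻¹ : ℝ) : ℂ) := by
  obtain ⟨S, hdet, hpos, hS⟩ := exists_sqrt_one_add_sq T
  have h1 : ∀ y, ‖point (T.toMatrix *ᵥ y) y‖ ^ 2 = (S *ᵥ y) ⬝ᵥ (S *ᵥ y) := by
    intro y
    rw [hS, EuclideanSpace.norm_sq_eq, Fintype.sum_sum_type]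
    simp [dotProduct, sq]
  simp only [radonFlat, gauss_apply, add_zero, h1]
  rw [integral_complex_ofReal]
  congr 1
  have hmap := Real.map_matrix_volume_pi_eq_smul_volume_pi hpos.ne'
  have h2 : ∫ y, Real.exp (-Real.pi * (y ⬝ᵥ y)) ∂(Measure.map (Matrix.toLin' S) volume) =
      ∫ y, Real.exp (-Real.pi * ((S *ᵥ y) ⬝ᵥ (S *ᵥ y))) := by
    rw [integral_map]
    · rfl
    · exact (LinearMap.continuous_of_finiteDimensional _).aemeasurable
    · refine Continuous.aestronglyMeasurable ?_
      simp only [dotProduct]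
      fun_prop
  rw [← h2, hmap, integral_smul_measure, integral_gauss_pi, ← hdet, smul_eq_mul, mul_one,
    ENNReal.toReal_ofReal (abs_nonneg _), abs_of_pos (inv_pos.2 hpos)]

theorem memSchwartzFlat_radonFlat (f : 𝓢(PhaseSpace n, ℂ)) : MemSchwartzFlat (radonFlat f) := by
  refine ⟨radonAL f, isSchwartz_radonAL f, fun T τ => ?_⟩
  obtain ⟨h0, h⟩ := radonAL_act_graphPlane f ⟨1, one_mem_ASp⟩ (T, τ)
  have hc : ∀ φ : 𝓢(PhaseSpace n, ℂ), compAffine ⟨1, one_mem_ASp⟩ 0 φ = φ := by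
    intro φ
    ext v
    rw [compAffine_apply, linPart_one, add_zero]
    rfl
  rw [AL.act_one, transPart_one, hc, hc] at h
  rw [hc] at h0
  rw [h, radonFlat_gauss] at *
  rw [Complex.real_smul, mul_div_cancel₀ _ h0]

/-! ### Functions of `(T, τ)` that are Schwartz functions of `τ`, locally uniformly in `T` -/

/-- Rapid decay in `τ`, uniformly for bounded `T`. -/
def RapidDecay {F : Type*} [Norm F] (g : Symm n × (Fin n → ℝ) → F) : Prop :=
  ∀ (R : ℝ) (M : ℕ), ∃ C : ℝ, 0 ≤ C ∧ ∀ p, ‖p.1‖ ≤ R → (1 + ‖p.2‖) ^ M * ‖g p‖ ≤ C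

/-- Iterated directional derivatives. -/
noncomputable def dirDerivs : List (Symm n × (Fin n → ℝ)) → (Symm n × (Fin n → ℝ) → ℂ) →
    Symm n × (Fin n → ℝ) → ℂ
  | [], g => g
  | w :: ws, g => dirDerivs ws fun p => fderiv ℝ g p w

/-- Smooth functions all of whose derivatives decay rapidly in `τ`, uniformly for bounded `T`. -/
def IsLocSchwartz (g : Symm n × (Fin n → ℝ) → ℂ) : Prop :=
  ContDiff ℝ ∞ g ∧ ∀ ws, RapidDecay (dirDerivs ws g)

theorem IsLocSchwartz.of_closed (S : (Symm n × (Fin n → ℝ) → ℂ) → Prop)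
    (h : ∀ g, S g → Differentiable ℝ g ∧ RapidDecay g ∧ ∀ w, S fun p => fderiv ℝ g p w)
    {g : Symm n × (Fin n → ℝ) → ℂ} (hg : S g) : IsLocSchwartz g := by
  refine ⟨contDiff_of_closed S (fun g hg => ⟨(h g hg).1, (h g hg).2.2⟩) hg, fun ws => ?_⟩
  induction ws generalizing g with
  | nil => exact (h g hg).2.1
  | cons w ws ih => exact ih ((h g hg).2.2 w)

theorem RapidDecay.add {g h : Symm n × (Fin n → ℝ) → ℂ} (hg : RapidDecay g) (hh : RapidDecay h) :
    RapidDecay fun p => g p + h p := by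
  intro R M
  obtain ⟨C, hC0, hC⟩ := hg R M
  obtain ⟨D, hD0, hD⟩ := hh R M
  refine ⟨C + D, by positivity, fun p hp => ?_⟩
  calc (1 + ‖p.2‖) ^ M * ‖g p + h p‖ ≤ (1 + ‖p.2‖) ^ M * (‖g p‖ + ‖h p‖) := by
        gcongr; exact norm_add_le _ _
    _ ≤ C + D := by rw [mul_add]; exact add_le_add (hC p hp) (hD p hp)

theorem RapidDecay.mul_of_growth {a g : Symm n × (Fin n → ℝ) → ℂ} (hg : RapidDecay g)
    (ha : ∀ R : ℝ, ∃ D : ℝ, 0 ≤ D ∧ ∀ p, ‖p.1‖ ≤ R → ‖a p‖ ≤ D * (1 + ‖p.2‖)) :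
    RapidDecay fun p => a p * g p := by
  intro R M
  obtain ⟨C, hC0, hC⟩ := hg R (M + 1)
  obtain ⟨D, hD0, hD⟩ := ha R
  refine ⟨D * C, by positivity, fun p hp => ?_⟩
  rw [norm_mul]
  calc (1 + ‖p.2‖) ^ M * (‖a p‖ * ‖g p‖)
      ≤ (1 + ‖p.2‖) ^ M * (D * (1 + ‖p.2‖) * ‖g p‖) := by gcongr; exact hD p hp
    _ = D * ((1 + ‖p.2‖) ^ (M + 1) * ‖g p‖) := by ring
    _ ≤ D * C := by gcongr; exact hC p hp

namespace IsLocSchwartz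

variable {g h : Symm n × (Fin n → ℝ) → ℂ}

theorem differentiable (hg : IsLocSchwartz g) : Differentiable ℝ g := hg.1.differentiable (by simp)

theorem continuous (hg : IsLocSchwartz g) : Continuous g := hg.1.continuous

theorem rapidDecay (hg : IsLocSchwartz g) : RapidDecay g := hg.2 []

theorem fderiv (hg : IsLocSchwartz g) (w : Symm n × (Fin n → ℝ)) :
    IsLocSchwartz fun p => fderiv ℝ g p w :=
  ⟨(hg.1.fderiv_right (by simp)).clm_apply contDiff_const, fun ws => hg.2 (w :: ws)⟩

theorem rapidDecay_fderiv (hg : IsLocSchwartz g) : RapidDecay (_root_.fderiv ℝ g) := by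
  intro R M
  let b := Module.finBasis ℝ (Symm n × (Fin n → ℝ))
  obtain ⟨K, hK0, hK⟩ := b.exists_opNorm_le (F := ℂ)
  choose C hC0 hC using fun i => (hg.fderiv (b i)).rapidDecay R M
  refine ⟨K * ∑ i, C i, mul_nonneg hK0.le (Finset.sum_nonneg fun i _ => hC0 i), fun p hp => ?_⟩
  have h := hK (u := _root_.fderiv ℝ g p) (M := (∑ i, C i) / (1 + ‖p.2‖) ^ M)
    (div_nonneg (Finset.sum_nonneg fun i _ => hC0 i) (by positivity)) fun i => by
      rw [le_div_iff₀ (by positivity), mul_comm]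
      exact (hC i p hp).trans (Finset.single_le_sum (fun i _ => hC0 i) (Finset.mem_univ i))
  rw [← mul_div_assoc, le_div_iff₀ (by positivity), mul_comm] at h
  exact h

theorem zero : IsLocSchwartz (fun _ : Symm n × (Fin n → ℝ) => (0 : ℂ)) :=
  of_closed (fun g => g = fun _ => 0) (by
    rintro _ rfl
    exact ⟨differentiable_const _, fun R M => ⟨0, le_rfl, fun p _ => by simp⟩, fun w => by simp⟩) rfl

theorem add (hg : IsLocSchwartz g) (hh : IsLocSchwartz h) : IsLocSchwartz fun p => g p + h p := by
  refine of_closed (fun f => ∃ g h, IsLocSchwartz g ∧ IsLocSchwartz h ∧ f = fun p => g p + h p) ?_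
    ⟨g, h, hg, hh, rfl⟩
  rintro _ ⟨g, h, hg, hh, rfl⟩
  refine ⟨hg.differentiable.add hh.differentiable, hg.rapidDecay.add hh.rapidDecay,
    fun w => ⟨_, _, hg.fderiv w, hh.fderiv w, ?_⟩⟩
  funext p
  rw [fderiv_fun_add (hg.differentiable p) (hh.differentiable p)]
  rfl

theorem sum {ι : Type*} (s : Finset ι) {g : ι → Symm n × (Fin n → ℝ) → ℂ}
    (hg : ∀ i ∈ s, IsLocSchwartz (g i)) : IsLocSchwartz fun p => ∑ i ∈ s, g i p := by
  classical
  induction s using Finset.induction_on with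
  | empty => simpa using zero
  | insert i s hi ih =>
    simp only [Finset.sum_insert hi]
    exact (hg i (by simp)).add (ih fun j hj => hg j (by simp [hj]))

/-- Products of a function of `T` with a function in the class, and their sums. -/
inductive MulSpan : (Symm n × (Fin n → ℝ) → ℂ) → Prop
  | mul {a : Symm n → ℂ} {g} : ContDiff ℝ ∞ a → IsLocSchwartz g → MulSpan fun p => a p.1 * g p
  | add {f g} : MulSpan f → MulSpan g → MulSpan fun p => f p + g p

/-- No growth condition on `a` is needed: all estimates concern bounded T, where a continuous
function is bounded. -/
theorem mul_left {a : Symm n → ℂ} (ha : ContDiff ℝ ∞ a) (hg : IsLocSchwartz g) :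
    IsLocSchwartz fun p => a p.1 * g p := by
  refine of_closed MulSpan (fun f hf => ?_) (.mul ha hg)
  induction hf with
  | @mul a g ha hg =>
    have had : Differentiable ℝ a := ha.differentiable (by simp)
    have hd : ∀ p, HasFDerivAt (fun p : Symm n × (Fin n → ℝ) => a p.1 * g p) _ p := fun p =>
      ((had p.1).hasFDerivAt.comp p hasFDerivAt_fst).mul (hg.differentiable p).hasFDerivAt
    refine ⟨fun p => (hd p).differentiableAt, hg.rapidDecay.mul_of_growth fun R => ?_, fun w => ?_⟩
    · obtain ⟨D, hD⟩ := (isCompact_closedBall (0 : Symm n) R).exists_bound_of_continuousOn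
        ha.continuous.continuousOn
      refine ⟨|D|, abs_nonneg D, fun p hp => ?_⟩
      have h1 := hD p.1 (by simpa using hp)
      nlinarith [le_abs_self D, abs_nonneg D, norm_nonneg p.2,
        mul_nonneg (abs_nonneg D) (norm_nonneg p.2)]
    · have : (fun p : Symm n × (Fin n → ℝ) => _root_.fderiv ℝ (fun p => a p.1 * g p) p w) =
          fun p => a p.1 * _root_.fderiv ℝ g p w + _root_.fderiv ℝ a p.1 w.1 * g p := by
        funext p
        rw [(hd p).fderiv]
        simp [mul_comm]
      rw [this]
      exact .add (.mul ha (hg.fderiv w))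
        (.mul (a := fun T => _root_.fderiv ℝ a T w.1)
          ((ha.fderiv_right (by simp)).clm_apply contDiff_const) hg)
  | @add f g _ _ ih ih' =>
    refine ⟨ih.1.add ih'.1, ih.2.1.add ih'.2.1, fun w => ?_⟩
    have : (fun p : Symm n × (Fin n → ℝ) => _root_.fderiv ℝ (fun p => f p + g p) p w) =
        fun p => _root_.fderiv ℝ f p w + _root_.fderiv ℝ g p w := by
      funext p
      rw [fderiv_fun_add (ih.1 p) (ih'.1 p)]
      rfl
    rw [this]
    exact .add (ih.2.2 w) (ih'.2.2 w)

theorem const_mul (c : ℂ) (hg : IsLocSchwartz g) : IsLocSchwartz fun p => c * g p :=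
  mul_left (a := fun _ => c) contDiff_const hg

theorem mul_clm (l : (Symm n × (Fin n → ℝ)) →L[ℝ] ℂ) (hg : IsLocSchwartz g) :
    IsLocSchwartz fun p => l p * g p := by
  -- The products l·g alone are not visibly stable under derivatives; the summand `h` absorbs the
  -- terms l(w)·g from the product rule.
  refine of_closed (fun f => ∃ g h, IsLocSchwartz g ∧ IsLocSchwartz h ∧
    f = fun p => l p * g p + h p) ?_ ⟨g, fun _ => 0, hg, zero, by simp⟩
  rintro _ ⟨g, h, hg, hh, rfl⟩
  have hd : ∀ p, HasFDerivAt (fun p : Symm n × (Fin n → ℝ) => l p * g p + h p) _ p := fun p =>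
    (l.hasFDerivAt.mul (hg.differentiable p).hasFDerivAt).add (hh.differentiable p).hasFDerivAt
  refine ⟨fun p => (hd p).differentiableAt, (hg.rapidDecay.mul_of_growth fun R => ?_).add
    hh.rapidDecay, fun w => ⟨_, _, hg.fderiv w, (hg.const_mul (l w)).add (hh.fderiv w), ?_⟩⟩
  · refine ⟨‖l‖ * (1 + |R|), by positivity, fun p hp => (l.le_opNorm p).trans ?_⟩
    rw [mul_assoc]
    gcongr
    refine max_le ?_ ?_
    · nlinarith [le_abs_self R, abs_nonneg R, norm_nonneg p.2,
        mul_nonneg (abs_nonneg R) (norm_nonneg p.2)]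
    · nlinarith [abs_nonneg R, norm_nonneg p.2, mul_nonneg (abs_nonneg R) (norm_nonneg p.2)]
  · funext p
    rw [(hd p).fderiv]
    simp
    ring

end IsLocSchwartz

/-! ### The Fourier transform in `τ` -/

theorem abs_dotProduct_le (x y : Fin n → ℝ) : |x ⬝ᵥ y| ≤ n * ‖x‖ * ‖y‖ := by
  calc |x ⬝ᵥ y| ≤ ∑ i, |x i * y i| := Finset.abs_sum_le_sum_abs _ _
    _ ≤ ∑ _i : Fin n, ‖x‖ * ‖y‖ := Finset.sum_le_sum fun i _ => by
        rw [abs_mul]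
        exact mul_le_mul (norm_le_pi_norm x i) (norm_le_pi_norm y i) (abs_nonneg _) (norm_nonneg _)
    _ = n * ‖x‖ * ‖y‖ := by simp [mul_assoc]

/-- The linear functional `ξ ↦ τ · ξ`. -/
noncomputable def dotL (τ : Fin n → ℝ) : (Fin n → ℝ) →L[ℝ] ℝ :=
  ∑ i, τ i • ContinuousLinearMap.proj i

@[simp]
theorem dotL_apply (τ ξ : Fin n → ℝ) : dotL τ ξ = τ ⬝ᵥ ξ := by
  simp [dotL, dotProduct, sum_apply]

/-- The character `exp (-2πi τ·ξ)`. -/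
noncomputable def expPhase (τ ξ : Fin n → ℝ) : ℂ :=
  Complex.exp (((-2 * Real.pi * (τ ⬝ᵥ ξ) : ℝ) : ℂ) * Complex.I)

theorem norm_expPhase (τ ξ : Fin n → ℝ) : ‖expPhase τ ξ‖ = 1 :=
  Complex.norm_exp_ofReal_mul_I _

theorem expPhase_comm (τ ξ : Fin n → ℝ) : expPhase τ ξ = expPhase ξ τ := by
  rw [expPhase, expPhase, dotProduct_comm]

theorem hasFDerivAt_expPhase (τ ξ : Fin n → ℝ) :
    HasFDerivAt (expPhase τ)
      (expPhase τ ξ • ((-2 * Real.pi * Complex.I : ℂ) • Complex.ofRealCLM.comp (dotL τ))) ξ := by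
  have h1 : HasFDerivAt (fun ξ => ((-2 * Real.pi * (τ ⬝ᵥ ξ) : ℝ) : ℂ) * Complex.I)
      ((-2 * Real.pi * Complex.I : ℂ) • Complex.ofRealCLM.comp (dotL τ)) ξ := by
    have h2 := ((-2 * Real.pi * Complex.I : ℂ) • Complex.ofRealCLM.comp (dotL τ)).hasFDerivAt (x := ξ)
    refine h2.congr_of_eventuallyEq (Eventually.of_forall fun ξ => ?_)
    simp
    ring
  exact h1.cexp

theorem continuous_expPhase_right (τ : Fin n → ℝ) : Continuous (expPhase τ) :=
  continuous_iff_continuousAt.2 fun ξ => (hasFDerivAt_expPhase τ ξ).continuousAt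

theorem continuous_expPhase_left (ξ : Fin n → ℝ) : Continuous fun τ => expPhase τ ξ := by
  simp_rw [fun τ => expPhase_comm τ ξ]
  exact continuous_expPhase_right ξ

/-- The Fourier transform in `τ` of a function of `(T, τ)`. -/
noncomputable def fourierTau (h : Symm n × (Fin n → ℝ) → ℂ) (p : Symm n × (Fin n → ℝ)) : ℂ :=
  ∫ τ : Fin n → ℝ, expPhase τ p.2 * h (p.1, τ)

/-- The linear functional that the derivative of the Fourier transform in the direction `w`
multiplies by. -/
noncomputable def phaseL (w : Symm n × (Fin n → ℝ)) : (Symm n × (Fin n → ℝ)) →L[ℝ] ℂ :=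
  ((-2 * Real.pi * Complex.I : ℂ) • Complex.ofRealCLM.comp (dotL w.2)).comp
    (ContinuousLinearMap.snd ℝ _ _)

theorem phaseL_apply (w p : Symm n × (Fin n → ℝ)) :
    phaseL w p = -2 * Real.pi * Complex.I * ((p.2 ⬝ᵥ w.2 : ℝ) : ℂ) := by
  simp [phaseL, dotProduct_comm]

theorem integrable_one_add_norm_pow_pi :
    Integrable fun y : Fin n → ℝ => ((1 + ‖y‖) ^ (n + 1))⁻¹ :=
  integrable_one_add_norm_pow (by simp)

namespace IsLocSchwartz

variable {h g : Symm n × (Fin n → ℝ) → ℂ}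

theorem continuous_slice (hh : IsLocSchwartz h) (T : Symm n) : Continuous fun τ => h (T, τ) :=
  hh.continuous.comp (Continuous.prodMk continuous_const continuous_id)

theorem integrable_slice (hh : IsLocSchwartz h) (T : Symm n) : Integrable fun τ => h (T, τ) := by
  obtain ⟨C, -, hC⟩ := hh.rapidDecay ‖T‖ (n + 1)
  exact integrable_of_decay integrable_one_add_norm_pow_pi (hh.continuous_slice T)
    fun τ => hC (T, τ) le_rfl

theorem integrable_phase_mul (hh : IsLocSchwartz h) (T : Symm n) (ξ : Fin n → ℝ) :
    Integrable fun τ => expPhase τ ξ * h (T, τ) := by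
  refine (hh.integrable_slice T).bdd_mul (c := 1) (continuous_expPhase_left ξ).aestronglyMeasurable
    (Eventually.of_forall fun τ => (norm_expPhase τ ξ).le)

/-- A T-derivative falls on `h`, and a ξ-derivative falls on the character and produces a factor
-2πi τ·w. Both results are transforms of functions in the class, so the statement can be iterated.
-/
theorem hasFDerivAt_fourierTau (hh : IsLocSchwartz h) (p : Symm n × (Fin n → ℝ)) :
    ∃ L : (Symm n × (Fin n → ℝ)) →L[ℝ] ℂ, HasFDerivAt (fourierTau h) L p ∧
      ∀ w, L w = fourierTau (fun p => _root_.fderiv ℝ h p (w.1, 0) + phaseL w p * h p) p := by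
  let φ' : Symm n × (Fin n → ℝ) → (Fin n → ℝ) → (Symm n × (Fin n → ℝ)) →L[ℝ] ℂ := fun p τ =>
    expPhase τ p.2 • (_root_.fderiv ℝ h (p.1, τ)).comp
      ((ContinuousLinearMap.inl ℝ _ _).comp (ContinuousLinearMap.fst ℝ _ _)) +
    h (p.1, τ) • (expPhase τ p.2 •
      ((-2 * Real.pi * Complex.I : ℂ) • Complex.ofRealCLM.comp (dotL τ))).comp
        (ContinuousLinearMap.snd ℝ _ _)
  have hφ' : ∀ p τ w, φ' p τ w =
      expPhase τ p.2 * (_root_.fderiv ℝ h (p.1, τ) (w.1, 0) + phaseL w (p.1, τ) * h (p.1, τ)) := by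
    intro p τ w
    simp [φ', phaseL_apply]
    ring
  -- One power more than integrability requires, to pay for the factor τ produced by the
  -- ξ-derivative.
  obtain ⟨C₀, hC₀, hb₀⟩ := hh.rapidDecay (‖p‖ + 1) (n + 1 + 1)
  obtain ⟨C₁, hC₁, hb₁⟩ := hh.rapidDecay_fderiv (‖p‖ + 1) (n + 1)
  have hp1 : ∀ q ∈ Metric.ball p 1, ‖q.1‖ ≤ ‖p‖ + 1 := by
    intro q hq
    have h1 : ‖q‖ ≤ ‖p‖ + ‖q - p‖ := by
      have := norm_add_le p (q - p)
      rwa [add_sub_cancel] at this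
    rw [mem_ball_iff_norm] at hq
    linarith [norm_fst_le q]
  have hb : ∀ q ∈ Metric.ball p 1, ∀ τ, (1 + ‖τ‖) ^ (n + 1) * ‖φ' q τ‖ ≤
      C₁ + 2 * Real.pi * n * C₀ := by
    intro q hq τ
    have h1 := hb₀ (q.1, τ) (hp1 q hq)
    have h2 := hb₁ (q.1, τ) (hp1 q hq)
    have h3 : ‖φ' q τ‖ ≤ ‖_root_.fderiv ℝ h (q.1, τ)‖ +
        2 * Real.pi * n * ((1 + ‖τ‖) * ‖h (q.1, τ)‖) := by
      refine ContinuousLinearMap.opNorm_le_bound _ (by positivity) fun w => ?_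
      rw [hφ', norm_mul, norm_expPhase, one_mul, add_mul]
      refine (norm_add_le _ _).trans (add_le_add ?_ ?_)
      · refine (ContinuousLinearMap.le_opNorm _ _).trans ?_
        gcongr
        simpa using norm_fst_le w
      · rw [phaseL_apply, norm_mul, norm_mul, Complex.norm_real]
        have h4 : ‖(-2 * Real.pi * Complex.I : ℂ)‖ = 2 * Real.pi := by
          simp [abs_of_pos Real.pi_pos]
        rw [h4, Real.norm_eq_abs]
        calc 2 * Real.pi * |τ ⬝ᵥ w.2| * ‖h (q.1, τ)‖
            ≤ 2 * Real.pi * (n * (1 + ‖τ‖) * ‖w‖) * ‖h (q.1, τ)‖ := by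
              gcongr
              refine (abs_dotProduct_le _ _).trans ?_
              gcongr
              · linarith
              · exact norm_snd_le w
          _ = _ := by ring
    calc (1 + ‖τ‖) ^ (n + 1) * ‖φ' q τ‖
        ≤ (1 + ‖τ‖) ^ (n + 1) * (‖_root_.fderiv ℝ h (q.1, τ)‖ +
          2 * Real.pi * n * ((1 + ‖τ‖) * ‖h (q.1, τ)‖)) := by gcongr
      _ = (1 + ‖τ‖) ^ (n + 1) * ‖_root_.fderiv ℝ h (q.1, τ)‖ +
          2 * Real.pi * n * ((1 + ‖τ‖) ^ (n + 1 + 1) * ‖h (q.1, τ)‖) := by ring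
      _ ≤ _ := by gcongr
  have hc' : Continuous (φ' p) := by
    refine continuous_clm_apply.2 fun w => ?_
    simp only [hφ']
    have h1 := (hh.fderiv (w.1, 0)).continuous_slice p.1
    have h2 : Continuous fun τ : Fin n → ℝ => phaseL w (p.1, τ) :=
      (phaseL w).continuous.comp (Continuous.prodMk continuous_const continuous_id)
    exact (continuous_expPhase_left p.2).mul (h1.add (h2.mul (hh.continuous_slice p.1)))
  have hint : Integrable (φ' p) := integrable_of_decay integrable_one_add_norm_pow_pi hc'
    (hb p (Metric.mem_ball_self one_pos))
  have hd : ∀ q ∈ Metric.ball p 1, ∀ τ,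
      HasFDerivAt (fun q : Symm n × (Fin n → ℝ) => expPhase τ q.2 * h (q.1, τ)) (φ' q τ) q := by
    intro q _ τ
    have h1 : HasFDerivAt (fun q : Symm n × (Fin n → ℝ) => expPhase τ q.2) _ q :=
      (hasFDerivAt_expPhase τ q.2).comp q hasFDerivAt_snd
    have h2 : HasFDerivAt (fun q : Symm n × (Fin n → ℝ) => h (q.1, τ)) _ q :=
      (hh.differentiable (q.1, τ)).hasFDerivAt.comp q
        (hasFDerivAt_fst.prodMk (hasFDerivAt_const τ q))
    refine (h1.mul h2).congr_fderiv ?_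
    refine ContinuousLinearMap.ext fun w => ?_
    rw [hφ', phaseL_apply]
    simp only [add_apply, smul_apply, ContinuousLinearMap.comp_apply,
      ContinuousLinearMap.prod_apply, ContinuousLinearMap.coe_fst', ContinuousLinearMap.coe_snd',
      zero_apply, dotL_apply, Complex.ofRealCLM_apply, smul_eq_mul]
    ring
  have hb' : ∀ τ, (1 + ‖τ‖) ^ (n + 1) * ‖expPhase τ p.2 * h (p.1, τ)‖ ≤ C₀ := by
    intro τ
    rw [norm_mul, norm_expPhase, one_mul]
    refine le_trans ?_ (hb₀ (p.1, τ) (by linarith [norm_fst_le p]))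
    gcongr
    · linarith [norm_nonneg τ]
    · omega
  have hcφ : ∀ q : Symm n × (Fin n → ℝ), Continuous fun τ => expPhase τ q.2 * h (q.1, τ) :=
    fun q => (continuous_expPhase_left q.2).mul (hh.continuous_slice q.1)
  have hF := hasFDerivAt_integral_of_decay (μ := volume)
    (φ := fun (q : Symm n × (Fin n → ℝ)) (τ : Fin n → ℝ) => expPhase τ q.2 * h (q.1, τ))
    one_pos integrable_one_add_norm_pow_pi hcφ hc' hd hb' hb
  refine ⟨∫ τ, φ' p τ, hF, fun w => ?_⟩
  · rw [ContinuousLinearMap.integral_apply hint]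
    simp only [hφ']
    rfl

theorem mul_phaseL (hh : IsLocSchwartz h) (w : Symm n × (Fin n → ℝ)) :
    IsLocSchwartz fun p => _root_.fderiv ℝ h p (w.1, 0) + phaseL w p * h p :=
  (hh.fderiv (w.1, 0)).add (hh.mul_clm (phaseL w))

theorem fderiv_fourierTau (hh : IsLocSchwartz h) (p w : Symm n × (Fin n → ℝ)) :
    _root_.fderiv ℝ (fourierTau h) p w =
      fourierTau (fun p => _root_.fderiv ℝ h p (w.1, 0) + phaseL w p * h p) p := by
  obtain ⟨L, hL, hw⟩ := hh.hasFDerivAt_fourierTau p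
  rw [hL.fderiv, hw]

theorem contDiff_fourierTau (hh : IsLocSchwartz h) : ContDiff ℝ ∞ (fourierTau h) := by
  refine contDiff_of_closed (fun g => ∃ h, IsLocSchwartz h ∧ g = fourierTau h) ?_ ⟨h, hh, rfl⟩
  rintro _ ⟨h, hh, rfl⟩
  refine ⟨fun p => ?_, fun w => ⟨_, hh.mul_phaseL w, funext fun p => hh.fderiv_fourierTau p w⟩⟩
  obtain ⟨L, hL, -⟩ := hh.hasFDerivAt_fourierTau p
  exact hL.differentiableAt

theorem continuous_fourierTau (hh : IsLocSchwartz h) : Continuous (fourierTau h) :=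
  hh.contDiff_fourierTau.continuous

theorem differentiable_fourierTau (hh : IsLocSchwartz h) : Differentiable ℝ (fourierTau h) :=
  hh.contDiff_fourierTau.differentiable (by simp)

theorem fourierTau_add (hh : IsLocSchwartz h) (hg : IsLocSchwartz g) (p : Symm n × (Fin n → ℝ)) :
    fourierTau (fun p => h p + g p) p = fourierTau h p + fourierTau g p := by
  simp only [fourierTau, mul_add]
  exact integral_add (hh.integrable_phase_mul _ _) (hg.integrable_phase_mul _ _)

theorem _root_.LagrangianRadon.fourierTau_const_mul (c : ℂ) (h : Symm n × (Fin n → ℝ) → ℂ)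
    (p : Symm n × (Fin n → ℝ)) : fourierTau (fun p => c * h p) p = c * fourierTau h p := by
  simp only [fourierTau, mul_left_comm _ c]
  exact integral_const_mul _ _

theorem _root_.LagrangianRadon.fourierTau_mul_left (a : Symm n → ℂ) (h : Symm n × (Fin n → ℝ) → ℂ)
    (p : Symm n × (Fin n → ℝ)) : fourierTau (fun p => a p.1 * h p) p = a p.1 * fourierTau h p := by
  simp only [fourierTau, mul_left_comm _ (a _)]
  exact integral_const_mul _ _

theorem fourierTau_sum {ι : Type*} (s : Finset ι) {g : ι → Symm n × (Fin n → ℝ) → ℂ}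
    (hg : ∀ i ∈ s, IsLocSchwartz (g i)) (p : Symm n × (Fin n → ℝ)) :
    fourierTau (fun p => ∑ i ∈ s, g i p) p = ∑ i ∈ s, fourierTau (g i) p := by
  simp only [fourierTau, Finset.mul_sum]
  exact integral_finsetSum _ fun i hi => (hg i hi).integrable_phase_mul _ _

/-- Derivatives in `T` commute with the Fourier transform. -/
theorem fourierTau_fderiv_left (hh : IsLocSchwartz h) (S : Symm n) (p : Symm n × (Fin n → ℝ)) :
    fourierTau (fun p => _root_.fderiv ℝ h p (S, 0)) p = _root_.fderiv ℝ (fourierTau h) p (S, 0) := by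
  rw [hh.fderiv_fourierTau]
  simp [phaseL_apply]

/-- Derivatives in `τ` become multiplications. -/
theorem fourierTau_fderiv_right (hh : IsLocSchwartz h) (σ : Fin n → ℝ)
    (p : Symm n × (Fin n → ℝ)) :
    fourierTau (fun p => _root_.fderiv ℝ h p (0, σ)) p =
      2 * Real.pi * Complex.I * ((σ ⬝ᵥ p.2 : ℝ) : ℂ) * fourierTau h p := by
  have h1 : ∀ τ, HasFDerivAt (fun τ => expPhase τ p.2) _ τ := fun τ => by
    simp_rw [fun τ => expPhase_comm τ p.2]
    exact hasFDerivAt_expPhase p.2 τ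
  have h2 : ∀ τ, HasFDerivAt (fun τ => h (p.1, τ)) _ τ := fun τ =>
    (hh.differentiable (p.1, τ)).hasFDerivAt.comp τ ((hasFDerivAt_const p.1 τ).prodMk
      (hasFDerivAt_id τ))
  have e1 : ∀ τ, _root_.fderiv ℝ (fun τ => expPhase τ p.2) τ σ =
      expPhase τ p.2 * (-2 * Real.pi * Complex.I * ((σ ⬝ᵥ p.2 : ℝ) : ℂ)) := by
    intro τ
    rw [(h1 τ).fderiv, expPhase_comm p.2 τ]
    simp [dotProduct_comm]
  have e2 : ∀ τ, _root_.fderiv ℝ (fun τ => h (p.1, τ)) τ σ = _root_.fderiv ℝ h (p.1, τ) (0, σ) := by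
    intro τ
    rw [(h2 τ).fderiv]
    simp
  have key := integral_mul_fderiv_eq_neg_fderiv_mul_of_integrable (μ := volume)
    (f := fun τ => expPhase τ p.2) (g := fun τ => h (p.1, τ)) (v := σ) ?_ ?_
    (hh.integrable_phase_mul p.1 p.2) (fun τ _ => (h1 τ).differentiableAt)
    (fun τ _ => (h2 τ).differentiableAt)
  · simp only [e1, e2] at key
    rw [fourierTau, key, fourierTau, ← integral_const_mul, ← integral_neg]
    congr 1
    funext τ
    ring
  · simp only [e1]
    refine ((hh.integrable_phase_mul p.1 p.2).mul_const
      (-2 * Real.pi * Complex.I * ((σ ⬝ᵥ p.2 : ℝ) : ℂ))).congr (Eventually.of_forall fun τ => ?_)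
    simp only
    ring
  · simp only [e2]
    exact (hh.fderiv (0, σ)).integrable_phase_mul p.1 p.2

theorem bounded_fourierTau (hh : IsLocSchwartz h) (R : ℝ) :
    ∃ C : ℝ, 0 ≤ C ∧ ∀ p : Symm n × (Fin n → ℝ), ‖p.1‖ ≤ R → ‖fourierTau h p‖ ≤ C := by
  obtain ⟨C, hC0, hC⟩ := hh.rapidDecay R (n + 1)
  refine ⟨C * ∫ y : Fin n → ℝ, ((1 + ‖y‖) ^ (n + 1))⁻¹,
    mul_nonneg hC0 (integral_nonneg fun _ => by positivity), fun p hp => ?_⟩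
  refine norm_integral_le_of_decay integrable_one_add_norm_pow_pi fun τ => ?_
  rw [norm_mul, norm_expPhase, one_mul]
  exact hC (p.1, τ) hp

/-- Induction on M: up to 2πi, multiplication of the transform by ξ_i is the transform of ∂h/∂τ_i,
which is in the class again. The sup norm of ξ is recovered from its coordinates. -/
theorem decay_fourierTau (hh : IsLocSchwartz h) (R : ℝ) (M : ℕ) :
    ∃ C : ℝ, 0 ≤ C ∧ ∀ p : Symm n × (Fin n → ℝ), ‖p.1‖ ≤ R → ‖p.2‖ ^ M * ‖fourierTau h p‖ ≤ C := by
  induction M generalizing h with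
  | zero => simpa using hh.bounded_fourierTau R
  | succ M ih =>
    choose C hC0 hC using fun i : Fin n => ih (hh.fderiv (0, Pi.single i 1))
    refine ⟨∑ i, C i, Finset.sum_nonneg fun i _ => hC0 i, fun p hp => ?_⟩
    have h1 : ∀ i, ‖p.2‖ ^ M * ‖fourierTau h p‖ * |p.2 i| ≤ ∑ i, C i := by
      intro i
      refine le_trans ?_ ((hC i p hp).trans
        (Finset.single_le_sum (f := C) (fun i _ => hC0 i) (Finset.mem_univ i)))
      rw [hh.fourierTau_fderiv_right, norm_mul, norm_mul, Complex.norm_real]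
      have h4 : ‖(2 * Real.pi * Complex.I : ℂ)‖ = 2 * Real.pi := by
        simp [abs_of_pos Real.pi_pos]
      rw [h4, single_one_dotProduct, Real.norm_eq_abs]
      have h5 : 0 ≤ ‖p.2‖ ^ M * ‖fourierTau h p‖ * |p.2 i| := by positivity
      nlinarith [Real.pi_gt_three]
    have hS : 0 ≤ ∑ i, C i := Finset.sum_nonneg fun i _ => hC0 i
    rcases eq_or_ne (‖p.2‖ ^ M * ‖fourierTau h p‖) 0 with h0 | h0
    · rw [pow_succ, mul_right_comm, h0, zero_mul]
      exact hS
    · have hpos : 0 < ‖p.2‖ ^ M * ‖fourierTau h p‖ := lt_of_le_of_ne (by positivity) h0.symm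
      have h6 : ‖p.2‖ ≤ (∑ i, C i) / (‖p.2‖ ^ M * ‖fourierTau h p‖) :=
        (pi_norm_le_iff_of_nonneg (div_nonneg hS hpos.le)).2 fun i => by
          rw [le_div_iff₀ hpos, mul_comm]
          exact h1 i
      rw [le_div_iff₀ hpos] at h6
      calc _ = ‖p.2‖ * (‖p.2‖ ^ M * ‖fourierTau h p‖) := by ring
        _ ≤ _ := h6

end IsLocSchwartz

/-! ### Injectivity of the Fourier transform -/

/-- Fourier inversion, applicable because the zero function is integrable. The function is
transported to Euclidean space, where the inversion theorem is stated. -/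
theorem eq_zero_of_fourier_eq_zero {φ : (Fin n → ℝ) → ℂ} (hc : Continuous φ) (hi : Integrable φ)
    (h : ∀ ξ, ∫ τ, expPhase τ ξ * φ τ = 0) : φ = 0 := by
  let ψ : EuclideanSpace ℝ (Fin n) → ℂ := fun v => φ (WithLp.ofLp v)
  have hψc : Continuous ψ := hc.comp (PiLp.continuous_ofLp 2 _)
  have hmp := EuclideanSpace.volume_preserving_symm_measurableEquiv_toLp (Fin n)
  have hψi : Integrable ψ := hmp.integrable_comp_of_integrable hi
  have hF : FourierTransform.fourier ψ = 0 := by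
    funext w
    rw [Real.fourier_eq', Pi.zero_apply, ← h (WithLp.ofLp w),
      ← hmp.integral_comp (MeasurableEquiv.measurableEmbedding _)]
    refine integral_congr_ae (Eventually.of_forall fun v => ?_)
    simp only [smul_eq_mul, ψ, expPhase]
    congr 4
    rw [PiLp.inner_apply]
    simp [dotProduct, mul_comm]
  have hinv := hψc.fourierInv_fourier_eq hψi (by rw [hF]; exact integrable_zero _ _ _)
  funext τ
  have h1 := congrFun hinv (WithLp.toLp 2 τ)
  rw [hF, Real.fourierInv_eq'] at h1
  simpa [ψ] using h1.symm

/-! ### Integration along the coordinate lines in `τ` -/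

/-- The integral of `g` over the points `τ + s e_k`, `s ∈ A`. -/
noncomputable def lineInt (A : Set ℝ) (k : Fin n) (g : Symm n × (Fin n → ℝ) → ℂ)
    (p : Symm n × (Fin n → ℝ)) : ℂ :=
  ∫ s in A, g (p.1, p.2 + s • Pi.single k 1)

theorem norm_single_one (k : Fin n) (s : ℝ) : ‖s • (Pi.single k 1 : Fin n → ℝ)‖ = |s| := by
  rw [norm_smul, Real.norm_eq_abs]
  simp [Pi.norm_single]

theorem one_add_abs_le (τ : Fin n → ℝ) (k : Fin n) (s : ℝ) :
    1 + |s| ≤ (1 + ‖τ‖) * (1 + ‖τ + s • Pi.single k 1‖) := by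
  have h : |s| ≤ ‖τ + s • Pi.single k 1‖ + ‖τ‖ := by
    have := norm_sub_le (τ + s • (Pi.single k 1 : Fin n → ℝ)) τ
    rwa [add_sub_cancel_left, norm_single_one] at this
  nlinarith [norm_nonneg τ, norm_nonneg (τ + s • (Pi.single k 1 : Fin n → ℝ)),
    mul_nonneg (norm_nonneg τ) (norm_nonneg (τ + s • (Pi.single k 1 : Fin n → ℝ)))]

theorem integrable_one_add_norm_pow_real (A : Set ℝ) :
    Integrable (fun s : ℝ => ((1 + ‖s‖) ^ 2)⁻¹) (volume.restrict A) :=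
  (integrable_one_add_norm_pow (μ := volume) (by simp)).restrict

namespace IsLocSchwartz

variable {g : Symm n × (Fin n → ℝ) → ℂ}

theorem continuous_line (hg : IsLocSchwartz g) (p : Symm n × (Fin n → ℝ)) (k : Fin n) :
    Continuous fun s : ℝ => g (p.1, p.2 + s • Pi.single k 1) :=
  hg.continuous.comp (by fun_prop)

theorem line_decay {F : Type*} [NormedAddCommGroup F] {f : Symm n × (Fin n → ℝ) → F}
    (hf : RapidDecay f) (R : ℝ) : ∃ C : ℝ, 0 ≤ C ∧ ∀ p : Symm n × (Fin n → ℝ), ‖p‖ ≤ R → ∀ k, ∀ s : ℝ,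
      (1 + ‖s‖) ^ 2 * ‖f (p.1, p.2 + s • Pi.single k 1)‖ ≤ C := by
  obtain ⟨C, hC0, hC⟩ := hf R 2
  refine ⟨(1 + R) ^ 2 * C, by positivity, fun p hp k s => ?_⟩
  calc (1 + ‖s‖) ^ 2 * ‖f (p.1, p.2 + s • Pi.single k 1)‖
      ≤ ((1 + R) * (1 + ‖p.2 + s • Pi.single k 1‖)) ^ 2 *
          ‖f (p.1, p.2 + s • Pi.single k 1)‖ := by
        gcongr
        refine (one_add_abs_le p.2 k s).trans ?_
        gcongr
        exact (norm_snd_le p).trans hp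
    _ = (1 + R) ^ 2 * ((1 + ‖p.2 + s • Pi.single k 1‖) ^ 2 *
          ‖f (p.1, p.2 + s • Pi.single k 1)‖) := by ring
    _ ≤ _ := by
        gcongr
        exact hC (p.1, p.2 + s • Pi.single k 1) ((norm_fst_le p).trans hp)

theorem integrable_line (hg : IsLocSchwartz g) (A : Set ℝ) (p : Symm n × (Fin n → ℝ)) (k : Fin n) :
    IntegrableOn (fun s : ℝ => g (p.1, p.2 + s • Pi.single k 1)) A := by
  obtain ⟨C, -, hC⟩ := line_decay hg.rapidDecay ‖p‖
  exact integrable_of_decay (integrable_one_add_norm_pow_real A) (hg.continuous_line p k)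
    (hC p le_rfl k)

theorem hasFDerivAt_lineInt (hg : IsLocSchwartz g) (A : Set ℝ) (k : Fin n)
    (p : Symm n × (Fin n → ℝ)) :
    ∃ L : (Symm n × (Fin n → ℝ)) →L[ℝ] ℂ, HasFDerivAt (lineInt A k g) L p ∧
      ∀ w, L w = lineInt A k (fun p => _root_.fderiv ℝ g p w) p := by
  obtain ⟨C₀, -, hC₀⟩ := line_decay hg.rapidDecay (‖p‖ + 1)
  obtain ⟨C, -, hC⟩ := line_decay hg.rapidDecay_fderiv (‖p‖ + 1)
  have hcf : Continuous fun s : ℝ => _root_.fderiv ℝ g (p.1, p.2 + s • Pi.single k 1) :=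
    (hg.1.continuous_fderiv (by simp)).comp (by fun_prop)
  have hb : ∀ q ∈ Metric.ball p 1, ∀ s : ℝ,
      (1 + ‖s‖) ^ 2 * ‖_root_.fderiv ℝ g (q.1, q.2 + s • Pi.single k 1)‖ ≤ C := by
    intro q hq s
    refine hC q ?_ k s
    have h1 : ‖q‖ ≤ ‖p‖ + ‖q - p‖ := by
      have := norm_add_le p (q - p)
      rwa [add_sub_cancel] at this
    rw [mem_ball_iff_norm] at hq
    linarith
  have hd : ∀ q ∈ Metric.ball p 1, ∀ s : ℝ, HasFDerivAt
      (fun q : Symm n × (Fin n → ℝ) => g (q.1, q.2 + s • Pi.single k 1))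
      (_root_.fderiv ℝ g (q.1, q.2 + s • Pi.single k 1)) q := by
    intro q _ s
    have h1 : HasFDerivAt (fun q : Symm n × (Fin n → ℝ) => (q.1, q.2 + s • Pi.single k (1 : ℝ)))
        (ContinuousLinearMap.id ℝ _) q :=
      ((hasFDerivAt_id q).add_const (0, s • Pi.single k (1 : ℝ))).congr_of_eventuallyEq
        (Eventually.of_forall fun q => by simp [Prod.ext_iff])
    exact (hg.differentiable _).hasFDerivAt.comp q h1
  have hF := hasFDerivAt_integral_of_decay (μ := volume.restrict A)
    (φ := fun (q : Symm n × (Fin n → ℝ)) (s : ℝ) => g (q.1, q.2 + s • Pi.single k 1))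
    (φ' := fun q s => _root_.fderiv ℝ g (q.1, q.2 + s • Pi.single k 1))
    one_pos (integrable_one_add_norm_pow_real A) (fun q => hg.continuous_line q k) hcf hd
    (hC₀ p (by linarith) k) hb
  refine ⟨_, hF, fun w => ?_⟩
  rw [ContinuousLinearMap.integral_apply (integrable_of_decay (integrable_one_add_norm_pow_real A)
    hcf (hb p (Metric.mem_ball_self one_pos)))]
  rfl

theorem fderiv_lineInt (hg : IsLocSchwartz g) (A : Set ℝ) (k : Fin n)
    (p w : Symm n × (Fin n → ℝ)) :
    _root_.fderiv ℝ (lineInt A k g) p w = lineInt A k (fun p => _root_.fderiv ℝ g p w) p := by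
  obtain ⟨L, hL, h⟩ := hg.hasFDerivAt_lineInt A k p
  rw [hL.fderiv, h]

theorem lineInt_univ (hg : IsLocSchwartz g) (k : Fin n) (p : Symm n × (Fin n → ℝ)) :
    lineInt Set.univ k g p = lineInt (Set.Iic 0) k g p + lineInt (Set.Ioi 0) k g p := by
  rw [lineInt, ← Set.Iic_union_Ioi (a := (0 : ℝ)), setIntegral_union (by simp) measurableSet_Ioi
    (hg.integrable_line _ p k) (hg.integrable_line _ p k)]
  rfl

/-- For τ_k ≤ 0 the integral runs over points that recede from the origin, so it decays. For τ_k ≥ 0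
the vanishing of the full line integral replaces it by minus the integral over the opposite
half-line, which recedes as well. -/
theorem rapidDecay_lineInt (hg : IsLocSchwartz g) (k : Fin n)
    (h0 : ∀ p, lineInt Set.univ k g p = 0) : RapidDecay (lineInt (Set.Iic 0) k g) := by
  intro R M
  obtain ⟨C, hC0, hC⟩ := hg.rapidDecay R (M + 2)
  -- If s and τ_k have the same sign, then |τ_k + s| dominates both |τ_k| and |s|. Two powers of
  -- decay serve integrability in s and the other M serve decay in τ.
  have key : ∀ p : Symm n × (Fin n → ℝ), ‖p.1‖ ≤ R → ∀ s : ℝ, 0 ≤ s * p.2 k →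
      (1 + ‖s‖) ^ 2 * ‖((1 + ‖p.2‖) ^ M : ℝ) * g (p.1, p.2 + s • Pi.single k 1)‖ ≤ C := by
    intro p hp s hs
    have h1 : ∀ i, |p.2 i| ≤ |(p.2 + s • (Pi.single k 1 : Fin n → ℝ)) i| := by
      intro i
      by_cases hi : i = k
      · subst hi
        simp only [Pi.add_apply, Pi.smul_apply, Pi.single_eq_same, smul_eq_mul, mul_one]
        refine sq_le_sq.1 ?_
        nlinarith [sq_nonneg s]
      · simp [hi]
    have h2 : ‖p.2‖ ≤ ‖p.2 + s • (Pi.single k 1 : Fin n → ℝ)‖ :=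
      (pi_norm_le_iff_of_nonneg (norm_nonneg _)).2 fun i => (h1 i).trans
        (norm_le_pi_norm (p.2 + s • (Pi.single k 1 : Fin n → ℝ)) i)
    have h3 : ‖s‖ ≤ ‖p.2 + s • (Pi.single k 1 : Fin n → ℝ)‖ := by
      refine le_trans ?_ (norm_le_pi_norm (p.2 + s • (Pi.single k 1 : Fin n → ℝ)) k)
      simp only [Pi.add_apply, Pi.smul_apply, Pi.single_eq_same, smul_eq_mul, mul_one,
        Real.norm_eq_abs]
      refine sq_le_sq.1 ?_
      nlinarith [sq_nonneg (p.2 k)]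
    rw [norm_mul, Complex.norm_real,
      Real.norm_of_nonneg (by positivity : 0 ≤ (1 + ‖p.2‖) ^ M)]
    calc (1 + ‖s‖) ^ 2 * ((1 + ‖p.2‖) ^ M * ‖g (p.1, p.2 + s • Pi.single k 1)‖)
        ≤ (1 + ‖p.2 + s • (Pi.single k 1 : Fin n → ℝ)‖) ^ 2 *
          ((1 + ‖p.2 + s • (Pi.single k 1 : Fin n → ℝ)‖) ^ M *
            ‖g (p.1, p.2 + s • Pi.single k 1)‖) := by gcongr
      _ = (1 + ‖p.2 + s • (Pi.single k 1 : Fin n → ℝ)‖) ^ (M + 2) *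
            ‖g (p.1, p.2 + s • Pi.single k 1)‖ := by ring
      _ ≤ C := hC (p.1, p.2 + s • Pi.single k 1) hp
  have main : ∀ A : Set ℝ, MeasurableSet A → ∀ p : Symm n × (Fin n → ℝ), ‖p.1‖ ≤ R →
      (∀ s ∈ A, 0 ≤ s * p.2 k) →
      (1 + ‖p.2‖) ^ M * ‖lineInt A k g p‖ ≤ C * ∫ s : ℝ, ((1 + ‖s‖) ^ 2)⁻¹ := by
    intro A hA p hp hs
    have h1 : ‖∫ s in A, ((1 + ‖p.2‖) ^ M : ℝ) * g (p.1, p.2 + s • Pi.single k 1)‖ ≤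
        ∫ s in A, C * ((1 + ‖s‖) ^ 2)⁻¹ :=
      norm_integral_le_of_norm_le ((integrable_one_add_norm_pow_real A).const_mul C)
        ((ae_restrict_iff' hA).2 (Eventually.of_forall fun s hsA =>
          norm_le_of_decay (key p hp s (hs s hsA))))
    rw [integral_const_mul, norm_mul, Complex.norm_real,
      Real.norm_of_nonneg (by positivity : 0 ≤ (1 + ‖p.2‖) ^ M), integral_const_mul] at h1
    refine h1.trans (mul_le_mul_of_nonneg_left ?_ hC0)
    refine setIntegral_le_integral (integrableOn_univ.1 (integrable_one_add_norm_pow_real Set.univ))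
      (Eventually.of_forall ?_)
    intro s
    show (0 : ℝ) ≤ _
    positivity
  refine ⟨C * ∫ s : ℝ, ((1 + ‖s‖) ^ 2)⁻¹,
    mul_nonneg hC0 (integral_nonneg fun _ => by positivity), fun p hp => ?_⟩
  rcases le_total (p.2 k) 0 with hk | hk
  · exact main _ measurableSet_Iic p hp fun s hs => mul_nonneg_of_nonpos_of_nonpos hs hk
  · have h1 := hg.lineInt_univ k p
    rw [h0 p] at h1
    rw [eq_neg_of_add_eq_zero_left h1.symm, norm_neg]
    exact main _ measurableSet_Ioi p hp fun s hs => mul_nonneg (le_of_lt hs) hk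

/-- The vanishing of the full line integrals passes to all directional derivatives of `g`, so it can
be part of the stable class. -/
theorem lineInt_Iic (hg : IsLocSchwartz g) (k : Fin n) (h0 : ∀ p, lineInt Set.univ k g p = 0) :
    IsLocSchwartz (lineInt (Set.Iic 0) k g) := by
  refine of_closed (fun u => ∃ g, IsLocSchwartz g ∧ (∀ p, lineInt Set.univ k g p = 0) ∧
    u = lineInt (Set.Iic 0) k g) ?_ ⟨g, hg, h0, rfl⟩
  rintro _ ⟨g, hg, h0, rfl⟩
  refine ⟨fun p => ?_, hg.rapidDecay_lineInt k h0, fun w => ⟨_, hg.fderiv w, fun p => ?_,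
    funext fun p => hg.fderiv_lineInt _ k p w⟩⟩
  · obtain ⟨L, hL, -⟩ := hg.hasFDerivAt_lineInt (Set.Iic 0) k p
    exact hL.differentiableAt
  · rw [← hg.fderiv_lineInt, show lineInt Set.univ k g = fun _ => 0 from funext h0]
    simp

/-- Fundamental theorem of calculus on a half-line, the boundary term at -∞ vanishing by decay. -/
theorem fderiv_lineInt_Iic (hg : IsLocSchwartz g) (k : Fin n) (p : Symm n × (Fin n → ℝ)) :
    _root_.fderiv ℝ (lineInt (Set.Iic 0) k g) p (0, Pi.single k 1) = g p := by
  rw [hg.fderiv_lineInt, lineInt]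
  have hd : ∀ s : ℝ, HasDerivAt (fun s : ℝ => g (p.1, p.2 + s • Pi.single k 1))
      (_root_.fderiv ℝ g (p.1, p.2 + s • Pi.single k 1) (0, Pi.single k 1)) s := by
    intro s
    have h1 : HasDerivAt (fun s : ℝ => (p.1, p.2 + s • (Pi.single k 1 : Fin n → ℝ)))
        (0, Pi.single k 1) s := by
      refine (hasDerivAt_const s p.1).prodMk ?_
      simpa using ((hasDerivAt_id s).smul_const (Pi.single k (1 : ℝ))).const_add p.2
    exact (hg.differentiable _).hasFDerivAt.comp_hasDerivAt s h1
  obtain ⟨C, hC0, hC⟩ := line_decay hg.rapidDecay ‖p‖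
  have ht : Tendsto (fun s : ℝ => g (p.1, p.2 + s • Pi.single k 1)) atBot (𝓝 0) := by
    refine squeeze_zero_norm (a := fun s => C * ((1 + ‖s‖) ^ 2)⁻¹)
      (fun s => norm_le_of_decay (hC p le_rfl k s)) ?_
    have h2 : Tendsto (fun s : ℝ => (1 + ‖s‖) ^ 2) atBot atTop :=
      (tendsto_pow_atTop two_ne_zero).comp
        (tendsto_atTop_add_const_left _ _ tendsto_abs_atBot_atTop)
    simpa using h2.inv_tendsto_atTop.const_mul C
  rw [integral_Iic_of_hasDerivAt_of_tendsto (hg.continuous_line p k).continuousWithinAt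
    (fun s _ => hd s) ((hg.fderiv _).integrable_line _ p k) ht]
  simp

end IsLocSchwartz

namespace IsLocSchwartz

/-- The line integrals vanish if the Fourier transform vanishes on the hyperplane `ξ_k = 0`. -/
theorem lineInt_univ_eq_zero {g : Symm n × (Fin n → ℝ) → ℂ} (hg : IsLocSchwartz g) (k : Fin n)
    (h0 : ∀ T ξ, ξ k = 0 → fourierTau g (T, ξ) = 0) (p : Symm n × (Fin n → ℝ)) :
    lineInt Set.univ k g p = 0 := by
  obtain _ | m := n
  · exact k.elim0
  obtain ⟨T, τ⟩ := p
  have hline : ∀ τ, lineInt Set.univ k g (T, τ) =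
      ∫ x : ℝ, g (T, k.insertNth x (k.removeNth τ)) := by
    intro τ
    rw [lineInt, setIntegral_univ,
      ← integral_add_left_eq_self (fun x => g (T, k.insertNth x (k.removeNth τ))) (τ k)]
    congr 1
    funext s
    have h : τ + s • Pi.single k 1 = k.insertNth (α := fun _ => ℝ) (τ k + s) (k.removeNth τ) := by
      refine Fin.eq_insertNth_iff.2 ⟨?_, ?_⟩
      · simp
      · funext i
        simp [Fin.removeNth]
    rw [h]
  -- The line integrals form a function of the remaining m coordinates. By Fubini its Fourier
  -- transform is that of `g` restricted to ξ_k = 0, so injectivity of the transform finishes the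
  -- proof.
  let q : (Fin m → ℝ) → ℂ := fun σ => ∫ x : ℝ, g (T, k.insertNth x σ)
  have hq : ∀ σ, q σ = lineInt Set.univ k g (T, k.insertNth 0 σ) := fun σ => by
    rw [hline, Fin.removeNth_insertNth]
  have hmp := (volume_preserving_piFinSuccAbove (fun _ : Fin (m + 1) => ℝ) k).symm
  have hme := (MeasurableEquiv.piFinSuccAbove (fun _ : Fin (m + 1) => ℝ) k).symm.measurableEmbedding
  have hsymm : ∀ z : ℝ × (Fin m → ℝ),
      (MeasurableEquiv.piFinSuccAbove (fun _ : Fin (m + 1) => ℝ) k).symm z =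
        k.insertNth z.1 z.2 := fun z => rfl
  have hqc : Continuous q := by
    rw [show q = _ from funext hq]
    have hc : Continuous (lineInt Set.univ k g) := continuous_iff_continuousAt.2 fun p => by
      obtain ⟨L, hL, -⟩ := hg.hasFDerivAt_lineInt Set.univ k p
      exact hL.continuousAt
    refine hc.comp (Continuous.prodMk continuous_const ?_)
    exact continuous_const.finInsertNth k continuous_id
  have hqi : Integrable q := by
    have h1 : Integrable (fun z : ℝ × (Fin m → ℝ) => g (T, k.insertNth z.1 z.2)) :=
      hmp.integrable_comp_of_integrable (hg.integrable_slice T)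
    exact h1.integral_prod_right
  have hq0 : q = 0 := by
    refine eq_zero_of_fourier_eq_zero hqc hqi fun ξ => ?_
    have h1 := h0 T (k.insertNth 0 ξ) (by simp)
    have h2 := hmp.integrable_comp_of_integrable (hg.integrable_phase_mul T (k.insertNth 0 ξ))
    rw [fourierTau, ← hmp.integral_comp hme] at h1
    have h3 := integral_prod_symm _ h2
    rw [← Measure.volume_eq_prod] at h3
    rw [← h1]
    refine Eq.trans ?_ h3.symm
    congr 1
    funext σ
    simp only [Function.comp_apply, hsymm]
    rw [← integral_const_mul]
    congr 1
    funext x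
    congr 1
    simp [expPhase, dotProduct, Fin.sum_univ_succAbove _ k]
  rw [hline]
  exact congrFun hq0 (k.removeNth τ)

end IsLocSchwartz

/-! ### Symmetric matrices -/

/-- The identity matrix. -/
def Symm.one (n : ℕ) : Symm n := (Symm.equivSymmetric n).symm ⟨1, Matrix.isSymm_one⟩

@[simp]
theorem Symm.toMatrix_one : (Symm.one n).toMatrix = 1 :=
  congrArg Subtype.val ((Symm.equivSymmetric n).apply_symm_apply ⟨1, Matrix.isSymm_one⟩)

/-- A symmetric matrix that maps a given vector `ξ ≠ 0` to `η`. -/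
noncomputable def symmOfMulVec (p : (Fin n → ℝ) × (Fin n → ℝ)) : Symm n :=
  Sym2.lift ⟨fun k l => (p.2 k * p.1 l + p.1 k * p.2 l) / (p.1 ⬝ᵥ p.1) -
    (p.1 ⬝ᵥ p.2) * (p.1 k * p.1 l) / (p.1 ⬝ᵥ p.1) ^ 2, fun k l => by ring_nf⟩

theorem symmOfMulVec_mk (p : (Fin n → ℝ) × (Fin n → ℝ)) (k l : Fin n) :
    symmOfMulVec p s(k, l) = (p.2 k * p.1 l + p.1 k * p.2 l) / (p.1 ⬝ᵥ p.1) -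
      (p.1 ⬝ᵥ p.2) * (p.1 k * p.1 l) / (p.1 ⬝ᵥ p.1) ^ 2 := rfl

theorem symmOfMulVec_mulVec {p : (Fin n → ℝ) × (Fin n → ℝ)} (hp : p.1 ≠ 0) :
    (symmOfMulVec p).toMatrix *ᵥ p.1 = p.2 := by
  have h0 : p.1 ⬝ᵥ p.1 ≠ 0 := fun h => hp (dotProduct_self_eq_zero.1 h)
  funext k
  have h1 : ((symmOfMulVec p).toMatrix *ᵥ p.1) k =
      ∑ l : Fin n, (p.2 k / (p.1 ⬝ᵥ p.1) * (p.1 l * p.1 l) + p.1 k / (p.1 ⬝ᵥ p.1) * (p.1 l * p.2 l) -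
        (p.1 ⬝ᵥ p.2) * p.1 k / (p.1 ⬝ᵥ p.1) ^ 2 * (p.1 l * p.1 l)) := by
    rw [Matrix.mulVec, dotProduct]
    refine Finset.sum_congr rfl fun l _ => ?_
    simp only [Symm.toMatrix, Matrix.of_apply, symmOfMulVec_mk]
    ring
  rw [h1, Finset.sum_sub_distrib, Finset.sum_add_distrib, ← Finset.mul_sum, ← Finset.mul_sum,
    ← Finset.mul_sum]
  change p.2 k / (p.1 ⬝ᵥ p.1) * (p.1 ⬝ᵥ p.1) + p.1 k / (p.1 ⬝ᵥ p.1) * (p.1 ⬝ᵥ p.2) -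
    (p.1 ⬝ᵥ p.2) * p.1 k / (p.1 ⬝ᵥ p.1) ^ 2 * (p.1 ⬝ᵥ p.1) = p.2 k
  field_simp
  ring

theorem sq_norm_le_dotProduct (ξ : Fin n → ℝ) : ‖ξ‖ ^ 2 ≤ ξ ⬝ᵥ ξ := by
  have h0 : 0 ≤ ξ ⬝ᵥ ξ := Finset.sum_nonneg fun i _ => mul_self_nonneg _
  refine (Real.le_sqrt (norm_nonneg _) h0).1
    ((pi_norm_le_iff_of_nonneg (Real.sqrt_nonneg _)).2 fun i => Real.le_sqrt_of_sq_le ?_)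
  rw [Real.norm_eq_abs, sq_abs, sq]
  exact Finset.single_le_sum (f := fun i => ξ i * ξ i) (fun i _ => mul_self_nonneg _)
    (Finset.mem_univ i)

/-- The first term of the matrix contributes at most 2, and the second at most n because |ξ·η| ≤
n|ξ||η| for sup norms. The bound does not depend on the size of ξ, so the whole half |η| ≤ |ξ| of
phase space is reached by matrices from a fixed compact set. -/
theorem norm_symmOfMulVec_le {p : (Fin n → ℝ) × (Fin n → ℝ)} (hp : p.1 ≠ 0)
    (h : ‖p.2‖ ≤ ‖p.1‖) : ‖symmOfMulVec p‖ ≤ n + 2 := by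
  have hpos : 0 < ‖p.1‖ := norm_pos_iff.2 hp
  have hD := sq_norm_le_dotProduct p.1
  have hD0 : 0 < p.1 ⬝ᵥ p.1 := lt_of_lt_of_le (by positivity) hD
  refine (pi_norm_le_iff_of_nonneg (by positivity)).2 fun z => ?_
  induction z with | _ k l => ?_
  rw [symmOfMulVec_mk, Real.norm_eq_abs]
  have hk := norm_le_pi_norm p.1 k
  have hl := norm_le_pi_norm p.1 l
  have hk' := (norm_le_pi_norm p.2 k).trans h
  have hl' := (norm_le_pi_norm p.2 l).trans h
  rw [Real.norm_eq_abs] at hk hl hk' hl'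
  have e1 : |(p.2 k * p.1 l + p.1 k * p.2 l) / (p.1 ⬝ᵥ p.1)| ≤ 2 := by
    rw [abs_div, abs_of_pos hD0, div_le_iff₀ hD0]
    refine (abs_add_le _ _).trans ?_
    rw [abs_mul, abs_mul]
    have := mul_le_mul hk' hl (abs_nonneg _) hpos.le
    have := mul_le_mul hk hl' (abs_nonneg _) hpos.le
    nlinarith
  have e2 : |(p.1 ⬝ᵥ p.2) * (p.1 k * p.1 l) / (p.1 ⬝ᵥ p.1) ^ 2| ≤ n := by
    rw [abs_div, abs_of_pos (by positivity : 0 < (p.1 ⬝ᵥ p.1) ^ 2), div_le_iff₀ (by positivity),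
      abs_mul, abs_mul]
    calc |p.1 ⬝ᵥ p.2| * (|p.1 k| * |p.1 l|) ≤ (n * ‖p.1‖ * ‖p.1‖) * (‖p.1‖ * ‖p.1‖) := by
          gcongr
          exact (abs_dotProduct_le _ _).trans (by gcongr)
      _ = n * (‖p.1‖ ^ 2) ^ 2 := by ring
      _ ≤ n * (p.1 ⬝ᵥ p.1) ^ 2 := by gcongr
  rw [abs_le] at e1 e2 ⊢
  constructor <;> linarith [e1.1, e1.2, e2.1, e2.2]

theorem contDiffAt_symmOfMulVec {p : (Fin n → ℝ) × (Fin n → ℝ)} (hp : p.1 ≠ 0) :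
    ContDiffAt ℝ ∞ symmOfMulVec p := by
  have h0 : p.1 ⬝ᵥ p.1 ≠ 0 := fun h => hp (dotProduct_self_eq_zero.1 h)
  refine contDiffAt_pi.2 fun z => ?_
  induction z with | _ k l => ?_
  simp only [symmOfMulVec_mk]
  have h1 : ∀ i, ContDiffAt ℝ ∞ (fun p : (Fin n → ℝ) × (Fin n → ℝ) => p.1 i) p := fun i => by fun_prop
  have h2 : ∀ i, ContDiffAt ℝ ∞ (fun p : (Fin n → ℝ) × (Fin n → ℝ) => p.2 i) p := fun i => by fun_prop
  have hd : ContDiffAt ℝ ∞ (fun p : (Fin n → ℝ) × (Fin n → ℝ) => p.1 ⬝ᵥ p.1) p :=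
    ContDiffAt.sum fun i _ => (h1 i).mul (h1 i)
  have hd' : ContDiffAt ℝ ∞ (fun p : (Fin n → ℝ) × (Fin n → ℝ) => p.1 ⬝ᵥ p.2) p :=
    ContDiffAt.sum fun i _ => (h1 i).mul (h2 i)
  exact ((((h2 k).mul (h1 l)).add ((h1 k).mul (h2 l))).div hd h0).sub
    ((hd'.mul ((h1 k).mul (h1 l))).div (hd.pow 2) (pow_ne_zero 2 h0))

/-! ### Functions whose restrictions to Lagrangian subspaces are Fourier transforms in `τ` -/

/-- Away from the origin the restrictions of `G` to the subspaces `{(ξ, -Tξ)}` and `{(-Tξ, ξ)}` are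
the Fourier transforms in `τ` of `h₁` and `h₂`. -/
structure HasSlices (G : (Fin n → ℝ) × (Fin n → ℝ) → ℂ) (h₁ h₂ : Symm n × (Fin n → ℝ) → ℂ) :
    Prop where
  left : IsLocSchwartz h₁
  right : IsLocSchwartz h₂
  eq_left : ∀ (T : Symm n) (ξ : Fin n → ℝ), ξ ≠ 0 →
    fourierTau h₁ (T, ξ) = G (ξ, -(T.toMatrix *ᵥ ξ))
  eq_right : ∀ (T : Symm n) (ξ : Fin n → ℝ), ξ ≠ 0 →
    fourierTau h₂ (T, ξ) = G (-(T.toMatrix *ᵥ ξ), ξ)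

/-- All the restrictions of `G` to the subspaces `{(ξ, -Tξ)}` and `{(-Tξ, ξ)}` are Fourier
transforms in `τ`. -/
def IsSliced (G : (Fin n → ℝ) × (Fin n → ℝ) → ℂ) : Prop :=
  ∃ h₁ h₂, HasSlices G h₁ h₂ ∧ ∀ T : Symm n, fourierTau h₁ (T, 0) = G 0 ∧ fourierTau h₂ (T, 0) = G 0

namespace HasSlices

variable {G : (Fin n → ℝ) × (Fin n → ℝ) → ℂ} {h₁ h₂ : Symm n × (Fin n → ℝ) → ℂ}

theorem swap (h : HasSlices G h₁ h₂) : HasSlices (fun p => G p.swap) h₂ h₁ :=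
  ⟨h.right, h.left, h.eq_right, h.eq_left⟩

theorem congr (h : HasSlices G h₁ h₂) {G' : (Fin n → ℝ) × (Fin n → ℝ) → ℂ}
    (hG : ∀ p, p ≠ 0 → G' p = G p) : HasSlices G' h₁ h₂ :=
  ⟨h.left, h.right, fun T ξ hξ => by
    rw [h.eq_left T ξ hξ, hG _ (fun h => hξ (congrArg Prod.fst h))], fun T ξ hξ => by
    rw [h.eq_right T ξ hξ, hG _ (fun h => hξ (congrArg Prod.snd h))]⟩

theorem const_mul (h : HasSlices G h₁ h₂) (c : ℂ) :
    HasSlices (fun p => c * G p) (fun p => c * h₁ p) fun p => c * h₂ p :=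
  ⟨h.left.const_mul c, h.right.const_mul c, fun T ξ hξ => by
    rw [fourierTau_const_mul, h.eq_left T ξ hξ], fun T ξ hξ => by
    rw [fourierTau_const_mul, h.eq_right T ξ hξ]⟩

theorem sum {ι : Type*} (s : Finset ι) {G : ι → (Fin n → ℝ) × (Fin n → ℝ) → ℂ}
    {h₁ h₂ : ι → Symm n × (Fin n → ℝ) → ℂ} (h : ∀ i ∈ s, HasSlices (G i) (h₁ i) (h₂ i)) :
    HasSlices (fun p => ∑ i ∈ s, G i p) (fun p => ∑ i ∈ s, h₁ i p) fun p => ∑ i ∈ s, h₂ i p :=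
  ⟨IsLocSchwartz.sum s fun i hi => (h i hi).left, IsLocSchwartz.sum s fun i hi => (h i hi).right,
    fun T ξ hξ => by
      rw [IsLocSchwartz.fourierTau_sum s fun i hi => (h i hi).left]
      exact Finset.sum_congr rfl fun i hi => (h i hi).eq_left T ξ hξ,
    fun T ξ hξ => by
      rw [IsLocSchwartz.fourierTau_sum s fun i hi => (h i hi).right]
      exact Finset.sum_congr rfl fun i hi => (h i hi).eq_right T ξ hξ⟩

theorem add {G' : (Fin n → ℝ) × (Fin n → ℝ) → ℂ} {h₁' h₂' : Symm n × (Fin n → ℝ) → ℂ}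
    (h : HasSlices G h₁ h₂) (h' : HasSlices G' h₁' h₂') :
    HasSlices (fun p => G p + G' p) (fun p => h₁ p + h₁' p) fun p => h₂ p + h₂' p :=
  ⟨h.left.add h'.left, h.right.add h'.right, fun T ξ hξ => by
    rw [h.left.fourierTau_add h'.left, h.eq_left T ξ hξ, h'.eq_left T ξ hξ], fun T ξ hξ => by
    rw [h.right.fourierTau_add h'.right, h.eq_right T ξ hξ, h'.eq_right T ξ hξ]⟩

/-- Expresses G where ξ ≠ 0 through a choice of T that is smooth in the point. Smoothness, decay and
limits of G are all read off from this formula. -/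
theorem apply_eq (h : HasSlices G h₁ h₂) {p : (Fin n → ℝ) × (Fin n → ℝ)} (hp : p.1 ≠ 0) :
    G p = fourierTau h₁ (-symmOfMulVec p, p.1) := by
  rw [h.eq_left _ _ hp, Symm.toMatrix_neg, Matrix.neg_mulVec, symmOfMulVec_mulVec hp, neg_neg]

/-- The two halves of phase space are interchanged by the swap. -/
theorem forall_of_swap {P : ((Fin n → ℝ) × (Fin n → ℝ) → ℂ) → (Fin n → ℝ) × (Fin n → ℝ) → Prop}
    (hP : ∀ G p, P (fun q => G q.swap) p.swap → P G p)
    (H : ∀ G h₁ h₂, HasSlices G h₁ h₂ → ∀ p : (Fin n → ℝ) × (Fin n → ℝ), p ≠ 0 →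
      ‖p.2‖ ≤ ‖p.1‖ → P G p) (h : HasSlices G h₁ h₂) {p : (Fin n → ℝ) × (Fin n → ℝ)} (hp : p ≠ 0) :
    P G p := by
  rcases le_total ‖p.2‖ ‖p.1‖ with h1 | h1
  · exact H G h₁ h₂ h p hp h1
  · exact hP _ _ (H _ _ _ h.swap p.swap (fun h0 => hp (Prod.swap_injective h0)) h1)

theorem fst_ne_zero {p : (Fin n → ℝ) × (Fin n → ℝ)} (hp : p ≠ 0) (h : ‖p.2‖ ≤ ‖p.1‖) : p.1 ≠ 0 := by
  intro h0
  rw [h0, norm_zero, norm_le_zero_iff] at h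
  exact hp (Prod.ext h0 h)

theorem contDiffAt_of_fst (h : HasSlices G h₁ h₂) {p : (Fin n → ℝ) × (Fin n → ℝ)} (hp : p.1 ≠ 0) :
    ContDiffAt ℝ ∞ G p := by
  have h1 : ContDiffAt ℝ ∞ (fun p : (Fin n → ℝ) × (Fin n → ℝ) =>
      fourierTau h₁ (-symmOfMulVec p, p.1)) p :=
    h.left.contDiff_fourierTau.contDiffAt.comp p
      ((contDiffAt_symmOfMulVec hp).neg.prodMk contDiffAt_fst)
  refine h1.congr_of_eventuallyEq ?_
  filter_upwards [(isOpen_ne.preimage continuous_fst).mem_nhds hp] with q hq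
  exact h.apply_eq hq

theorem contDiffAt (h : HasSlices G h₁ h₂) {p : (Fin n → ℝ) × (Fin n → ℝ)} (hp : p ≠ 0) :
    ContDiffAt ℝ ∞ G p := by
  refine forall_of_swap (P := fun G p => ContDiffAt ℝ ∞ G p) (fun G p hG => ?_)
    (fun G h₁ h₂ h p hp hle => h.contDiffAt_of_fst (fst_ne_zero hp hle)) h hp
  exact hG.comp p (ContinuousLinearEquiv.prodComm ℝ (Fin n → ℝ) (Fin n → ℝ)).contDiff.contDiffAt

theorem decay_half (h : HasSlices G h₁ h₂) (M : ℕ) : ∃ C : ℝ, ∀ p : (Fin n → ℝ) × (Fin n → ℝ),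
    p ≠ 0 → ‖p.2‖ ≤ ‖p.1‖ → ‖p‖ ^ M * ‖G p‖ ≤ C := by
  obtain ⟨C, hC0, hC⟩ := h.left.decay_fourierTau (n + 2) M
  refine ⟨C, fun p hp hle => ?_⟩
  have h1 := fst_ne_zero hp hle
  rw [h.apply_eq h1, Prod.norm_def, max_eq_left hle]
  exact hC (-symmOfMulVec p, p.1) (by rw [norm_neg]; exact norm_symmOfMulVec_le h1 hle)

theorem decay (h : HasSlices G h₁ h₂) (M : ℕ) : ∃ C : ℝ, ∀ p : (Fin n → ℝ) × (Fin n → ℝ),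
    p ≠ 0 → ‖p‖ ^ M * ‖G p‖ ≤ C := by
  obtain ⟨C, hC⟩ := h.decay_half M
  obtain ⟨D, hD⟩ := h.swap.decay_half M
  refine ⟨max C D, fun p hp => ?_⟩
  rcases le_total ‖p.2‖ ‖p.1‖ with h1 | h1
  · exact le_max_of_le_left (hC p hp h1)
  · have := hD p.swap (fun h0 => hp (Prod.swap_injective h0)) h1
    simp only [Prod.swap_swap] at this
    rw [Prod.norm_def, Prod.fst_swap, Prod.snd_swap, max_comm, ← Prod.norm_def] at this
    exact le_max_of_le_right this

/-- The matrix joining ξ to η has no limit as the point tends to the origin, but it stays in a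
compact set. There the transform is uniformly continuous, and at ξ = 0 it takes the same value for
all T. -/
theorem tendsto_half (h : HasSlices G h₁ h₂) {c : ℂ} (hc : ∀ T, fourierTau h₁ (T, 0) = c) {ε : ℝ}
    (hε : 0 < ε) : ∃ δ > 0, ∀ p : (Fin n → ℝ) × (Fin n → ℝ), p ≠ 0 → ‖p.2‖ ≤ ‖p.1‖ → ‖p‖ < δ →
      dist (G p) c < ε := by
  have hu := (isCompact_closedBall (0 : Symm n × (Fin n → ℝ)) (n + 2)).uniformContinuousOn_of_continuous
    h.left.continuous_fourierTau.continuousOn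
  obtain ⟨δ, hδ, H⟩ := Metric.uniformContinuousOn_iff.1 hu ε hε
  refine ⟨min δ 1, by positivity, fun p hp hle hlt => ?_⟩
  have h1 := fst_ne_zero hp hle
  have h2 : ‖p.1‖ < min δ 1 := (norm_fst_le p).trans_lt hlt
  have h3 := norm_symmOfMulVec_le h1 hle
  have hn : (0 : ℝ) ≤ n := by positivity
  rw [h.apply_eq h1, ← hc (-symmOfMulVec p)]
  refine H _ ?_ _ ?_ ?_
  · rw [mem_closedBall_zero_iff, Prod.norm_def, norm_neg]
    exact max_le h3 (by linarith [min_le_right δ 1])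
  · rw [mem_closedBall_zero_iff, Prod.norm_def, norm_neg, norm_zero]
    exact max_le h3 (by linarith)
  · rw [Prod.dist_eq, dist_self, dist_zero_right, max_eq_right (norm_nonneg _)]
    exact h2.trans_le (min_le_left _ _)

theorem tendsto (h : HasSlices G h₁ h₂) {c : ℂ} (hc₁ : ∀ T, fourierTau h₁ (T, 0) = c)
    (hc₂ : ∀ T, fourierTau h₂ (T, 0) = c) : Tendsto G (𝓝[≠] 0) (𝓝 c) := by
  refine Metric.tendsto_nhdsWithin_nhds.2 fun ε hε => ?_
  obtain ⟨δ, hδ, H⟩ := h.tendsto_half hc₁ hε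
  obtain ⟨δ', hδ', H'⟩ := h.swap.tendsto_half hc₂ hε
  refine ⟨min δ δ', lt_min hδ hδ', fun p hp hd => ?_⟩
  rw [dist_zero_right, lt_min_iff] at hd
  rcases le_total ‖p.2‖ ‖p.1‖ with h1 | h1
  · exact H p hp h1 hd.1
  · have := H' p.swap (fun h0 => hp (Prod.swap_injective h0)) h1
    simp only [Prod.swap_swap] at this
    rw [Prod.norm_def, Prod.fst_swap, Prod.snd_swap, max_comm, ← Prod.norm_def] at this
    exact this hd.2

/-- If `T` and `T'` agree on a nonzero vector, then the Fourier transforms agree at `ξ = 0`. -/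
theorem eq_of_mulVec_eq (h : HasSlices G h₁ h₂) {T T' : Symm n} {ξ : Fin n → ℝ} (hξ : ξ ≠ 0)
    (hT : T.toMatrix *ᵥ ξ = T'.toMatrix *ᵥ ξ) : fourierTau h₁ (T, 0) = fourierTau h₁ (T', 0) := by
  have hc : ∀ T : Symm n, Continuous fun s : ℝ => fourierTau h₁ (T, s • ξ) := fun T =>
    h.left.continuous_fourierTau.comp (by fun_prop)
  have h1 := Continuous.ext_on (dense_compl_singleton (0 : ℝ)) (hc T) (hc T') fun s hs => by
    have hs' : s • ξ ≠ 0 := smul_ne_zero hs hξ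
    rw [h.eq_left _ _ hs', h.eq_left _ _ hs', Matrix.mulVec_smul, Matrix.mulVec_smul, hT]
  simpa using congrFun h1 0

/-- For T = -1 both families of subspaces contain the diagonal {(ξ, ξ)}. The transforms agree on it
off the origin, hence at the origin by continuity. -/
theorem left_eq_right (h : HasSlices G h₁ h₂) (hn : 1 < n) :
    fourierTau h₁ (-Symm.one n, 0) = fourierTau h₂ (-Symm.one n, 0) := by
  have hc : ∀ h, IsLocSchwartz h → Continuous fun ξ : Fin n → ℝ => fourierTau h (-Symm.one n, ξ) :=
    fun h hh => hh.continuous_fourierTau.comp (by fun_prop)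
  have : Nonempty (Fin n) := ⟨⟨0, by omega⟩⟩
  have h1 := Continuous.ext_on (dense_compl_singleton (0 : Fin n → ℝ)) (hc h₁ h.left)
    (hc h₂ h.right) fun ξ hξ => by
      rw [h.eq_left _ _ hξ, h.eq_right _ _ hξ]
      simp [Symm.toMatrix_neg, Matrix.neg_mulVec]
  exact congrFun h1 0

/-- A chain T, U, V, T' in which neighbours agree on a nonzero vector: e_i - e_j, then e_i, then
e_j. Two distinct indices are needed, and this is where n > 1 is essential. -/
theorem left_const (h : HasSlices G h₁ h₂) (hn : 1 < n) (T T' : Symm n) :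
    fourierTau h₁ (T, 0) = fourierTau h₁ (T', 0) := by
  let i : Fin n := ⟨0, by omega⟩
  let j : Fin n := ⟨1, hn⟩
  have hij : i ≠ j := by simp [i, j]
  have hcol : ∀ (S : Symm n) (k l : Fin n), (S.toMatrix *ᵥ Pi.single k 1) l = S s(l, k) := by
    intro S k l
    rw [Matrix.mulVec_single_one]
    rfl
  have hne : ∀ k : Fin n, (Pi.single k 1 : Fin n → ℝ) ≠ 0 := fun k => by simp
  let c := T' s(i, j) - T s(i, j)
  -- A rank-one change along (e_i + e_j)(e_i + e_j)ᵗ kills e_i - e_j, and `c` adjusts the entry (i,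
  -- j) to that of T'.
  let U : Symm n := Sym2.lift ⟨fun k l => T s(k, l) +
    c * ((Pi.single i 1 + Pi.single j 1 : Fin n → ℝ) k * (Pi.single i 1 + Pi.single j 1 : Fin n → ℝ) l),
    fun k l => by simp only [Sym2.eq_swap (a := k), mul_comm]⟩
  have hU : ∀ k l, U s(k, l) = T s(k, l) +
    c * ((Pi.single i 1 + Pi.single j 1 : Fin n → ℝ) k *
      (Pi.single i 1 + Pi.single j 1 : Fin n → ℝ) l) := fun k l => rfl
  classical
  -- Row and column i are taken from U, the rest from T'. Column j then agrees with that of T',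
  -- including its i-th entry by the choice of U.
  let V : Symm n := fun z => if i ∈ z then U z else T' z
  have hUij : U s(i, j) = T' s(i, j) := by
    rw [hU]
    simp [hij, hij.symm, c]
  have e1 : fourierTau h₁ (T, 0) = fourierTau h₁ (U, 0) := by
    refine h.eq_of_mulVec_eq (ξ := Pi.single i 1 - Pi.single j 1) ?_ ?_
    · intro h0
      have := congrFun h0 i
      simp [hij] at this
    · funext l
      rw [Matrix.mulVec_sub, Matrix.mulVec_sub, Pi.sub_apply, Pi.sub_apply, hcol, hcol, hcol, hcol,
        hU, hU]
      simp [hij, hij.symm]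
  have e2 : fourierTau h₁ (U, 0) = fourierTau h₁ (V, 0) := by
    refine h.eq_of_mulVec_eq (hne i) ?_
    funext l
    rw [hcol, hcol]
    simp [V]
  have e3 : fourierTau h₁ (V, 0) = fourierTau h₁ (T', 0) := by
    refine h.eq_of_mulVec_eq (hne j) ?_
    funext l
    rw [hcol, hcol]
    by_cases hl : i = l
    · subst hl
      simp [V, hUij]
    · simp [V, hl, hij]
  rw [e1, e2, e3]

/-- The value at the origin can be chosen so that all the restrictions are Fourier transforms. -/
theorem exists_value (h : HasSlices G h₁ h₂) (hn : 1 < n) :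
    ∃ c, ∀ T : Symm n, fourierTau h₁ (T, 0) = c ∧ fourierTau h₂ (T, 0) = c :=
  ⟨fourierTau h₁ (-Symm.one n, 0), fun T => ⟨h.left_const hn T _, by
    rw [h.left_eq_right hn]
    exact h.swap.left_const hn T _⟩⟩

end HasSlices

/-! ### Slices of the first derivatives -/

theorem fderiv_comp_swap (G : (Fin n → ℝ) × (Fin n → ℝ) → ℂ) (p w : (Fin n → ℝ) × (Fin n → ℝ)) :
    fderiv ℝ (fun p => G p.swap) p w = fderiv ℝ G p.swap w.swap := by
  have h := (ContinuousLinearEquiv.prodComm ℝ (Fin n → ℝ) (Fin n → ℝ)).comp_right_fderiv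
    (f := G) (x := p)
  exact congrArg (fun l => l w) h

namespace HasSlices

variable {G : (Fin n → ℝ) × (Fin n → ℝ) → ℂ} {h₁ h₂ : Symm n × (Fin n → ℝ) → ℂ}

theorem eq_left_all (h : HasSlices G h₁ h₂) (h0 : ∀ T, fourierTau h₁ (T, 0) = G 0) (T : Symm n)
    (ξ : Fin n → ℝ) : fourierTau h₁ (T, ξ) = G (ξ, -(T.toMatrix *ᵥ ξ)) := by
  by_cases hξ : ξ = 0
  · subst hξ
    rw [h0, Matrix.mulVec_zero, neg_zero]
    rfl
  · exact h.eq_left T ξ hξ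

theorem differentiableAt (h : HasSlices G h₁ h₂) {p : (Fin n → ℝ) × (Fin n → ℝ)} (hp : p ≠ 0) :
    DifferentiableAt ℝ G p := (h.contDiffAt hp).differentiableAt (by simp)

theorem continuousAt_fderiv (h : HasSlices G h₁ h₂) {p : (Fin n → ℝ) × (Fin n → ℝ)} (hp : p ≠ 0)
    (w : (Fin n → ℝ) × (Fin n → ℝ)) : ContinuousAt (fun p => fderiv ℝ G p w) p :=
  (((h.contDiffAt hp).fderiv_right (m := 0) (by simp)).clm_apply contDiffAt_const).continuousAt

/-- The derivatives `∂G/∂η_k` are Fourier transforms in `τ` on the subspaces `{(ξ, -Tξ)}`. -/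
theorem exists_fderiv_left (h : HasSlices G h₁ h₂) (h0 : ∀ T, fourierTau h₁ (T, 0) = G 0)
    (k : Fin n) : ∃ u, IsLocSchwartz u ∧ ∀ (T : Symm n) (ξ : Fin n → ℝ), ξ ≠ 0 →
      fourierTau u (T, ξ) = fderiv ℝ G (ξ, -(T.toMatrix *ᵥ ξ)) (0, Pi.single k 1) := by
  -- The matrix 2E_kk moves -Tξ along e_k alone, with speed -2ξ_k. So the T-derivative of the
  -- transform in this direction is -2ξ_k ∂G/∂η_k.
  let S : Symm n := (entryDir (Sum.inl k) (Sum.inl k)).1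
  have hS : ∀ ξ, S.toMatrix *ᵥ ξ = (2 * ξ k) • Pi.single k 1 := fun ξ => by
    rw [entryDir_mulVec, ← add_smul, two_mul]
  have hmul : ∀ (T : Symm n) (t : ℝ) ξ, -((T + t • S).toMatrix *ᵥ ξ) =
      -(T.toMatrix *ᵥ ξ) + t • (-(2 * ξ k)) • Pi.single k 1 := by
    intro T t ξ
    rw [Symm.toMatrix_add, Symm.toMatrix_smul, Matrix.add_mulVec, Matrix.smul_mulVec, hS]
    module
  have hcurve : ∀ T ξ, HasDerivAt (fun t : ℝ => G (ξ, -(T.toMatrix *ᵥ ξ) +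
      t • (-(2 * ξ k)) • Pi.single k 1)) (fderiv ℝ (fourierTau h₁) (T, ξ) (S, 0)) 0 := by
    intro T ξ
    have h1 : HasDerivAt (fun t : ℝ => (T + t • S, ξ)) (S, 0) 0 := by
      refine HasDerivAt.prodMk ?_ (hasDerivAt_const _ _)
      simpa using ((hasDerivAt_id (0 : ℝ)).smul_const S).const_add T
    have h2 := (h.left.differentiable_fourierTau (T, ξ)).hasFDerivAt.comp_hasDerivAt_of_eq 0 h1
      (by simp)
    refine h2.congr_of_eventuallyEq (Eventually.of_forall fun t => ?_)
    simp only [Function.comp_apply]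
    rw [h.eq_left_all h0, hmul]
  let g : Symm n × (Fin n → ℝ) → ℂ := fun p => fderiv ℝ h₁ p (S, 0)
  have hg : IsLocSchwartz g := h.left.fderiv _
  have hgF : ∀ p, fourierTau g p = fderiv ℝ (fourierTau h₁) p (S, 0) :=
    h.left.fourierTau_fderiv_left S
  -- For ξ_k = 0 the curve in phase space is constant, so the transform of `g` vanishes on that
  -- hyperplane and `lineInt_univ_eq_zero` applies.
  have hline : ∀ p, lineInt Set.univ k g p = 0 := by
    refine hg.lineInt_univ_eq_zero k fun T ξ hξ => ?_
    rw [hgF]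
    refine (hcurve T ξ).unique ?_
    simp only [hξ, mul_zero, neg_zero, zero_smul, smul_zero]
    exact hasDerivAt_const _ _
  have hu := hg.lineInt_Iic k hline
  -- If u is the primitive of `g` in τ_k, then 2πi ξ_k û = ĝ = -2ξ_k ∂G/∂η_k. Cancelling 2ξ_k gives
  -- the constant -πi.
  refine ⟨_, hu.const_mul (-(Real.pi * Complex.I)), fun T ξ hξ => ?_⟩
  rw [fourierTau_const_mul]
  have hne : ∀ ξ : Fin n → ℝ, ξ k ≠ 0 → -(Real.pi * Complex.I) *
      fourierTau (lineInt (Set.Iic 0) k g) (T, ξ) =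
        fderiv ℝ G (ξ, -(T.toMatrix *ᵥ ξ)) (0, Pi.single k 1) := by
    intro ξ hk
    have hξ : (ξ, -(T.toMatrix *ᵥ ξ)) ≠ 0 := fun h => hk (congrFun (congrArg Prod.fst h) k)
    have h1 : HasDerivAt (fun t : ℝ => (ξ, -(T.toMatrix *ᵥ ξ) +
        t • (-(2 * ξ k)) • (Pi.single k 1 : Fin n → ℝ))) (0, (-(2 * ξ k)) • Pi.single k 1) 0 := by
      refine (hasDerivAt_const _ _).prodMk ?_
      simpa using ((hasDerivAt_id (0 : ℝ)).smul_const
        ((-(2 * ξ k)) • (Pi.single k 1 : Fin n → ℝ))).const_add (-(T.toMatrix *ᵥ ξ))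
    have h2 := (hcurve T ξ).unique ((h.differentiableAt hξ).hasFDerivAt.comp_hasDerivAt_of_eq 0 h1
      (by simp))
    have h3 := hu.fourierTau_fderiv_right (Pi.single k 1) (T, ξ)
    simp only [hg.fderiv_lineInt_Iic, single_one_dotProduct] at h3
    rw [← hgF, h3] at h2
    have h4 : ((0 : Fin n → ℝ), (-(2 * ξ k)) • (Pi.single k 1 : Fin n → ℝ)) =
        (-(2 * ξ k)) • (0, Pi.single k 1) := by simp
    rw [h4, map_smul, Complex.real_smul] at h2
    have hk' : ((ξ k : ℝ) : ℂ) ≠ 0 := by exact_mod_cast hk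
    refine mul_left_cancel₀ hk' ?_
    push_cast at h2
    linear_combination (-1 / 2 : ℂ) * h2
  -- Division by ξ_k is impossible on this hyperplane. Both sides are continuous there because ξ ≠
  -- 0, so the identity is the limit of the one at ξ + s e_k.
  by_cases hk : ξ k = 0
  · have hcur : Tendsto (fun s : ℝ => ξ + s • (Pi.single k 1 : Fin n → ℝ)) (𝓝[≠] 0) (𝓝 ξ) := by
      have : Continuous fun s : ℝ => ξ + s • (Pi.single k 1 : Fin n → ℝ) := by fun_prop
      simpa using (this.tendsto 0).mono_left nhdsWithin_le_nhds
    have hc1 : Tendsto (fun s : ℝ => -(Real.pi * Complex.I) *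
        fourierTau (lineInt (Set.Iic 0) k g) (T, ξ + s • (Pi.single k 1 : Fin n → ℝ))) (𝓝[≠] 0)
        (𝓝 (-(Real.pi * Complex.I) * fourierTau (lineInt (Set.Iic 0) k g) (T, ξ))) := by
      have hcF : Continuous fun ξ => -(Real.pi * Complex.I) *
        fourierTau (lineInt (Set.Iic 0) k g) (T, ξ) :=
          continuous_const.mul (hu.continuous_fourierTau.comp (by fun_prop))
      exact (hcF.tendsto ξ).comp hcur
    have hc2 : Tendsto (fun s : ℝ => fderiv ℝ G (ξ + s • (Pi.single k 1 : Fin n → ℝ),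
        -(T.toMatrix *ᵥ (ξ + s • (Pi.single k 1 : Fin n → ℝ)))) (0, Pi.single k 1)) (𝓝[≠] 0)
        (𝓝 (fderiv ℝ G (ξ, -(T.toMatrix *ᵥ ξ)) (0, Pi.single k 1))) := by
      have hcm : Continuous fun ξ : Fin n → ℝ => (ξ, -(T.toMatrix *ᵥ ξ)) :=
        continuous_id.prodMk (continuous_const.matrix_mulVec continuous_id).neg
      have hξ' : (ξ, -(T.toMatrix *ᵥ ξ)) ≠ 0 := fun h => hξ (congrArg Prod.fst h)
      exact ((h.continuousAt_fderiv hξ' (0, Pi.single k 1)).tendsto.comp (hcm.tendsto ξ)).comp hcur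
    refine tendsto_nhds_unique_of_eventuallyEq hc1 hc2 ?_
    filter_upwards [self_mem_nhdsWithin] with s hs
    exact hne _ (by simpa [hk] using hs)
  · exact hne ξ hk

/-- The derivatives `∂G/∂η_k` have slices that are Fourier transforms in `τ`. -/
theorem exists_fderiv_single (h : HasSlices G h₁ h₂) (h0 : ∀ T, fourierTau h₁ (T, 0) = G 0)
    (h0' : ∀ T, fourierTau h₂ (T, 0) = G 0) (k : Fin n) :
    ∃ u v, HasSlices (fun p => fderiv ℝ G p (0, Pi.single k 1)) u v := by
  obtain ⟨u, hu, hu'⟩ := h.exists_fderiv_left h0 k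
  choose v hv hv' using fun l => h.swap.exists_fderiv_left h0' l
  -- Differentiating G(-Tξ, ξ) along e_k gives ∂G/∂η_k minus the sum of T_lk times the derivatives
  -- of G in the l-th coordinate of the first factor. Those derivatives have slices here by the
  -- swapped form of `exists_fderiv_left`, so the formula is solved for ∂G/∂η_k. The summand with
  -- direction (0, 0) is zero and only matches the shape of `mul_phaseL`.
  refine ⟨u, fun p => (fderiv ℝ h₂ p ((0 : Symm n), 0) + phaseL (0, Pi.single k 1) p * h₂ p) +
    ∑ l, ((p.1.toMatrix l k : ℝ) : ℂ) * v l p, hu, ?_, hu', fun T ξ hξ => ?_⟩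
  · refine (h.right.mul_phaseL (0, Pi.single k 1)).add (IsLocSchwartz.sum _ fun l _ => ?_)
    refine (hv l).mul_left (a := fun T : Symm n => ((T.toMatrix l k : ℝ) : ℂ)) ?_
    exact Complex.ofRealCLM.contDiff.comp (contDiff_apply ℝ ℝ s(l, k))
  · have hvl : ∀ l ∈ Finset.univ, IsLocSchwartz fun p : Symm n × (Fin n → ℝ) =>
        ((p.1.toMatrix l k : ℝ) : ℂ) * v l p := fun l _ =>
      (hv l).mul_left (a := fun T : Symm n => ((T.toMatrix l k : ℝ) : ℂ))
        (Complex.ofRealCLM.contDiff.comp (contDiff_apply ℝ ℝ s(l, k)))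
    have hξ' : (-(T.toMatrix *ᵥ ξ), ξ) ≠ 0 := fun h => hξ (congrArg Prod.snd h)
    rw [(h.right.mul_phaseL (0, Pi.single k 1)).fourierTau_add (IsLocSchwartz.sum _ hvl),
      IsLocSchwartz.fourierTau_sum _ hvl, ← h.right.fderiv_fourierTau]
    have hv'' : ∀ l, fourierTau (fun p : Symm n × (Fin n → ℝ) =>
        ((p.1.toMatrix l k : ℝ) : ℂ) * v l p) (T, ξ) =
        T.toMatrix l k * fderiv ℝ G (-(T.toMatrix *ᵥ ξ), ξ) (Pi.single l 1, 0) := by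
      intro l
      rw [fourierTau_mul_left (fun T : Symm n => ((T.toMatrix l k : ℝ) : ℂ)), hv' l T ξ hξ]
      rw [fderiv_comp_swap]
      rfl
    simp only [hv'']
    have h1 : HasDerivAt (fun t : ℝ => (T, ξ + t • (Pi.single k 1 : Fin n → ℝ)))
        (0, Pi.single k 1) 0 := by
      refine (hasDerivAt_const _ _).prodMk ?_
      simpa using ((hasDerivAt_id (0 : ℝ)).smul_const (Pi.single k (1 : ℝ))).const_add ξ
    have h2 := (h.right.differentiable_fourierTau (T, ξ)).hasFDerivAt.comp_hasDerivAt_of_eq 0 h1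
      (by simp)
    have h3 : HasDerivAt (fun t : ℝ => (-(T.toMatrix *ᵥ ξ) +
        t • -(T.toMatrix *ᵥ (Pi.single k 1 : Fin n → ℝ)), ξ + t • (Pi.single k 1 : Fin n → ℝ)))
        (-(T.toMatrix *ᵥ (Pi.single k 1 : Fin n → ℝ)), Pi.single k 1) 0 := by
      refine HasDerivAt.prodMk ?_ ?_
      · simpa using ((hasDerivAt_id (0 : ℝ)).smul_const
          (-(T.toMatrix *ᵥ (Pi.single k 1 : Fin n → ℝ)))).const_add (-(T.toMatrix *ᵥ ξ))
      · simpa using ((hasDerivAt_id (0 : ℝ)).smul_const (Pi.single k (1 : ℝ))).const_add ξ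
    have h4 := (h.differentiableAt hξ').hasFDerivAt.comp_hasDerivAt_of_eq 0 h3 (by simp)
    have h5 := h2.unique (h4.congr_of_eventuallyEq (Eventually.of_forall fun t => by
      have := h.swap.eq_left_all h0' T (ξ + t • (Pi.single k 1 : Fin n → ℝ))
      simp only [Function.comp_apply, Prod.swap_prod_mk] at this ⊢
      rw [this, Matrix.mulVec_add, Matrix.mulVec_smul, smul_neg, neg_add]))
    rw [h5]
    have h6 : (-(T.toMatrix *ᵥ (Pi.single k 1 : Fin n → ℝ)), (Pi.single k 1 : Fin n → ℝ)) =
        (0, Pi.single k 1) - ∑ l, T.toMatrix l k • ((Pi.single l 1 : Fin n → ℝ), (0 : Fin n → ℝ)) := by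
      refine Prod.ext ?_ ?_
      · funext i
        simp [Prod.fst_sum, Finset.sum_apply, Pi.single_apply]
      · simp [Prod.snd_sum]
    rw [h6, map_sub, map_sum]
    simp only [map_smul, Complex.real_smul]
    ring

theorem exists_fderiv (h : HasSlices G h₁ h₂) (h0 : ∀ T, fourierTau h₁ (T, 0) = G 0)
    (h0' : ∀ T, fourierTau h₂ (T, 0) = G 0) (w : (Fin n → ℝ) × (Fin n → ℝ)) :
    ∃ u v, HasSlices (fun p => fderiv ℝ G p w) u v := by
  choose u v huv using h.exists_fderiv_single h0 h0'
  choose u' v' huv' using h.swap.exists_fderiv_single h0' h0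
  have H := (HasSlices.sum Finset.univ fun l _ => (huv' l).swap.const_mul (w.1 l : ℂ)).add
    (HasSlices.sum Finset.univ fun l _ => (huv l).const_mul (w.2 l : ℂ))
  refine ⟨_, _, H.congr fun p hp => ?_⟩
  simp only [fderiv_comp_swap, Prod.swap_swap, Prod.swap_prod_mk]
  have h6 : w = ∑ l, w.1 l • ((Pi.single l 1 : Fin n → ℝ), (0 : Fin n → ℝ)) +
      ∑ l, w.2 l • ((0 : Fin n → ℝ), (Pi.single l 1 : Fin n → ℝ)) := by
    refine Prod.ext ?_ ?_ <;>
    · funext i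
      simp [Prod.fst_sum, Prod.snd_sum, Finset.sum_apply, Pi.single_apply]
  conv_lhs => rw [h6]
  rw [map_add, map_sum, map_sum]
  simp only [map_smul, Complex.real_smul]

end HasSlices

/-- A function that is continuous, differentiable away from the origin, and whose derivatives have
limits at the origin is differentiable at the origin. -/
theorem hasFDerivAt_zero_of_tendsto {G : (Fin n → ℝ) × (Fin n → ℝ) → ℂ} (k : Fin n)
    (hd : ∀ p, p ≠ 0 → DifferentiableAt ℝ G p) (hc : ContinuousAt G 0)
    {c : (Fin n → ℝ) × (Fin n → ℝ) → ℂ}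
    (h : ∀ w, Tendsto (fun p => fderiv ℝ G p w) (𝓝[≠] 0) (𝓝 (c w))) :
    ∃ L : (Fin n → ℝ) × (Fin n → ℝ) →L[ℝ] ℂ, HasFDerivAt G L 0 ∧ ∀ w, L w = c w := by
  let b := Module.finBasis ℝ ((Fin n → ℝ) × (Fin n → ℝ))
  let L : (Fin n → ℝ) × (Fin n → ℝ) →L[ℝ] ℂ :=
    ∑ i, (LinearMap.toContinuousLinearMap (b.coord i)).smulRight (c (b i))
  have hL : Tendsto (fderiv ℝ G) (𝓝[≠] 0) (𝓝 L) := by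
    have h1 : fderiv ℝ G = fun p => ∑ i,
        (LinearMap.toContinuousLinearMap (b.coord i)).smulRight (fderiv ℝ G p (b i)) := by
      funext p
      refine ContinuousLinearMap.ext fun w => ?_
      conv_lhs => rw [← b.sum_repr w, map_sum]
      simp only [map_smul, sum_apply, ContinuousLinearMap.smulRight_apply,
        LinearMap.coe_toContinuousLinearMap', Module.Basis.coord_apply]
    rw [h1]
    refine tendsto_finsetSum _ fun i _ => ?_
    have h2 : Continuous fun z : ℂ =>
        (LinearMap.toContinuousLinearMap (b.coord i)).smulRight z := by
      exact (ContinuousLinearMap.smulRightL ℝ _ ℂ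
        (LinearMap.toContinuousLinearMap (b.coord i))).continuous
    exact (h2.tendsto _).comp (h (b i))
  have hcont : ∀ p, ContinuousAt G p := fun p => by
    by_cases hp : p = 0
    · rw [hp]; exact hc
    · exact (hd p hp).continuousAt
  -- The punctured space is not convex, so the mean value argument is made on the two open
  -- half-spaces where the k-th coordinate of the first factor is positive or negative. Their
  -- closures have the origin on the boundary and together cover everything.
  have hhalf : ∀ U : Set ℝ, IsOpen U → Convex ℝ U → (0 : ℝ) ∉ U → HasFDerivWithinAt G L
      (closure ((fun p : (Fin n → ℝ) × (Fin n → ℝ) => p.1 k) ⁻¹' U)) 0 := by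
    intro U hU hUc h0
    have hne : ∀ p ∈ (fun p : (Fin n → ℝ) × (Fin n → ℝ) => p.1 k) ⁻¹' U, p ≠ 0 := by
      rintro p hp rfl
      exact h0 hp
    refine hasFDerivWithinAt_closure_of_tendsto_fderiv
      (fun p hp => (hd p (hne p hp)).differentiableWithinAt) ?_ (hU.preimage (by fun_prop))
      (fun p _ => (hcont p).continuousWithinAt) (hL.mono_left (nhdsWithin_mono _ hne))
    exact hUc.linear_preimage ((LinearMap.proj k).comp (LinearMap.fst ℝ (Fin n → ℝ) (Fin n → ℝ)))
  have hL0 : HasFDerivAt G L 0 := by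
    have h1 := (hhalf (Set.Ioi 0) isOpen_Ioi (convex_Ioi 0) (by simp)).union
      (hhalf (Set.Iio 0) isOpen_Iio (convex_Iio 0) (by simp))
    rw [← closure_union, ← Set.preimage_union, Set.union_comm, Set.Iio_union_Ioi] at h1
    have h2 : Dense ((fun p : (Fin n → ℝ) × (Fin n → ℝ) => p.1 k) ⁻¹' {0}ᶜ) :=
      (dense_compl_singleton (0 : ℝ)).preimage ((isOpenMap_eval k).comp isOpenMap_fst)
    rwa [h2.closure_eq, hasFDerivWithinAt_univ] at h1
  refine ⟨L, hL0, fun w => ?_⟩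
  have : (𝓝[≠] (0 : (Fin n → ℝ) × (Fin n → ℝ))).NeBot := by
    have : Nontrivial ((Fin n → ℝ) × (Fin n → ℝ)) :=
      ⟨(Pi.single k 1, 0), 0, fun h => by simpa using congrFun (congrArg Prod.fst h) k⟩
    exact Module.punctured_nhds_neBot ℝ _ 0
  refine tendsto_nhds_unique ?_ (h w)
  exact ((ContinuousLinearMap.apply ℝ ℂ w).continuous.tendsto L).comp hL

/-! ### Regularity at the origin -/

namespace IsSliced

variable {G : (Fin n → ℝ) × (Fin n → ℝ) → ℂ}

theorem decay (hG : IsSliced G) (M : ℕ) : ∃ C : ℝ, ∀ p, ‖p‖ ^ M * ‖G p‖ ≤ C := by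
  obtain ⟨h₁, h₂, h, -⟩ := hG
  obtain ⟨C, hC⟩ := h.decay M
  refine ⟨max C (‖(0 : (Fin n → ℝ) × (Fin n → ℝ))‖ ^ M * ‖G 0‖), fun p => ?_⟩
  by_cases hp : p = 0
  · rw [hp]
    exact le_max_right _ _
  · exact le_max_of_le_left (hC p hp)

/-- The first derivatives have slices, so by `exists_value` they have limits at the origin. These
limits make G differentiable there with the matching derivative, so each derivative is again sliced,
origin included, and the argument can be iterated. -/
theorem differentiable_and_fderiv (hn : 1 < n) (hG : IsSliced G) :
    Differentiable ℝ G ∧ ∀ w, IsSliced fun p => fderiv ℝ G p w := by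
  obtain ⟨h₁, h₂, h, h0⟩ := hG
  have hc : ContinuousAt G 0 := continuousAt_iff_punctured_nhds.2
    (h.tendsto (fun T => (h0 T).1) fun T => (h0 T).2)
  choose u v huv using h.exists_fderiv (fun T => (h0 T).1) (fun T => (h0 T).2)
  choose c hc' using fun w => (huv w).exists_value hn
  obtain ⟨L, hL, hLc⟩ := hasFDerivAt_zero_of_tendsto ⟨0, by omega⟩ (fun p hp => h.differentiableAt hp)
    hc fun w => (huv w).tendsto (fun T => (hc' w T).1) fun T => (hc' w T).2
  refine ⟨fun p => ?_, fun w => ⟨u w, v w, huv w, fun T => ?_⟩⟩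
  · by_cases hp : p = 0
    · rw [hp]
      exact hL.differentiableAt
    · exact h.differentiableAt hp
  · simp only [hL.fderiv, hLc]
    exact hc' w T

theorem exists_schwartz (hn : 1 < n) (hG : IsSliced G) :
    ∃ f : 𝓢((Fin n → ℝ) × (Fin n → ℝ), ℂ), ⇑f = G :=
  exists_schwartz_of_closed IsSliced (fun _ hG => ⟨(hG.differentiable_and_fderiv hn).1, hG.decay,
    (hG.differentiable_and_fderiv hn).2⟩) hG

end IsSliced

/-- A function with slices is a Schwartz function, up to its value at the origin. -/
theorem HasSlices.exists_schwartz {G : (Fin n → ℝ) × (Fin n → ℝ) → ℂ}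
    {h₁ h₂ : Symm n × (Fin n → ℝ) → ℂ} (h : HasSlices G h₁ h₂) (hn : 1 < n) :
    ∃ f : 𝓢((Fin n → ℝ) × (Fin n → ℝ), ℂ), ∀ (T : Symm n) (ξ : Fin n → ℝ),
      fourierTau h₁ (T, ξ) = f (ξ, -(T.toMatrix *ᵥ ξ)) := by
  obtain ⟨c, hc⟩ := h.exists_value hn
  have h' : HasSlices (Function.update G 0 c) h₁ h₂ :=
    h.congr fun p hp => Function.update_of_ne hp _ _
  obtain ⟨f, hf⟩ := IsSliced.exists_schwartz hn ⟨h₁, h₂, h', fun T => by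
    rw [Function.update_self]
    exact hc T⟩
  refine ⟨f, fun T ξ => ?_⟩
  rw [hf]
  exact h'.eq_left_all (fun T => by rw [Function.update_self]; exact (hc T).1) T ξ

/-! ### The slice theorem -/

theorem measurePreserving_pointE_symm :
    MeasurePreserving (fun v : PhaseSpace n => (pointE n).symm v) volume volume :=
  (volume_measurePreserving_sumPiEquivProdPi fun _ : Fin n ⊕ Fin n => ℝ).comp
    (EuclideanSpace.volume_preserving_symm_measurableEquiv_toLp (Fin n ⊕ Fin n))

theorem integral_phaseSpace (g : PhaseSpace n → ℂ) :
    ∫ v, g v = ∫ p : (Fin n → ℝ) × (Fin n → ℝ), g (point p.1 p.2) := by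
  have h := (measurePreserving_pointE_symm (n := n)).integral_comp
    (pointE n).symm.toHomeomorph.toMeasurableEquiv.measurableEmbedding
    fun p => g (point p.1 p.2)
  rw [← h]
  congr 1
  funext v
  rw [← pointE_apply, ContinuousLinearEquiv.apply_symm_apply]

/-- The linear equivalence `(τ, y) ↦ (Ty + τ, y)`. -/
noncomputable def shearE (T : Symm n) : ((Fin n → ℝ) × (Fin n → ℝ)) ≃L[ℝ] PhaseSpace n :=
  (LinearEquiv.toContinuousLinearEquiv
    { toFun := fun p => (T.toMatrix *ᵥ p.2 + p.1, p.2)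
      invFun := fun p => (p.1 - T.toMatrix *ᵥ p.2, p.2)
      map_add' := fun p q => by
        refine Prod.ext ?_ rfl
        simp only [Prod.snd_add, Prod.fst_add, Matrix.mulVec_add]
        abel
      map_smul' := fun c p => by
        refine Prod.ext ?_ rfl
        simp [Matrix.mulVec_smul]
      left_inv := fun p => by simp
      right_inv := fun p => by simp } :
    ((Fin n → ℝ) × (Fin n → ℝ)) ≃L[ℝ] ((Fin n → ℝ) × (Fin n → ℝ))).trans (pointE n)

theorem integrable_comp_shearE (f : 𝓢(PhaseSpace n, ℂ)) (T : Symm n) :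
    Integrable fun p : (Fin n → ℝ) × (Fin n → ℝ) => f (point (T.toMatrix *ᵥ p.2 + p.1) p.2) := by
  have : Measure.IsAddHaarMeasure (volume : Measure ((Fin n → ℝ) × (Fin n → ℝ))) :=
    Measure.prod.instIsAddHaarMeasure _ _
  exact (SchwartzMap.compCLMOfContinuousLinearEquiv ℝ (shearE T) f).integrable

theorem Symm.mulVec_dotProduct (T : Symm n) (y ξ : Fin n → ℝ) :
    (T.toMatrix *ᵥ y) ⬝ᵥ ξ = y ⬝ᵥ (T.toMatrix *ᵥ ξ) := by
  rw [Matrix.dotProduct_mulVec, ← Matrix.mulVec_transpose, T.isSymm_toMatrix.eq]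

theorem integrable_radonFlat_slice (f : 𝓢(PhaseSpace n, ℂ)) (T : Symm n) :
    Integrable fun τ => radonFlat f (T, τ) := by
  have h := integrable_comp_shearE f T
  rw [Measure.volume_eq_prod] at h
  exact h.integral_prod_left

/-- The slice theorem: the Fourier transform in `τ` of the Radon transform is the restriction of
the Fourier transform to a Lagrangian subspace. -/
theorem fourierTau_radonFlat (f : 𝓢(PhaseSpace n, ℂ)) (T : Symm n) (ξ : Fin n → ℝ) :
    fourierTau (radonFlat f) (T, ξ) =
      FourierTransform.fourier f (point ξ (-(T.toMatrix *ᵥ ξ))) := by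
  have hi : ∀ {g : (Fin n → ℝ) × (Fin n → ℝ) → ℂ}, Integrable g →
      ∀ a : (Fin n → ℝ) × (Fin n → ℝ) → (Fin n → ℝ), Continuous a →
      Integrable fun p => expPhase (a p) ξ * g p := fun hg a ha =>
    hg.bdd_mul (c := 1) ((continuous_expPhase_left ξ).comp ha).aestronglyMeasurable
      (Eventually.of_forall fun p => (norm_expPhase _ ξ).le)
  have h1 := hi (integrable_comp_shearE f T) Prod.fst continuous_fst
  have h2 := hi (integrable_comp_shearE f 0) (fun p => p.1 - T.toMatrix *ᵥ p.2)
    (continuous_fst.sub (continuous_const.matrix_mulVec continuous_snd))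
  simp only [Symm.toMatrix_zero, Matrix.zero_mulVec, zero_add] at h2
  have e1 : fourierTau (radonFlat f) (T, ξ) = ∫ τ : Fin n → ℝ, ∫ y : Fin n → ℝ,
      expPhase τ ξ * f (point (T.toMatrix *ᵥ y + τ) y) := by
    simp only [fourierTau, radonFlat, integral_const_mul]
  have e2 : FourierTransform.fourier f (point ξ (-(T.toMatrix *ᵥ ξ))) =
      ∫ p : (Fin n → ℝ) × (Fin n → ℝ), expPhase (p.1 - T.toMatrix *ᵥ p.2) ξ *
        f (point p.1 p.2) := by
    rw [SchwartzMap.fourier_coe, Real.fourier_eq', integral_phaseSpace]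
    congr 1
    funext p
    rw [smul_eq_mul, expPhase, sub_dotProduct, T.mulVec_dotProduct]
    congr 5
    rw [PiLp.inner_apply, Fintype.sum_sum_type]
    simp [dotProduct, mul_comm, sub_eq_add_neg]
  rw [e1, e2]
  rw [Measure.volume_eq_prod] at h1 h2 ⊢
  rw [integral_prod_symm _ h2, integral_integral_swap h1]
  congr 1
  funext y
  -- For fixed y this is the substitution x = Ty + τ.
  rw [← integral_sub_right_eq_self _ (T.toMatrix *ᵥ y)]
  simp

/-- The preimage is the inverse Fourier transform of the function on phase space. By the slice
theorem both sides have the same Fourier transform in τ, which determines them. -/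
theorem radonFlat_eq_of_fourierTau {h : Symm n × (Fin n → ℝ) → ℂ} (hh : IsLocSchwartz h)
    (f : 𝓢((Fin n → ℝ) × (Fin n → ℝ), ℂ)) (hf : ∀ (T : Symm n) (ξ : Fin n → ℝ),
      fourierTau h (T, ξ) = f (ξ, -(T.toMatrix *ᵥ ξ))) :
    ∃ g : 𝓢(PhaseSpace n, ℂ), h = radonFlat g := by
  let g : 𝓢(PhaseSpace n, ℂ) := FourierTransformInv.fourierInv
    (SchwartzMap.compCLMOfContinuousLinearEquiv ℝ (pointE n).symm f)
  have hg : ∀ T ξ, fourierTau (radonFlat g) (T, ξ) = fourierTau h (T, ξ) := by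
    intro T ξ
    rw [fourierTau_radonFlat, hf, FourierTransform.fourier_fourierInv_eq]
    rfl
  refine ⟨g, funext fun p => ?_⟩
  have h1 : (fun τ => h (p.1, τ) - radonFlat g (p.1, τ)) = 0 := by
    have hc : Continuous fun τ => radonFlat g (p.1, τ) :=
      (contDiff_radonFlat g).continuous.comp (by fun_prop)
    refine eq_zero_of_fourier_eq_zero ((hh.continuous_slice p.1).sub hc)
      ((hh.integrable_slice p.1).sub (integrable_radonFlat_slice g p.1)) fun ξ => ?_
    simp only [mul_sub]
    rw [integral_sub (hh.integrable_phase_mul p.1 ξ)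
      ((integrable_radonFlat_slice g p.1).bdd_mul (c := 1)
        (continuous_expPhase_left ξ).aestronglyMeasurable
        (Eventually.of_forall fun τ => (norm_expPhase τ ξ).le))]
    exact sub_eq_zero.2 (hg p.1 ξ).symm
  exact sub_eq_zero.1 (congrFun h1 p.2)

/-! ### One-parameter groups that translate charts -/

/-- Both directions have dimension n, so one inclusion suffices. -/
theorem AL.eq_of_le {P Q : AL n} (h : ∀ v ∈ P.1, v ∈ Q.1) : P = Q := by
  have hle : P.1 ≤ Q.1 := h
  have hd := AffineSubspace.direction_le hle
  have hfr : Module.finrank ℝ P.1.direction = Module.finrank ℝ Q.1.direction :=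
    P.2.2.2.trans Q.2.2.2.symm
  exact Subtype.ext (AffineSubspace.eq_of_direction_eq_of_nonempty_of_le
    (Submodule.eq_of_le_of_finrank_eq hd hfr) P.2.1 hle)

theorem AL.act_eq {g : ASp n} {P Q : AL n} (h : ∀ v ∈ P.1, affineAction g.1 v ∈ Q.1) :
    P.act g = Q := by
  refine AL.eq_of_le fun v hv => ?_
  obtain ⟨u, hu, rfl⟩ := (AffineSubspace.mem_map).1 hv
  exact h u hu

theorem exp_of_sq_eq_zero {m : Type*} [Fintype m] [DecidableEq m] {A : Matrix m m ℝ}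
    (hA : A * A = 0) : NormedSpace.exp A = 1 + A := by
  refine (hasSum_exp A).unique ?_
  have h := hasSum_sum_of_ne_finset_zero (L := SummationFilter.unconditional ℕ)
    (f := fun k : ℕ => ((k.factorial : ℝ)⁻¹) • A ^ k)
    (s := Finset.range 2) fun k hk => by
      obtain ⟨j, rfl⟩ : ∃ j, k = 2 + j := Nat.exists_eq_add_of_le (by simpa using not_lt.1 fun h => hk (Finset.mem_range.2 h))
      simp only [pow_add, sq, hA, zero_mul, smul_zero]
  have h2 : ∑ k ∈ Finset.range 2, ((k.factorial : ℝ)⁻¹) • A ^ k = 1 + A := by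
    simp [Finset.sum_range_succ]
  rwa [h2] at h

/-- The matrix `(X r; 0 0)`. -/
def affMatrix (X : Matrix (Fin n ⊕ Fin n) (Fin n ⊕ Fin n) ℝ) (r : Fin n ⊕ Fin n → ℝ) : AffMatrix n :=
  Matrix.fromBlocks X (Matrix.of fun i _ => r i) 0 0

/-- The two hypotheses say that the affine matrix has square zero, so the exponential series stops
after the linear term. -/
theorem affineAction_exp_affMatrix {X : Matrix (Fin n ⊕ Fin n) (Fin n ⊕ Fin n) ℝ}
    {r : Fin n ⊕ Fin n → ℝ} (hX : X * X = 0) (hr : X *ᵥ r = 0) (t : ℝ) (v : PhaseSpace n)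
    (i : Fin n ⊕ Fin n) :
    affineAction (NormedSpace.exp (t • affMatrix X r)) v i =
      v i + t * ((X *ᵥ WithLp.ofLp v) i + r i) := by
  have h0 : affMatrix X r * affMatrix X r = 0 := by
    rw [affMatrix, Matrix.fromBlocks_multiply, hX]
    have : X * (Matrix.of fun i (_ : Unit) => r i) = 0 := by
      ext i j
      exact congrFun hr i
    simp [this]
  rw [exp_of_sq_eq_zero (by rw [Matrix.smul_mul, Matrix.mul_smul, h0, smul_zero, smul_zero]),
    affineAction_apply]
  rw [PiLp.add_apply, linPart_coord, transPart_coord]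
  have h1 : ∀ j, (1 + t • affMatrix X r) (Sum.inl i) (Sum.inl j) =
      (1 : Matrix (Fin n ⊕ Fin n) (Fin n ⊕ Fin n) ℝ) i j + t * X i j := by
    intro j
    simp [affMatrix, Matrix.one_apply]
  have h2 : (1 + t • affMatrix X r) (Sum.inl i) (Sum.inr ()) = t * r i := by
    simp [affMatrix]
  simp only [h1, h2, add_mul, Finset.sum_add_distrib, mul_assoc, ← Finset.mul_sum]
  rw [mul_add, ← add_assoc]
  congr 2
  simp [Matrix.one_apply]

theorem affMatrix_mem_aspLie {X : Matrix (Fin n ⊕ Fin n) (Fin n ⊕ Fin n) ℝ}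
    {r : Fin n ⊕ Fin n → ℝ} (hX : Xᵀ * Matrix.J (Fin n) ℝ = Matrix.J (Fin n) ℝ * (-X)) :
    affMatrix X r ∈ aspLie n := by
  refine ⟨?_, Matrix.toBlocks_fromBlocks₂₁ _ _ _ _, Matrix.toBlocks_fromBlocks₂₂ _ _ _ _⟩
  rw [affMatrix, Matrix.toBlocks_fromBlocks₁₁]
  refine (mem_skewAdjointMatricesLieSubalgebra _ _).2 ?_
  rw [mem_skewAdjointMatricesSubmodule]
  exact hX

/-- A chart of the affine Lagrangian Grassmannian whose translations are given by one-parameter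
subgroups of the affine symplectic group. -/
structure IsTranslationChart (c : Symm n × (Fin n → ℝ) → AL n) : Prop where
  exists_lie : ∀ w, ∃ Y : aspLie n, ∀ (p : Symm n × (Fin n → ℝ)) (t : ℝ),
    (c p).act (aspExp Y t) = c (p + t • w)
  contDiff : ∀ F : AL n → ℂ, IsSmooth F → ContDiff ℝ ∞ fun p => F (c p)
  norm_le : ∀ p, ‖p.2‖ ≤ (1 + n * ‖p.1‖) * (c p).distZero

theorem isTranslationChart_graphPlane : IsTranslationChart (graphPlane (n := n)) where
  exists_lie w := by
    have hS := w.1.isSymm_toMatrix.eq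
    -- The generator of the shears x ↦ x + t(Sy + σ), which translate the chart; its linear part
    -- lies in sp because S is symmetric.
    refine ⟨⟨affMatrix (Matrix.fromBlocks 0 w.1.toMatrix 0 0) (Sum.elim w.2 0),
      affMatrix_mem_aspLie ?_⟩, fun p t => AL.act_eq fun v hv => ?_⟩
    · simp [Matrix.J, Matrix.fromBlocks_transpose, Matrix.fromBlocks_multiply, hS,
        Matrix.fromBlocks_neg]
    · rw [mem_graphPlane] at hv ⊢
      have hX : (Matrix.fromBlocks 0 w.1.toMatrix 0 0 : Matrix (Fin n ⊕ Fin n) (Fin n ⊕ Fin n) ℝ) *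
          Matrix.fromBlocks 0 w.1.toMatrix 0 0 = 0 := by
        simp [Matrix.fromBlocks_multiply]
      have hr : (Matrix.fromBlocks 0 w.1.toMatrix 0 0 : Matrix (Fin n ⊕ Fin n) (Fin n ⊕ Fin n) ℝ) *ᵥ
          Sum.elim w.2 0 = 0 := by
        simp [Matrix.fromBlocks_mulVec]
      intro i
      simp only [aspExp, affineAction_exp_affMatrix hX hr]
      simp only [Matrix.fromBlocks_mulVec, Sum.elim_inl, Sum.elim_inr, Matrix.zero_mulVec, zero_add,
        Pi.zero_apply, add_zero, mul_zero, Prod.fst_add, Prod.smul_fst, Prod.snd_add,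
        Prod.smul_snd, Symm.toMatrix_add, Symm.toMatrix_smul, Matrix.add_mulVec, Matrix.smul_mulVec,
        Pi.add_apply, Pi.smul_apply, smul_eq_mul, hv i]
      simp only [Function.comp_def]
      ring
  contDiff F hF := by
    simpa only [AL.act_one] using hF ⟨1, one_mem_ASp⟩
  norm_le p := by
    have hK : (0 : ℝ) < 1 + n * ‖p.1‖ := by positivity
    rw [← div_le_iff₀' hK, AL.distZero, Metric.le_infDist (graphPlane p).2.1]
    intro v hv
    rw [div_le_iff₀' hK, dist_zero_left]
    have h1 := mem_graphPlane.1 hv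
    have h2 : p.2 = (fun i => v (Sum.inl i)) - p.1.toMatrix *ᵥ fun j => v (Sum.inr j) := by
      funext i
      rw [Pi.sub_apply, h1 i]
      ring
    have hv' : v = point (fun i => v (Sum.inl i)) fun j => v (Sum.inr j) :=
      ((pointE n).apply_symm_apply v).symm
    have h3 := norm_le_norm_point_left (fun i => v (Sum.inl i)) fun j => v (Sum.inr j)
    have h4 := norm_le_norm_point_right (fun i => v (Sum.inl i)) fun j => v (Sum.inr j)
    rw [← hv'] at h3 h4
    calc ‖p.2‖ ≤ ‖fun i => v (Sum.inl i)‖ + ‖p.1.toMatrix *ᵥ fun j => v (Sum.inr j)‖ := by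
          conv_lhs => rw [h2]
          exact norm_sub_le _ _
      _ ≤ ‖v‖ + n * ‖p.1‖ * ‖v‖ := by
          gcongr
          exact (Symm.norm_mulVec_le _ _).trans (by gcongr)
      _ = _ := by ring

/-- The rotation `(x, y) ↦ (y, -x)`. -/
def rotation (n : ℕ) : ASp n :=
  ⟨Matrix.fromBlocks (Matrix.fromBlocks 0 1 (-1) 0) 0 0 1, by
    refine ⟨?_, Matrix.toBlocks_fromBlocks₂₁ _ _ _ _, Matrix.toBlocks_fromBlocks₂₂ _ _ _ _⟩
    rw [Matrix.toBlocks_fromBlocks₁₁, SymplecticGroup.mem_iff]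
    simp [Matrix.J, Matrix.fromBlocks_transpose, Matrix.fromBlocks_multiply]⟩

theorem affineAction_rotation_inl (v : PhaseSpace n) (i : Fin n) :
    affineAction (rotation n).1 v (Sum.inl i) = v (Sum.inr i) := by
  rw [affineAction_apply, PiLp.add_apply, linPart_coord, transPart_coord]
  simp [rotation, Fintype.sum_sum_type, Matrix.one_apply]

theorem affineAction_rotation_inr (v : PhaseSpace n) (i : Fin n) :
    affineAction (rotation n).1 v (Sum.inr i) = -v (Sum.inl i) := by
  rw [affineAction_apply, PiLp.add_apply, linPart_coord, transPart_coord]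
  simp [rotation, Fintype.sum_sum_type, Matrix.one_apply]

/-- The affine Lagrangian subspace `y = T x + τ`. -/
noncomputable def coPlane (p : Symm n × (Fin n → ℝ)) : AL n := (graphPlane (-p)).act (rotation n)

theorem mem_coPlane {p : Symm n × (Fin n → ℝ)} {v : PhaseSpace n} :
    v ∈ (coPlane p).1 ↔ ∀ i, v (Sum.inr i) =
      (p.1.toMatrix *ᵥ fun j => v (Sum.inl j)) i + p.2 i := by
  constructor
  · intro hv i
    obtain ⟨u, hu, rfl⟩ := AffineSubspace.mem_map.1 hv
    have := mem_graphPlane.1 hu i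
    simp only [affineAction_rotation_inl, affineAction_rotation_inr, this, Prod.fst_neg,
      Prod.snd_neg, Symm.toMatrix_neg, Matrix.neg_mulVec, Pi.neg_apply]
    ring
  · intro hv
    refine AffineSubspace.mem_map.2
      ⟨point (-fun i => v (Sum.inr i)) fun i => v (Sum.inl i), mem_graphPlane.2 fun i => ?_, ?_⟩
    · simp only [point_inl, point_inr, Pi.neg_apply, hv i, Prod.fst_neg,
        Prod.snd_neg, Symm.toMatrix_neg, Matrix.neg_mulVec]
      ring
    · ext i
      cases i with
      | inl i => rw [affineAction_rotation_inl, point_inr]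
      | inr i => rw [affineAction_rotation_inr, point_inl, Pi.neg_apply, neg_neg]

theorem isTranslationChart_coPlane : IsTranslationChart (coPlane (n := n)) where
  exists_lie w := by
    have hS := w.1.isSymm_toMatrix.eq
    -- Here the shears are y ↦ y + t(Sx + σ).
    refine ⟨⟨affMatrix (Matrix.fromBlocks 0 0 w.1.toMatrix 0) (Sum.elim 0 w.2),
      affMatrix_mem_aspLie ?_⟩, fun p t => AL.act_eq fun v hv => ?_⟩
    · simp [Matrix.J, Matrix.fromBlocks_transpose, Matrix.fromBlocks_multiply, hS,
        Matrix.fromBlocks_neg]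
    · rw [mem_coPlane] at hv ⊢
      have hX : (Matrix.fromBlocks 0 0 w.1.toMatrix 0 : Matrix (Fin n ⊕ Fin n) (Fin n ⊕ Fin n) ℝ) *
          Matrix.fromBlocks 0 0 w.1.toMatrix 0 = 0 := by
        simp [Matrix.fromBlocks_multiply]
      have hr : (Matrix.fromBlocks 0 0 w.1.toMatrix 0 : Matrix (Fin n ⊕ Fin n) (Fin n ⊕ Fin n) ℝ) *ᵥ
          Sum.elim 0 w.2 = 0 := by
        simp [Matrix.fromBlocks_mulVec]
      intro i
      simp only [aspExp, affineAction_exp_affMatrix hX hr]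
      simp only [Matrix.fromBlocks_mulVec, Sum.elim_inl, Sum.elim_inr, Matrix.zero_mulVec,
        Pi.zero_apply, add_zero, mul_zero, Prod.fst_add, Prod.smul_fst, Prod.snd_add,
        Prod.smul_snd, Symm.toMatrix_add, Symm.toMatrix_smul, Matrix.add_mulVec, Matrix.smul_mulVec,
        Pi.add_apply, Pi.smul_apply, smul_eq_mul, hv i]
      simp only [Function.comp_def]
      ring
  contDiff F hF := (hF (rotation n)).comp contDiff_neg
  norm_le p := by
    have hK : (0 : ℝ) < 1 + n * ‖p.1‖ := by positivity
    rw [← div_le_iff₀' hK, AL.distZero, Metric.le_infDist (coPlane p).2.1]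
    intro v hv
    rw [div_le_iff₀' hK, dist_zero_left]
    have h1 := mem_coPlane.1 hv
    have h2 : p.2 = (fun i => v (Sum.inr i)) - p.1.toMatrix *ᵥ fun j => v (Sum.inl j) := by
      funext i
      rw [Pi.sub_apply, h1 i]
      ring
    have hv' : v = point (fun i => v (Sum.inl i)) fun j => v (Sum.inr j) :=
      ((pointE n).apply_symm_apply v).symm
    have h3 := norm_le_norm_point_left (fun i => v (Sum.inl i)) fun j => v (Sum.inr j)
    have h4 := norm_le_norm_point_right (fun i => v (Sum.inl i)) fun j => v (Sum.inr j)
    rw [← hv'] at h3 h4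
    calc ‖p.2‖ ≤ ‖fun i => v (Sum.inr i)‖ + ‖p.1.toMatrix *ᵥ fun j => v (Sum.inl j)‖ := by
          conv_lhs => rw [h2]
          exact norm_sub_le _ _
      _ ≤ ‖v‖ + n * ‖p.1‖ * ‖v‖ := by
          gcongr
          exact (Symm.norm_mulVec_le _ _).trans (by gcongr)
      _ = _ := by ring

/-- Coordinate derivatives in such a chart are Lie derivatives, so the Schwartz condition bounds all
of them. For bounded T the field `norm_le` turns decay in the distance of the plane into decay in τ.
-/
theorem IsTranslationChart.isLocSchwartz {c : Symm n × (Fin n → ℝ) → AL n}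
    (hc : IsTranslationChart c) {F : AL n → ℂ} (hF : IsSchwartz F) :
    IsLocSchwartz fun p => F (c p) := by
  refine IsLocSchwartz.of_closed (fun u => ContDiff ℝ ∞ u ∧ ∃ Ys : List (aspLie n),
    u = fun p => Ys.foldr lieDeriv F (c p)) ?_ ⟨hc.contDiff F hF.1, [], rfl⟩
  rintro _ ⟨hu, Ys, rfl⟩
  refine ⟨hu.differentiable (by simp), fun R M => ?_, fun w => ⟨(hu.fderiv_right (by simp)).clm_apply
    contDiff_const, ?_⟩⟩
  · obtain ⟨C, hC⟩ := hF.2 Ys 0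
    obtain ⟨D, hD⟩ := hF.2 Ys M
    have hC0 : 0 ≤ C := le_trans (by positivity) (hC (c 0))
    have hD0 : 0 ≤ D := le_trans (mul_nonneg (pow_nonneg (AL.distZero_nonneg _) _) (norm_nonneg _))
      (hD (c 0))
    refine ⟨2 ^ (M - 1) * (C + (1 + n * |R|) ^ M * D), by positivity, fun p hp => ?_⟩
    have h1 : ‖p.2‖ ^ M ≤ (1 + n * |R|) ^ M * (c p).distZero ^ M := by
      rw [← mul_pow]
      refine pow_le_pow_left₀ (norm_nonneg _) ((hc.norm_le p).trans ?_) M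
      have := AL.distZero_nonneg (c p)
      gcongr
      exact hp.trans (le_abs_self R)
    calc (1 + ‖p.2‖) ^ M * ‖Ys.foldr lieDeriv F (c p)‖
        ≤ (2 ^ (M - 1) * (1 ^ M + ‖p.2‖ ^ M)) * ‖Ys.foldr lieDeriv F (c p)‖ := by
          gcongr
          exact add_pow_le zero_le_one (norm_nonneg _) M
      _ ≤ (2 ^ (M - 1) * (1 ^ M + (1 + n * |R|) ^ M * (c p).distZero ^ M)) *
            ‖Ys.foldr lieDeriv F (c p)‖ := by gcongr
      _ = 2 ^ (M - 1) * ((c p).distZero ^ 0 * ‖Ys.foldr lieDeriv F (c p)‖ +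
            (1 + n * |R|) ^ M * ((c p).distZero ^ M * ‖Ys.foldr lieDeriv F (c p)‖)) := by ring
      _ ≤ _ := by
          gcongr
          · exact hC (c p)
          · exact hD (c p)
  · obtain ⟨Y, hY⟩ := hc.exists_lie w
    refine ⟨Y :: Ys, funext fun p => ?_⟩
    simp only [List.foldr_cons, lieDeriv, hY]
    have h1 : HasDerivAt (fun t : ℝ => p + t • w) w 0 := by
      simpa using ((hasDerivAt_id (0 : ℝ)).smul_const w).const_add p
    exact ((hu.differentiable (by simp) p).hasFDerivAt.comp_hasDerivAt_of_eq 0 h1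
      (by simp)).deriv.symm

theorem det_one_add_sq_pos (T : Symm n) : 0 < (1 + T.toMatrix ^ 2).det := by
  obtain ⟨S, hS, h0, -⟩ := exists_sqrt_one_add_sq T
  exact Real.sqrt_pos.1 (hS ▸ h0)

theorem contDiff_sqrt_det_inv :
    ContDiff ℝ ∞ fun T : Symm n => (((√(1 + T.toMatrix ^ 2).det)⁻¹ : ℝ) : ℂ) := by
  have h1 : ContDiff ℝ ∞ fun T : Symm n => (1 + T.toMatrix ^ 2).det := by
    simp only [Matrix.det_apply, Matrix.add_apply, sq, Matrix.mul_apply, Symm.toMatrix,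
      Matrix.of_apply]
    refine ContDiff.sum fun σ _ => ContDiff.const_smul _ (contDiff_prod fun i _ => ?_)
    refine contDiff_const.add (ContDiff.sum fun j _ => ?_)
    exact (contDiff_apply ℝ ℝ _).mul (contDiff_apply ℝ ℝ _)
  have h2 := (h1.sqrt fun T => (det_one_add_sq_pos T).ne').inv fun T =>
    (Real.sqrt_pos.2 (det_one_add_sq_pos T)).ne'
  exact Complex.ofRealCLM.contDiff.comp h2

/-! ### The determinantal system on the Fourier side -/

theorem sum_perm_fin_three (f : Fin 3 → Fin 3 → Fin 3 → ℂ) :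
    ∑ σ : Equiv.Perm (Fin 3), ((Equiv.Perm.sign σ : ℤ) : ℂ) * f (σ 0) (σ 1) (σ 2) =
      f 0 1 2 - f 0 2 1 - f 1 0 2 + f 1 2 0 + f 2 0 1 - f 2 1 0 := by
  have h : (Finset.univ : Finset (Equiv.Perm (Fin 3))) =
      {1, Equiv.swap 0 1, Equiv.swap 0 2, Equiv.swap 1 2, Equiv.swap 0 1 * Equiv.swap 1 2,
        Equiv.swap 1 2 * Equiv.swap 0 1} := by decide
  rw [h, Finset.sum_insert (by decide), Finset.sum_insert (by decide),
    Finset.sum_insert (by decide), Finset.sum_insert (by decide), Finset.sum_insert (by decide),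
    Finset.sum_singleton]
  have e1 : (Equiv.swap 0 1 * Equiv.swap 1 2 : Equiv.Perm (Fin 3)) 0 = 1 := by decide
  have e2 : (Equiv.swap 0 1 * Equiv.swap 1 2 : Equiv.Perm (Fin 3)) 1 = 2 := by decide
  have e3 : (Equiv.swap 0 1 * Equiv.swap 1 2 : Equiv.Perm (Fin 3)) 2 = 0 := by decide
  have e4 : (Equiv.swap 1 2 * Equiv.swap 0 1 : Equiv.Perm (Fin 3)) 0 = 2 := by decide
  have e5 : (Equiv.swap 1 2 * Equiv.swap 0 1 : Equiv.Perm (Fin 3)) 1 = 0 := by decide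
  have e6 : (Equiv.swap 1 2 * Equiv.swap 0 1 : Equiv.Perm (Fin 3)) 2 = 1 := by decide
  have e7 : (Equiv.swap 0 1 : Equiv.Perm (Fin 3)) 2 = 2 := by decide
  have e8 : (Equiv.swap 0 2 : Equiv.Perm (Fin 3)) 1 = 1 := by decide
  have e9 : (Equiv.swap 1 2 : Equiv.Perm (Fin 3)) 0 = 0 := by decide
  rw [e1, e2, e3, e4, e5, e6, e7, e8, e9, Equiv.Perm.sign_mul, Equiv.Perm.sign_mul,
    Equiv.Perm.sign_swap (by decide), Equiv.Perm.sign_swap (by decide),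
    Equiv.Perm.sign_swap (by decide)]
  simp
  ring

namespace IsLocSchwartz

variable {h : Symm n × (Fin n → ℝ) → ℂ}

theorem fderiv_comm (hh : IsLocSchwartz h) (p a b : Symm n × (Fin n → ℝ)) :
    _root_.fderiv ℝ (fun q => _root_.fderiv ℝ h q a) p b =
      _root_.fderiv ℝ (fun q => _root_.fderiv ℝ h q b) p a := by
  have h1 : ∀ c, _root_.fderiv ℝ (fun q => _root_.fderiv ℝ h q c) p =
      (_root_.fderiv ℝ (_root_.fderiv ℝ h) p).flip c := by
    intro c
    have h2 : DifferentiableAt ℝ (_root_.fderiv ℝ h) p :=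
      (hh.1.fderiv_right (m := 1) (by norm_cast)).differentiable (by simp) p
    have h3 : HasFDerivAt (fun q => _root_.fderiv ℝ h q c) _ p :=
      h2.hasFDerivAt.clm_apply (hasFDerivAt_const c p)
    rw [h3.fderiv]
    refine ContinuousLinearMap.ext fun w => ?_
    simp
  rw [h1, h1]
  exact (hh.1.contDiffAt.isSymmSndFDerivAt
    (by simpa using (WithTop.coe_le_coe.2 le_top : ((2 : ℕ∞) : WithTop ℕ∞) ≤ ∞))).eq b a

theorem entryOp (hh : IsLocSchwartz h) (i j : Fin n ⊕ Unit) : IsLocSchwartz (entryOp i j h) :=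
  hh.fderiv _

theorem entryOp_comm (hh : IsLocSchwartz h) (i j k l : Fin n ⊕ Unit) :
    LagrangianRadon.entryOp i j (LagrangianRadon.entryOp k l h) =
      LagrangianRadon.entryOp k l (LagrangianRadon.entryOp i j h) :=
  funext fun p => hh.fderiv_comm p _ _

theorem fourierTau_entryOp_inr (hh : IsLocSchwartz h) (k : Fin n) (p : Symm n × (Fin n → ℝ)) :
    fourierTau (LagrangianRadon.entryOp (Sum.inl k) (Sum.inr ()) h) p =
      2 * Real.pi * Complex.I * (p.2 k : ℂ) * fourierTau h p := by
  have := hh.fourierTau_fderiv_right (Pi.single k 1) p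
  rwa [single_one_dotProduct] at this

theorem fourierTau_entryOp_inl (hh : IsLocSchwartz h) (k l : Fin n) (p : Symm n × (Fin n → ℝ)) :
    fourierTau (LagrangianRadon.entryOp (Sum.inl k) (Sum.inl l) h) p =
      LagrangianRadon.entryOp (Sum.inl k) (Sum.inl l) (fourierTau h) p :=
  hh.fourierTau_fderiv_left _ p

theorem entryOp_inr_inr (h : Symm n × (Fin n → ℝ) → ℂ) :
    LagrangianRadon.entryOp (Sum.inr ()) (Sum.inr ()) h = fun _ => 0 :=
  funext fun p => map_zero (_root_.fderiv ℝ h p)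

theorem entryOp_zero (i j : Fin n ⊕ Unit) :
    LagrangianRadon.entryOp i j (fun _ : Symm n × (Fin n → ℝ) => (0 : ℂ)) = fun _ => 0 := by
  funext p
  simp [LagrangianRadon.entryOp]

theorem fourierTau_zero (p : Symm n × (Fin n → ℝ)) :
    fourierTau (fun _ => (0 : ℂ)) p = 0 := by
  simp [fourierTau]

/-- The determinantal system implies a system for the Fourier transform in `τ`. -/
theorem entryOp_fourierTau (hh : IsLocSchwartz h) (hd : SatisfiesDeterminantal h) (m k l : Fin n)
    (p : Symm n × (Fin n → ℝ)) :
    (p.2 m : ℂ) ^ 2 * LagrangianRadon.entryOp (Sum.inl k) (Sum.inl l) (fourierTau h) p =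
      p.2 m * p.2 k * LagrangianRadon.entryOp (Sum.inl m) (Sum.inl l) (fourierTau h) p +
      p.2 m * p.2 l * LagrangianRadon.entryOp (Sum.inl k) (Sum.inl m) (fourierTau h) p -
      p.2 k * p.2 l * LagrangianRadon.entryOp (Sum.inl m) (Sum.inl m) (fourierTau h) p := by
  by_cases hk : k = m
  · subst hk
    ring
  by_cases hl : l = m
  · subst hl
    ring
  -- The minor with rows m, k and columns m, l, both completed by the τ border. Its corner entry is
  -- zero, so two of the six terms drop out, and each of the others contains exactly two
  -- τ-derivatives, which become coordinates of ξ.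
  let r : Fin 3 → Fin n ⊕ Unit := ![Sum.inl m, Sum.inl k, Sum.inr ()]
  let c : Fin 3 → Fin n ⊕ Unit := ![Sum.inl m, Sum.inl l, Sum.inr ()]
  have hr : Function.Injective r := by
    intro i j hij
    fin_cases i <;> fin_cases j <;> simp_all [r, eq_comm]
  have hc : Function.Injective c := by
    intro i j hij
    fin_cases i <;> fin_cases j <;> simp_all [c, eq_comm]
  let g : Fin 3 → Fin 3 → Fin 3 → Symm n × (Fin n → ℝ) → ℂ := fun i j s =>
    LagrangianRadon.entryOp (r 0) (c i) (LagrangianRadon.entryOp (r 1) (c j)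
      (LagrangianRadon.entryOp (r 2) (c s) h))
  have hg : ∀ i j s, IsLocSchwartz (g i j s) := fun i j s => ((hh.entryOp _ _).entryOp _ _).entryOp _ _
  have h0 : fourierTau (minorOp r c h) p = 0 := by
    rw [show minorOp r c h = fun _ => 0 from funext (hd r c hr hc), fourierTau_zero]
  have h1 : fourierTau (minorOp r c h) p = ∑ σ : Equiv.Perm (Fin 3),
      ((Equiv.Perm.sign σ : ℤ) : ℂ) * fourierTau (g (σ 0) (σ 1) (σ 2)) p := by
    simp only [← fourierTau_const_mul]
    exact fourierTau_sum Finset.univ (fun σ _ => (hg (σ 0) (σ 1) (σ 2)).const_mul _) p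
  rw [h0, sum_perm_fin_three fun i j s => fourierTau (g i j s) p] at h1
  have e1 : fourierTau (g 0 1 2) p = 0 := by
    simp [g, r, c, entryOp_inr_inr, entryOp_zero, fourierTau_zero]
  have e2 : fourierTau (g 1 0 2) p = 0 := by
    simp [g, r, c, entryOp_inr_inr, entryOp_zero, fourierTau_zero]
  have e3 : fourierTau (g 0 2 1) p = (2 * Real.pi * Complex.I) ^ 2 * (p.2 k * p.2 l *
      LagrangianRadon.entryOp (Sum.inl m) (Sum.inl m) (fourierTau h) p) := by
    change fourierTau (LagrangianRadon.entryOp (Sum.inl m) (Sum.inl m)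
      (LagrangianRadon.entryOp (Sum.inl k) (Sum.inr ())
        (LagrangianRadon.entryOp (Sum.inl l) (Sum.inr ()) h))) p = _
    rw [(hh.entryOp _ _).entryOp_comm, hh.entryOp_comm, ((hh.entryOp _ _).entryOp _ _).fourierTau_entryOp_inr,
      (hh.entryOp _ _).fourierTau_entryOp_inr, hh.fourierTau_entryOp_inl]
    ring
  have e4 : fourierTau (g 1 2 0) p = (2 * Real.pi * Complex.I) ^ 2 * (p.2 m * p.2 k *
      LagrangianRadon.entryOp (Sum.inl m) (Sum.inl l) (fourierTau h) p) := by
    change fourierTau (LagrangianRadon.entryOp (Sum.inl m) (Sum.inl l)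
      (LagrangianRadon.entryOp (Sum.inl k) (Sum.inr ())
        (LagrangianRadon.entryOp (Sum.inl m) (Sum.inr ()) h))) p = _
    rw [(hh.entryOp _ _).entryOp_comm, hh.entryOp_comm, ((hh.entryOp _ _).entryOp _ _).fourierTau_entryOp_inr,
      (hh.entryOp _ _).fourierTau_entryOp_inr, hh.fourierTau_entryOp_inl]
    ring
  have e5 : fourierTau (g 2 0 1) p = (2 * Real.pi * Complex.I) ^ 2 * (p.2 m * p.2 l *
      LagrangianRadon.entryOp (Sum.inl k) (Sum.inl m) (fourierTau h) p) := by
    change fourierTau (LagrangianRadon.entryOp (Sum.inl m) (Sum.inr ())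
      (LagrangianRadon.entryOp (Sum.inl k) (Sum.inl m)
        (LagrangianRadon.entryOp (Sum.inl l) (Sum.inr ()) h))) p = _
    rw [hh.entryOp_comm, ((hh.entryOp _ _).entryOp _ _).fourierTau_entryOp_inr,
      (hh.entryOp _ _).fourierTau_entryOp_inr, hh.fourierTau_entryOp_inl]
    ring
  have e6 : fourierTau (g 2 1 0) p = (2 * Real.pi * Complex.I) ^ 2 * ((p.2 m : ℂ) ^ 2 *
      LagrangianRadon.entryOp (Sum.inl k) (Sum.inl l) (fourierTau h) p) := by
    change fourierTau (LagrangianRadon.entryOp (Sum.inl m) (Sum.inr ())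
      (LagrangianRadon.entryOp (Sum.inl k) (Sum.inl l)
        (LagrangianRadon.entryOp (Sum.inl m) (Sum.inr ()) h))) p = _
    rw [hh.entryOp_comm, ((hh.entryOp _ _).entryOp _ _).fourierTau_entryOp_inr,
      (hh.entryOp _ _).fourierTau_entryOp_inr, hh.fourierTau_entryOp_inl]
    ring
  rw [e1, e2, e3, e4, e5, e6] at h1
  have hpi : ((2 * Real.pi * Complex.I) ^ 2 : ℂ) ≠ 0 := by
    simp [Real.pi_ne_zero]
  refine mul_left_cancel₀ hpi ?_
  linear_combination h1

/-- Choose m with ξ_m ≠ 0. In the identity of `entryOp_fourierTau` every term on the right contains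
ξ_k or ξ_l, so contraction with S_kl annihilates it when Sξ = 0. -/
theorem fderiv_fourierTau_eq_zero (hh : IsLocSchwartz h) (hd : SatisfiesDeterminantal h)
    {p : Symm n × (Fin n → ℝ)} (hp : p.2 ≠ 0) {S : Symm n} (hS : S.toMatrix *ᵥ p.2 = 0) :
    _root_.fderiv ℝ (fourierTau h) p (S, 0) = 0 := by
  obtain ⟨m, hm⟩ := Function.ne_iff.1 hp
  have hm' : ((p.2 m : ℝ) : ℂ) ≠ 0 := by exact_mod_cast hm
  let A : Fin n → Fin n → ℂ := fun k l =>
    LagrangianRadon.entryOp (Sum.inl k) (Sum.inl l) (fourierTau h) p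
  have hA : ∀ k l, (p.2 m : ℂ) ^ 2 * A k l = p.2 m * p.2 k * A m l + p.2 m * p.2 l * A k m -
      p.2 k * p.2 l * A m m := fun k l => hh.entryOp_fourierTau hd m k l p
  have hS1 : ∀ k, ∑ l, (S s(k, l) : ℂ) * p.2 l = 0 := fun k => by
    exact_mod_cast congrFun hS k
  have hS2 : ∀ l, ∑ k, (S s(k, l) : ℂ) * p.2 k = 0 := fun l => by
    simpa only [Sym2.eq_swap (b := l)] using hS1 l
  -- The factor 2 arises because the sum runs over ordered pairs and each direction is E_kl + E_lk.
  have hdec : (2 : ℝ) • (S, (0 : Fin n → ℝ)) =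
      ∑ k, ∑ l, S s(k, l) • entryDir (Sum.inl k) (Sum.inl l) := by
    refine Prod.ext ?_ ?_
    · funext z
      induction z with | _ i j => ?_
      have h1 : ∀ k l, (entryDir (n := n) (Sum.inl k) (Sum.inl l)).1 s(i, j) =
        (entryDir (n := n) (Sum.inl k) (Sum.inl l)).1.toMatrix i j := fun k l => rfl
      simp only [Prod.fst_sum, Finset.sum_apply, Prod.smul_fst, Pi.smul_apply, h1,
        entryDir_toMatrix, smul_eq_mul]
      simp only [mul_add, Finset.sum_add_distrib, ite_and, mul_ite, mul_one, mul_zero,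
        Finset.sum_ite_eq, Finset.mem_univ, if_true]
      simp [Sym2.eq_swap (a := j), two_mul]
    · simp [Prod.snd_sum, entryDir]
  have h2 : 2 * _root_.fderiv ℝ (fourierTau h) p (S, 0) = ∑ k, ∑ l, (S s(k, l) : ℂ) * A k l := by
    have := congrArg (_root_.fderiv ℝ (fourierTau h) p) hdec
    simp only [map_smul, map_sum, Complex.real_smul] at this
    rwa [Complex.ofReal_ofNat] at this
  have h3 : (p.2 m : ℂ) ^ 2 * (2 * _root_.fderiv ℝ (fourierTau h) p (S, 0)) = 0 := by
    have t1 : ∑ k, ∑ l, (S s(k, l) : ℂ) * (p.2 m * p.2 k * A m l) = 0 := by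
      rw [Finset.sum_comm]
      refine Finset.sum_eq_zero fun l _ => ?_
      rw [← mul_zero (p.2 m * A m l : ℂ), ← hS2 l, Finset.mul_sum]
      exact Finset.sum_congr rfl fun k _ => by ring
    have t2 : ∑ k, ∑ l, (S s(k, l) : ℂ) * (p.2 m * p.2 l * A k m) = 0 := by
      refine Finset.sum_eq_zero fun k _ => ?_
      rw [← mul_zero (p.2 m * A k m : ℂ), ← hS1 k, Finset.mul_sum]
      exact Finset.sum_congr rfl fun l _ => by ring
    have t3 : ∑ k, ∑ l, (S s(k, l) : ℂ) * (p.2 k * p.2 l * A m m) = 0 := by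
      refine Finset.sum_eq_zero fun k _ => ?_
      rw [← mul_zero (p.2 k * A m m : ℂ), ← hS1 k, Finset.mul_sum]
      exact Finset.sum_congr rfl fun l _ => by ring
    rw [h2]
    simp only [Finset.mul_sum, mul_left_comm _ (S _ : ℂ), hA, mul_sub, mul_add,
      Finset.sum_add_distrib, Finset.sum_sub_distrib] at t1 t2 t3 ⊢
    rw [t1, t2, t3, add_zero, sub_zero]
  have h4 := (mul_eq_zero.1 h3).resolve_left (pow_ne_zero 2 hm')
  exact (mul_eq_zero.1 h4).resolve_left two_ne_zero

/-- The Fourier transform in `τ` depends on `ξ` and `Tξ` only. -/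
theorem fourierTau_eq_of_mulVec_eq (hh : IsLocSchwartz h) (hd : SatisfiesDeterminantal h)
    {ξ : Fin n → ℝ} (hξ : ξ ≠ 0) {T T' : Symm n} (hT : T.toMatrix *ᵥ ξ = T'.toMatrix *ᵥ ξ) :
    fourierTau h (T, ξ) = fourierTau h (T', ξ) := by
  have hS : (T' - T).toMatrix *ᵥ ξ = 0 := by
    rw [sub_eq_add_neg, Symm.toMatrix_add, Symm.toMatrix_neg, Matrix.add_mulVec, Matrix.neg_mulVec,
      hT, add_neg_cancel]
  have hcurve : ∀ t : ℝ, HasDerivAt (fun t : ℝ => fourierTau h (T + t • (T' - T), ξ)) 0 t := by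
    intro t
    have h1 : HasDerivAt (fun t : ℝ => (T + t • (T' - T), ξ)) (T' - T, 0) t := by
      refine HasDerivAt.prodMk ?_ (hasDerivAt_const _ _)
      simpa using ((hasDerivAt_id t).smul_const (T' - T)).const_add T
    have h2 := (hh.differentiable_fourierTau (T + t • (T' - T), ξ)).hasFDerivAt.comp_hasDerivAt t h1
    rwa [hh.fderiv_fourierTau_eq_zero hd (p := (T + t • (T' - T), ξ)) hξ hS] at h2
  have h3 := is_const_of_deriv_eq_zero (fun t => (hcurve t).differentiableAt)
    (fun t => (hcurve t).deriv) 0 1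
  simpa using h3

end IsLocSchwartz

/-! ### The two charts -/

/-- The function of `(T, τ)` that represents a function on the affine Lagrangian Grassmannian in
a chart, with the factor that turns the Euclidean volume into the coordinate volume. -/
noncomputable def inChart (c : Symm n × (Fin n → ℝ) → AL n) (F : AL n → ℂ)
    (p : Symm n × (Fin n → ℝ)) : ℂ :=
  (((√(1 + p.1.toMatrix ^ 2).det)⁻¹ : ℝ) : ℂ) * F (c p)

theorem isLocSchwartz_inChart {c : Symm n × (Fin n → ℝ) → AL n} (hc : IsTranslationChart c)
    {F : AL n → ℂ} (hF : IsSchwartz F) : IsLocSchwartz (inChart c F) :=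
  (hc.isLocSchwartz hF).mul_left contDiff_sqrt_det_inv

theorem coPlane_eq_graphPlane {T U : Symm n} (h : T.toMatrix * U.toMatrix = 1) (τ : Fin n → ℝ) :
    coPlane (U, -(U.toMatrix *ᵥ τ)) = graphPlane (T, τ) := by
  refine AL.eq_of_le fun v hv => mem_graphPlane.2 fun i => ?_
  have h1 : (fun j => v (Sum.inr j)) =
      U.toMatrix *ᵥ (fun j => v (Sum.inl j)) - U.toMatrix *ᵥ τ := by
    funext j
    rw [mem_coPlane.1 hv j]
    simp [sub_eq_add_neg]
  rw [h1, ← Matrix.mulVec_sub, Matrix.mulVec_mulVec, h, Matrix.one_mulVec, Pi.sub_apply]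
  ring

/-- From 1 + T² = T²(1 + U²): the densities of the two charts differ by |det T|. -/
theorem sqrt_det_one_add_sq {T U : Symm n} (h : T.toMatrix * U.toMatrix = 1) :
    √(1 + T.toMatrix ^ 2).det = |T.toMatrix.det| * √(1 + U.toMatrix ^ 2).det := by
  have h1 : 1 + T.toMatrix ^ 2 = T.toMatrix ^ 2 * (1 + U.toMatrix ^ 2) := by
    have h2 : T.toMatrix ^ 2 * U.toMatrix ^ 2 = 1 := by
      rw [sq, sq, Matrix.mul_assoc, ← Matrix.mul_assoc T.toMatrix U.toMatrix, h, Matrix.one_mul, h]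
    rw [Matrix.mul_add, h2, Matrix.mul_one, add_comm]
  rw [h1, Matrix.det_mul, Matrix.det_pow, Real.sqrt_mul (sq_nonneg _), Real.sqrt_sq_eq_abs]

theorem inChart_graphPlane {T U : Symm n} (h : T.toMatrix * U.toMatrix = 1) (F : AL n → ℂ)
    (τ : Fin n → ℝ) : inChart graphPlane F (T, τ) =
      ((|T.toMatrix.det|⁻¹ : ℝ) : ℂ) * inChart coPlane F (U, -(U.toMatrix *ᵥ τ)) := by
  rw [inChart, inChart, coPlane_eq_graphPlane h, sqrt_det_one_add_sq h, mul_inv, ← mul_assoc]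
  push_cast
  rfl

theorem integral_comp_mulVec {M : Matrix (Fin n) (Fin n) ℝ} (hM : M.det ≠ 0)
    {ψ : (Fin n → ℝ) → ℂ} (hψ : Continuous ψ) :
    ∫ τ, ψ (M *ᵥ τ) = ((|M.det|⁻¹ : ℝ) : ℂ) * ∫ τ, ψ τ := by
  have h1 : ∫ τ, ψ τ ∂(Measure.map (Matrix.toLin' M) volume) = ∫ τ, ψ (M *ᵥ τ) :=
    integral_map (LinearMap.continuous_of_finiteDimensional _).aemeasurable
      hψ.aestronglyMeasurable
  rw [← h1, Real.map_matrix_volume_pi_eq_smul_volume_pi hM, integral_smul_measure,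
    ENNReal.toReal_ofReal (abs_nonneg _), Complex.real_smul, abs_inv]

/-- Substitute σ = -Uτ. The phase is preserved because σ·(-Tξ) = τ·ξ, and the Jacobian cancels the
quotient of the two densities. Hence both charts prescribe the same value at (ξ, -Tξ). -/
theorem fourierTau_inChart_graphPlane {F : AL n → ℂ} (hF : IsSchwartz F) {T U : Symm n}
    (h : T.toMatrix * U.toMatrix = 1) (ξ : Fin n → ℝ) :
    fourierTau (inChart graphPlane F) (T, ξ) =
      fourierTau (inChart coPlane F) (U, -(T.toMatrix *ᵥ ξ)) := by
  have hdet : T.toMatrix.det * U.toMatrix.det = 1 := by rw [← Matrix.det_mul, h, Matrix.det_one]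
  have hU : U.toMatrix.det ≠ 0 := right_ne_zero_of_mul_eq_one hdet
  have hU' : (-U.toMatrix).det ≠ 0 := by
    rw [Matrix.det_neg]
    exact mul_ne_zero (pow_ne_zero _ (by norm_num)) hU
  have habs : |T.toMatrix.det|⁻¹ * |(-U.toMatrix).det|⁻¹ = 1 := by
    rw [Matrix.det_neg, abs_mul, abs_pow, abs_neg, abs_one, one_pow, one_mul, ← mul_inv, ← abs_mul,
      hdet, abs_one, inv_one]
  have hc : Continuous fun σ => expPhase σ (-(T.toMatrix *ᵥ ξ)) * inChart coPlane F (U, σ) :=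
    (continuous_expPhase_left _).mul
      ((isLocSchwartz_inChart isTranslationChart_coPlane hF).continuous_slice U)
  have key := integral_comp_mulVec hU' hc
  have hphase : ∀ τ, expPhase ((-U.toMatrix) *ᵥ τ) (-(T.toMatrix *ᵥ ξ)) = expPhase τ ξ := by
    intro τ
    rw [expPhase, expPhase, Matrix.neg_mulVec, neg_dotProduct_neg, ← T.mulVec_dotProduct,
      Matrix.mulVec_mulVec, h, Matrix.one_mulVec]
  calc fourierTau (inChart graphPlane F) (T, ξ)
      = ((|T.toMatrix.det|⁻¹ : ℝ) : ℂ) * ∫ τ, expPhase ((-U.toMatrix) *ᵥ τ) (-(T.toMatrix *ᵥ ξ)) *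
          inChart coPlane F (U, (-U.toMatrix) *ᵥ τ) := by
        rw [fourierTau, ← integral_const_mul]
        congr 1
        funext τ
        simp only [hphase]
        rw [Matrix.neg_mulVec]
        rw [inChart_graphPlane h]
        ring
    _ = _ := by
        rw [key, ← mul_assoc, ← Complex.ofReal_mul, habs, Complex.ofReal_one, one_mul]
        rfl

theorem exists_inverse {T : Symm n} (hT : T.toMatrix.det ≠ 0) :
    ∃ U : Symm n, U.toMatrix * T.toMatrix = 1 ∧ T.toMatrix * U.toMatrix = 1 := by
  have hs : (T.toMatrix⁻¹).IsSymm := by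
    rw [Matrix.IsSymm, Matrix.transpose_nonsing_inv, T.isSymm_toMatrix.eq]
  have hU : ((Symm.equivSymmetric n).symm ⟨_, hs⟩).toMatrix = T.toMatrix⁻¹ :=
    congrArg Subtype.val ((Symm.equivSymmetric n).apply_symm_apply ⟨_, hs⟩)
  refine ⟨(Symm.equivSymmetric n).symm ⟨_, hs⟩, ?_, ?_⟩ <;> rw [hU]
  · exact Matrix.nonsing_inv_mul _ (isUnit_iff_ne_zero.2 hT)
  · exact Matrix.mul_nonsing_inv _ (isUnit_iff_ne_zero.2 hT)

/-- The determinant is the characteristic polynomial of -T at ε, so it has finitely many zeros. -/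
theorem eventually_det_ne_zero (T : Symm n) :
    ∀ᶠ ε : ℝ in 𝓝[≠] 0, (T + ε • Symm.one n).toMatrix.det ≠ 0 := by
  have h1 : ∀ ε : ℝ, (T + ε • Symm.one n).toMatrix.det = (-T.toMatrix).charpoly.eval ε := by
    intro ε
    rw [Matrix.eval_charpoly, Symm.toMatrix_add, Symm.toMatrix_smul, Symm.toMatrix_one,
      sub_neg_eq_add, add_comm, Matrix.smul_one_eq_diagonal]
    rfl
  have hne : (-T.toMatrix).charpoly ≠ 0 := (Matrix.charpoly_monic _).ne_zero
  have hfin : {ε : ℝ | (-T.toMatrix).charpoly.IsRoot ε}.Finite :=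
    Polynomial.finite_setOfPred_isRoot hne
  have h2 := (hfin.subset (Set.sdiff_subset (t := {0}))).isClosed.isOpen_compl.mem_nhds
    (x := (0 : ℝ)) (by simp)
  filter_upwards [mem_nhdsWithin_of_mem_nhds h2, self_mem_nhdsWithin] with ε h3 h4
  rw [h1]
  exact fun h5 => h3 ⟨h5, h4⟩

/-- The common extension of the two Fourier transforms to phase space. -/
noncomputable def phaseFunction (F : AL n → ℂ) (p : (Fin n → ℝ) × (Fin n → ℝ)) : ℂ :=
  open Classical in
  if p.1 = 0 then fourierTau (inChart coPlane F) (0, p.2)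
  else fourierTau (inChart graphPlane F) (-symmOfMulVec p, p.1)

/-- The determinantal system is assumed in the first chart only. The first family of slices follows
from it directly; for the second, invertible T reduce to the first chart, and the remaining T are
limits of T + ε. -/
theorem hasSlices_phaseFunction {F : AL n → ℂ} (hF : IsSchwartz F)
    (hd : SatisfiesDeterminantal (inChart graphPlane F)) :
    HasSlices (phaseFunction F) (inChart graphPlane F) (inChart coPlane F) := by
  have hL₁ := isLocSchwartz_inChart isTranslationChart_graphPlane hF
  have hL₂ := isLocSchwartz_inChart isTranslationChart_coPlane hF
  have hinv : ∀ (T : Symm n) (η : Fin n → ℝ), η ≠ 0 → T.toMatrix.det ≠ 0 →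
      fourierTau (inChart coPlane F) (T, η) = fourierTau (inChart graphPlane F)
        (-symmOfMulVec (-(T.toMatrix *ᵥ η), η), -(T.toMatrix *ᵥ η)) := by
    intro T η hη hT
    obtain ⟨U, hUT, hTU⟩ := exists_inverse hT
    have hne : -(T.toMatrix *ᵥ η) ≠ 0 := by
      intro h0
      refine hη ?_
      rw [← Matrix.one_mulVec η, ← hUT, ← Matrix.mulVec_mulVec, neg_eq_zero.1 h0, Matrix.mulVec_zero]
    have h1 := fourierTau_inChart_graphPlane hF hUT (-(T.toMatrix *ᵥ η))
    have h2 : -(U.toMatrix *ᵥ -(T.toMatrix *ᵥ η)) = η := by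
      rw [Matrix.mulVec_neg, neg_neg, Matrix.mulVec_mulVec, hUT, Matrix.one_mulVec]
    rw [h2] at h1
    rw [← h1]
    refine hL₁.fourierTau_eq_of_mulVec_eq hd hne ?_
    have h3 : (symmOfMulVec (-(T.toMatrix *ᵥ η), η)).toMatrix *ᵥ -(T.toMatrix *ᵥ η) = η :=
      symmOfMulVec_mulVec (p := (-(T.toMatrix *ᵥ η), η)) hne
    rw [Symm.toMatrix_neg, Matrix.neg_mulVec, h3]
    exact neg_eq_iff_eq_neg.1 h2
  have hlim : ∀ (T : Symm n) (η : Fin n → ℝ), Tendsto (fun ε : ℝ =>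
      fourierTau (inChart coPlane F) (T + ε • Symm.one n, η)) (𝓝[≠] 0)
        (𝓝 (fourierTau (inChart coPlane F) (T, η))) := by
    intro T η
    have hc : Continuous fun ε : ℝ => fourierTau (inChart coPlane F) (T + ε • Symm.one n, η) :=
      hL₂.continuous_fourierTau.comp (by fun_prop)
    simpa using (hc.tendsto 0).mono_left nhdsWithin_le_nhds
  have hmul : ∀ (T : Symm n) (ε : ℝ) (η : Fin n → ℝ),
      (T + ε • Symm.one n).toMatrix *ᵥ η = T.toMatrix *ᵥ η + ε • η := by
    intro T ε η
    rw [Symm.toMatrix_add, Symm.toMatrix_smul, Symm.toMatrix_one, Matrix.add_mulVec,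
      Matrix.smul_mulVec, Matrix.one_mulVec]
  refine ⟨hL₁, hL₂, fun T ξ hξ => ?_, fun T η hη => ?_⟩
  · rw [phaseFunction, if_neg hξ]
    refine hL₁.fourierTau_eq_of_mulVec_eq hd hξ ?_
    rw [Symm.toMatrix_neg, Matrix.neg_mulVec,
      symmOfMulVec_mulVec (p := (ξ, -(T.toMatrix *ᵥ ξ))) hξ, neg_neg]
  -- If Tη = 0, the point (0, η) lies outside the first family. Then T + ε and 0 + ε agree on η and
  -- are both invertible for small ε ≠ 0, so T may be replaced by 0, the matrix used in
  -- `phaseFunction`. Otherwise the formula of the first chart is continuous at (-Tη, η).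
  · by_cases h0 : T.toMatrix *ᵥ η = 0
    · rw [phaseFunction, if_pos (by simp [h0])]
      refine tendsto_nhds_unique_of_eventuallyEq (hlim T η) (hlim 0 η) ?_
      filter_upwards [eventually_det_ne_zero T, eventually_det_ne_zero 0] with ε h1 h2
      rw [hinv _ η hη h1, hinv _ η hη h2, hmul, hmul, h0, Symm.toMatrix_zero, Matrix.zero_mulVec]
    · have hne : -(T.toMatrix *ᵥ η) ≠ 0 := neg_ne_zero.2 h0
      rw [phaseFunction, if_neg hne]
      refine tendsto_nhds_unique_of_eventuallyEq (hlim T η)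
        (g := fun ε : ℝ => fourierTau (inChart graphPlane F)
          (-symmOfMulVec (-(T.toMatrix *ᵥ η + ε • η), η), -(T.toMatrix *ᵥ η + ε • η))) ?_ ?_
      · have h1 : ContinuousAt (fun q : (Fin n → ℝ) × (Fin n → ℝ) =>
            fourierTau (inChart graphPlane F) (-symmOfMulVec q, q.1)) (-(T.toMatrix *ᵥ η), η) :=
          ContinuousAt.comp (g := fourierTau (inChart graphPlane F))
            hL₁.continuous_fourierTau.continuousAt
            ((contDiffAt_symmOfMulVec (p := (-(T.toMatrix *ᵥ η), η)) hne).continuousAt.neg.prodMk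
              continuousAt_fst)
        have h2 : Continuous fun ε : ℝ => (-(T.toMatrix *ᵥ η + ε • η), η) := by fun_prop
        have h3 : Tendsto (fun ε : ℝ => (-(T.toMatrix *ᵥ η + ε • η), η)) (𝓝[≠] 0)
            (𝓝 (-(T.toMatrix *ᵥ η), η)) := by
          simpa using (h2.tendsto 0).mono_left nhdsWithin_le_nhds
        exact h1.tendsto.comp h3
      · filter_upwards [eventually_det_ne_zero T] with ε h1
        rw [hinv _ η hη h1, hmul]

theorem exists_eq_radonFlat (hn : 1 < n) {h : Symm n × (Fin n → ℝ) → ℂ} (hS : MemSchwartzFlat h)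
    (hd : SatisfiesDeterminantal h) : ∃ f : 𝓢(PhaseSpace n, ℂ), h = radonFlat f := by
  obtain ⟨F, hF, hFh⟩ := hS
  have hh : h = inChart graphPlane F := funext fun p => by
    rw [← Prod.mk.eta (p := p), hFh, Complex.real_smul]
    rfl
  rw [hh] at hd ⊢
  obtain ⟨f, hf⟩ := (hasSlices_phaseFunction hF hd).exists_schwartz hn
  exact radonFlat_eq_of_fourierTau (isLocSchwartz_inChart isTranslationChart_graphPlane hF) f hf

end LagrangianRadon

theorem mainTheorem1 (n : ℕ) (hn : 1 < n)
    (h : LagrangianRadon.Symm n × (Fin n → ℝ) → ℂ) :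
    (∃ f : 𝓢(LagrangianRadon.PhaseSpace n, ℂ), h = LagrangianRadon.radonFlat f) ↔
      LagrangianRadon.MemSchwartzFlat h ∧ LagrangianRadon.SatisfiesDeterminantal h := by
  constructor
  · rintro ⟨f, rfl⟩
    exact ⟨LagrangianRadon.memSchwartzFlat_radonFlat f,
      LagrangianRadon.satisfiesDeterminantal_radonFlat f⟩
  · rintro ⟨hS, hd⟩
    exact LagrangianRadon.exists_eq_radonFlat hn hS hd
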